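/- For $r\in\mathbb N$ and $u,v\in\{0,\dots,2^r-1\}$ let $Q_r(u,v)=2^{-r}\big([u,u+1)\times[v,v+1)\big)$, and let $\mathcal Q$ be the set of all these dyadic squares in $[0,1)^2$. A martingale is a function $d:\mathcal Q\to[0,\infty)$ with $$d(Q_r(u,v))=\tfrac14\sum_{\alpha,\beta\in\{0,1\}}d(Q_{r+1}(2u+\alpha,2v+\beta))$$ for all $Q_r(u,v)\in\mathcal Q$. Its success set $S^\infty[d]$ is the set of all $(x,y)\in[0,1)^2$ with $\limsup_{r\to\infty}d(Q_r(\lfloor 2^rx\rfloor,\lfloor 2^ry\rfloor))=\infty$. The martingale $d$ is double exponential time computable if there is a function $\hat d:\mathcal Q\times\mathbb N\to\mathbb Q$ with $|d(Q_r(u,v))-\hat d(Q_r(u,v),t)|<2^{-t}$ for all $Q_r(u,v)\in\mathcal Q$ and $t\in\mathbb N$, such that $\hat d(Q_r(u,v),t)$ is computable by a Turing machine, from $r,u,v,t$ in binary, in time $2^{2^{O(r+t)}}$. A set $E\subseteq\mathbb R^2$ has ee-measure $0$ if there is a double exponential time computable martingale $d$ with $[0,1)^2\cap\bigcup_{i,j\in\mathbb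 Z}(E-(i,j))\subseteq S^\infty[d]$. A point of $\mathbb R^2$ is double exponential time random (ee-random) if it belongs to no set of ee-measure $0$. Corollary. For every direction $\theta\in[0,2\pi)$ there is a line in $\mathbb R^2$ in direction $\theta$ that contains no ee-random point. Equivalently, there is a Kakeya set in $\mathbb R^2$, given as a union of a family of unit-length line segments that includes a segment in every direction, whose lineal extension (the union of all lines that contain a segment of the family) contains no ee-random point. -/

import Mathlib

open Filter Set
open scoped NNReal ENNReal

/-- The Euclidean plane. -/
abbrev Plane : Type := EuclideanSpace ℝ (Fin 2)

/-- The unit square `[0,1)²`. -/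
def unitSquare : Set Plane := {p | ∀ i, p i ∈ Ico (0 : ℝ) 1}

/-- The dyadic square `Q_r(u,v) = 2^{-r}([u,u+1) × [v,v+1))` inside `[0,1)²`, given by its
level `r` and its integer coordinates `u, v ∈ {0,…,2^r-1}` (which determine it uniquely). -/
@[ext]
structure DyadicSquare where
  r : ℕ
  u : ℕ
  v : ℕ
  hu : u < 2 ^ r
  hv : v < 2 ^ r

namespace DyadicSquare

/-- The subset of the plane that the dyadic square is. -/
def toSet (Q : DyadicSquare) : Set Plane :=
  {p | p 0 ∈ Ico ((Q.u : ℝ) / 2 ^ Q.r) ((Q.u + 1 : ℝ) / 2 ^ Q.r) ∧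
       p 1 ∈ Ico ((Q.v : ℝ) / 2 ^ Q.r) ((Q.v + 1 : ℝ) / 2 ^ Q.r)}

/-- The immediate subsquare `Q_{r+1}(2u+α, 2v+β)` of `Q_r(u,v)`, for `α, β ∈ {0,1}`. -/
def child (Q : DyadicSquare) (α β : Fin 2) : DyadicSquare where
  r := Q.r + 1
  u := 2 * Q.u + α
  v := 2 * Q.v + β
  hu := by have := Q.hu; have := α.isLt; rw [pow_succ]; omega
  hv := by have := Q.hv; have := β.isLt; rw [pow_succ]; omega

theorem floor_lt_two_pow (r : ℕ) {x : ℝ} (hx : x ∈ Ico (0 : ℝ) 1) :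
    ⌊(2 : ℝ) ^ r * x⌋₊ < 2 ^ r := by
  have h2 : (0 : ℝ) < 2 ^ r := by positivity
  rw [Nat.floor_lt (mul_nonneg h2.le hx.1)]
  push_cast
  nlinarith [hx.2]

/-- The `r`-dyadic square `Q_r(⌊2^r x⌋, ⌊2^r y⌋)` that contains the point `(x,y) ∈ [0,1)²`. -/
noncomputable def containing (r : ℕ) (p : Plane) (hp : p ∈ unitSquare) : DyadicSquare where
  r := r
  u := ⌊(2 : ℝ) ^ r * p 0⌋₊
  v := ⌊(2 : ℝ) ^ r * p 1⌋₊
  hu := floor_lt_two_pow r (hp 0)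
  hv := floor_lt_two_pow r (hp 1)

theorem mem_toSet_containing (r : ℕ) (p : Plane) (hp : p ∈ unitSquare) :
    p ∈ (containing r p hp).toSet := by
  have h2 : (0 : ℝ) < 2 ^ r := by positivity
  have key : ∀ x : ℝ, 0 ≤ x → x ∈ Ico ((⌊(2 : ℝ) ^ r * x⌋₊ : ℝ) / 2 ^ r)
      ((⌊(2 : ℝ) ^ r * x⌋₊ + 1 : ℝ) / 2 ^ r) := by
    intro x hx
    refine ⟨?_, ?_⟩
    · rw [div_le_iff₀ h2, mul_comm x]
      exact Nat.floor_le (by positivity)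
    · rw [lt_div_iff₀ h2, mul_comm x]
      exact Nat.lt_floor_add_one _
  exact ⟨key _ (hp 0).1, key _ (hp 1).1⟩

end DyadicSquare

/-- A martingale on `[0,1)²`: a nonnegative function on the dyadic squares whose value at each
square is the average of its values at the four immediate subsquares. -/
def IsMartingale (d : DyadicSquare → ℝ≥0) : Prop :=
  ∀ Q : DyadicSquare, d Q = 1 / 4 * ∑ α : Fin 2, ∑ β : Fin 2, d (Q.child α β)

/-- The success set `S^∞[d]`: the points of `[0,1)²` along whose dyadic squares the limsup of
the values of `d` is infinite. -/
def successSet (d : DyadicSquare → ℝ≥0) : Set Plane :=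
  {p | ∃ hp : p ∈ unitSquare,
    limsup (fun r : ℕ => (d (DyadicSquare.containing r p hp) : ℝ≥0∞)) atTop = ⊤}

/-- The binary expansion of a natural number as a word over `{0, 1, #}`; `none` is the
separator `#`. -/
def binaryWord (n : ℕ) : List (Option Bool) := (Computability.encodeNat n).map some

/-- The input word `r#u#v#t` for the query `(Q_r(u,v), t)`, all numbers in binary. -/
def queryWord (Q : DyadicSquare) (t : ℕ) : List (Option Bool) :=
  binaryWord Q.r ++ none :: (binaryWord Q.u ++ none :: (binaryWord Q.v ++ none :: binaryWord t))

/-- The word `w` represents the rational number `q`: it consists of a sign bit, a numerator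
`a` and a denominator `b > 0` in binary (not necessarily in lowest terms) with `q = ± a / b`. -/
def RepresentsRat (w : List (Option Bool)) (q : ℚ) : Prop :=
  ∃ (s : Bool) (a b : ℕ), 0 < b ∧ w = some s :: (binaryWord a ++ none :: binaryWord b) ∧
    q = (if s then -1 else 1) * ((a : ℚ) / (b : ℚ))

/-- `f(Q_r(u,v), t)` is computable in time `2^(2^(O(r+t)))`: some multi-stack Turing machine with
finite alphabets (and finitely many states and labels) halts on every input `(Q_r(u,v), t)`
after at most `2^(2^(c(r+t)+c))` steps, its output being a representation of `f(Q_r(u,v), t)`. -/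
def DoubleExpTimeComputable (f : DyadicSquare → ℕ → ℚ) : Prop :=
  ∃ (M : Turing.TM2ComputableAux (Option Bool) (Option Bool)) (c : ℕ),
    (∀ k, Finite (M.tm.Γ k)) ∧
    ∀ (Q : DyadicSquare) (t : ℕ), ∃ w : List (Option Bool), RepresentsRat w (f Q t) ∧
      Nonempty (Turing.TM2OutputsInTime M.tm
        ((queryWord Q t).map M.inputAlphabet.symm)
        (some (w.map M.outputAlphabet.symm))
        (2 ^ 2 ^ (c * (Q.r + t) + c)))

/-- A function on dyadic squares is double exponential time computable if it has a rational
approximation `d̂(Q,t)` with error `< 2^{-t}` that is computable in time `2^(2^(O(r+t)))`. -/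
def IsEEComputable (d : DyadicSquare → ℝ≥0) : Prop :=
  ∃ dhat : DyadicSquare → ℕ → ℚ,
    (∀ (Q : DyadicSquare) (t : ℕ), |(d Q : ℝ) - (dhat Q t : ℝ)| < ((2 : ℝ) ^ t)⁻¹) ∧
    DoubleExpTimeComputable dhat

/-- `#E = [0,1)² ∩ ⋃_{i,j ∈ ℤ} (E - (i,j))`. -/
def hashSet (E : Set Plane) : Set Plane :=
  unitSquare ∩ ⋃ (i : ℤ) (j : ℤ), (fun p : Plane => p - !₂[(i : ℝ), (j : ℝ)]) '' E

/-- `E` has double exponential time measure 0. -/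
def HasEEMeasureZero (E : Set Plane) : Prop :=
  ∃ d : DyadicSquare → ℝ≥0, IsMartingale d ∧ IsEEComputable d ∧ hashSet E ⊆ successSet d

/-- A point is double exponential time random if it lies in no set of ee-measure 0. -/
def IsEERandom (p : Plane) : Prop := ∀ E : Set Plane, HasEEMeasureZero E → p ∉ E

/-- The unit vector in direction `θ`. -/
noncomputable def dirVec (θ : ℝ) : Plane := !₂[Real.cos θ, Real.sin θ]

/-- The line through `p` in direction `θ`. -/
def lineThrough (p : Plane) (θ : ℝ) : Set Plane := range fun s : ℝ => p + s • dirVec θ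

/-- The unit-length line segment that starts at `p` and has direction `θ`. -/
def unitSegment (p : Plane) (θ : ℝ) : Set Plane := segment ℝ p (p + dirVec θ)

/-- A Kakeya set contains unit-length line segments in all directions. -/
def IsKakeya (K : Set Plane) : Prop :=
  ∀ θ ∈ Ico (0 : ℝ) (2 * Real.pi), ∃ p : Plane, unitSegment p θ ⊆ K

/-- The lineal extension of a union of line segments (given as the family `S` of those
segments): the union of all lines that contain one of the segments. -/
def linealExtension (S : Set (Set Plane)) : Set Plane :=
  ⋃₀ {L | (∃ p θ, L = lineThrough p θ) ∧ ∃ I ∈ S, I ⊆ L}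

/-! Lines with slope in `[z, z + 1)` are parametrised by the binary digits `d_l` of `a`, the slope
minus `z`. The line of slope `z + a` is `y = (z + a) x - τ(a)` with `τ(a) = ∑ d_l 2^-(l+1) focus l`,
so that `y = z x + ∑ d_l 2^-(l+1) (x - focus l)`: over the abscissa `focus l` the `l`-th digit has
no influence. The foci with `8^s ≤ l < 8^(s+1)` sweep across `[-2^s, 2^s]` in steps of `2^-s`,
resting at each place for `2^s` digits.

Let `|x| ≤ 2^s`, and let `n` be the first index of block `s` at which the foci are within `2^-s` of
`x`. The next `2^s` digits are damped by `2^-s` and the later ones by their size, so the digits from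
`n` on move the line over `x` by only `O(2^-(n+s))` (`focus_bound`, `abs_line_sub_le`). The first
`n` digits leave `2^n` strips of that height, so the vertical section of the family over `x` is
covered by strips of total length `O(2^-s)`. Since `n + s ≤ 16^s` for large `s`, the strips can be
counted on the grid of cells of side `2^-16^s`: the cells over a unit square get total weight
`O(2^-s)` relative to their number (`sum_stripCount_le`), while every point of the family lies in a
cell of weight at least `1` at all late stages (`one_le_stripCount`).

An effective Borel-Cantelli lemma (`hasEEMeasureZero_of_weights`) converts such weights into a
martingale: the sum over `s` of the averages of the weights converges geometrically, and it tends to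
infinity along every point that is charged infinitely often. Its approximation to within `2^-t` at
level `r` is a partial sum with `S = t + 2r + O(1)` terms, computable in time polynomial in `N =
2^16^S`, which is double exponential in `r + t`.

The running time is proved on an actual machine model. Structured programs compile to multi-stack
machines (`Exec.outputsInTime`), and stacks used as unary counters support a calculus of functions
computable in time polynomial in the values of their arguments. As `N` is itself an argument there,
brute-force sums over all cells and all digit strings are allowed
(`doubleExpTimeComputable_of_polyComp`).

Non-vertical directions are covered by the family, and the vertical one by the line `x = 0`. Unit
segments on the chosen lines form the Kakeya set. -/

/-! ### Structured programs on stacks -/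

namespace StackProg

/-- The contents of countably many stacks over the alphabet `{0, 1, #}`. -/
abbrev Store : Type := ℕ → List (Option Bool)

/-- Structured programs acting on a store; tests look at the top symbol of one stack. -/
inductive Prog : Type
  | skip : Prog
  | push (j : ℕ) (a : Option Bool) : Prog
  | pop (j : ℕ) : Prog
  | seq (P Q : Prog) : Prog
  | ite (j : ℕ) (c : Option (Option Bool) → Bool) (P Q : Prog) : Prog
  | loop (j : ℕ) (c : Option (Option Bool) → Bool) (P : Prog) : Prog

namespace Prog

/-- All stacks that the program mentions have an index below `n`. -/
def UsesBelow (n : ℕ) : Prog → Prop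
  | skip => True
  | push j _ => j < n
  | pop j => j < n
  | seq P Q => P.UsesBelow n ∧ Q.UsesBelow n
  | ite j _ P Q => j < n ∧ P.UsesBelow n ∧ Q.UsesBelow n
  | loop j _ P => j < n ∧ P.UsesBelow n

theorem UsesBelow.mono {m n : ℕ} (h : m ≤ n) {P : Prog} (hP : P.UsesBelow m) : P.UsesBelow n := by
  induction P with
  | skip => trivial
  | push j a => exact lt_of_lt_of_le hP h
  | pop j => exact lt_of_lt_of_le hP h
  | seq P Q ihP ihQ => exact ⟨ihP hP.1, ihQ hP.2⟩
  | ite j c P Q ihP ihQ => exact ⟨lt_of_lt_of_le hP.1 h, ihP hP.2.1, ihQ hP.2.2⟩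
  | loop j c P ihP => exact ⟨lt_of_lt_of_le hP.1 h, ihP hP.2⟩

/-- `P.Exec S S' n`: started in `S`, the program `P` ends in `S'` after `n` steps. -/
inductive Exec : Prog → Store → Store → ℕ → Prop
  | skip (S : Store) : Exec skip S S 1
  | push (S : Store) (j : ℕ) (a : Option Bool) :
      Exec (push j a) S (Function.update S j (a :: S j)) 1
  | pop (S : Store) (j : ℕ) : Exec (pop j) S (Function.update S j (S j).tail) 1
  | seq {P Q : Prog} {S S' S'' : Store} {m n : ℕ} :
      Exec P S S' m → Exec Q S' S'' n → Exec (seq P Q) S S'' (m + n)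
  | iteTrue {P Q : Prog} {S S' : Store} {j : ℕ} {c : Option (Option Bool) → Bool} {m : ℕ} :
      c (S j).head? = true → Exec P S S' m → Exec (ite j c P Q) S S' (m + 1)
  | iteFalse {P Q : Prog} {S S' : Store} {j : ℕ} {c : Option (Option Bool) → Bool} {m : ℕ} :
      c (S j).head? = false → Exec Q S S' m → Exec (ite j c P Q) S S' (m + 1)
  | loopFalse {P : Prog} {S : Store} {j : ℕ} {c : Option (Option Bool) → Bool} :
      c (S j).head? = false → Exec (loop j c P) S S 1
  | loopTrue {P : Prog} {S S' S'' : Store} {j : ℕ} {c : Option (Option Bool) → Bool} {m n : ℕ} :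
      c (S j).head? = true → Exec P S S' m → Exec (loop j c P) S' S'' n →
      Exec (loop j c P) S S'' (m + n + 1)

/-- The control labels of a program. -/
def Label : Prog → Type
  | skip => Unit
  | push _ _ => Unit
  | pop _ => Unit
  | seq P Q => P.Label ⊕ Q.Label
  | ite _ _ P Q => Option (P.Label ⊕ Q.Label)
  | loop _ _ P => Option P.Label

/-- A program has finitely many labels. -/
@[reducible]
def labelFintype : (P : Prog) → Fintype P.Label
  | skip => inferInstanceAs (Fintype Unit)
  | push _ _ => inferInstanceAs (Fintype Unit)
  | pop _ => inferInstanceAs (Fintype Unit)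
  | seq P Q =>
    letI := P.labelFintype
    letI := Q.labelFintype
    inferInstanceAs (Fintype (P.Label ⊕ Q.Label))
  | ite _ _ P Q =>
    letI := P.labelFintype
    letI := Q.labelFintype
    inferInstanceAs (Fintype (Option (P.Label ⊕ Q.Label)))
  | loop _ _ P =>
    letI := P.labelFintype
    inferInstanceAs (Fintype (Option P.Label))

/-- The label at which execution starts. -/
def entry : (P : Prog) → P.Label
  | skip => ()
  | push _ _ => ()
  | pop _ => ()
  | seq P _ => Sum.inl P.entry
  | ite _ _ _ _ => none
  | loop _ _ _ => none

/-- The stack of the machine with `k + 1` stacks that stands for stack `j`. -/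
def stackIndex (k j : ℕ) : Fin (k + 1) := Fin.ofNat (k + 1) j

theorem stackIndex_val {k j : ℕ} (hj : j < k + 1) : (stackIndex k j : ℕ) = j := by
  simp [stackIndex, Fin.ofNat, Nat.mod_eq_of_lt hj]

open Turing.TM2.Stmt in
/-- The statements of a multi-stack machine executing the program, whose labels are embedded by
`e` into the labels of the machine; control leaves to the label `out`. -/
def code (k : ℕ) {L : Type} : (P : Prog) → (e : P.Label → L) → (out : L) → P.Label →
    Turing.TM2.Stmt (fun _ : Fin (k + 1) => Option Bool) L (Option (Option Bool))
  | skip, _, out, _ => goto fun _ => out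
  | push j a, _, out, _ => Turing.TM2.Stmt.push (stackIndex k j) (fun _ => a) (goto fun _ => out)
  | pop j, _, out, _ => Turing.TM2.Stmt.pop (stackIndex k j) (fun _ _ => none) (goto fun _ => out)
  | seq P Q, e, _, Sum.inl l => P.code k (e ∘ Sum.inl) (e (Sum.inr Q.entry)) l
  | seq _ Q, e, out, Sum.inr l => Q.code k (e ∘ Sum.inr) out l
  -- The inspected symbol is erased from the internal state after the branch, so every label is
  -- entered with state `none`, as `cfg` demands.
  | ite j c P Q, e, _, none => peek (stackIndex k j) (fun _ o => o) <|
      branch c (load (fun _ => none) (goto fun _ => e (some (Sum.inl P.entry))))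
        (load (fun _ => none) (goto fun _ => e (some (Sum.inr Q.entry))))
  | ite _ _ P _, e, out, some (Sum.inl l) => P.code k (e ∘ some ∘ Sum.inl) out l
  | ite _ _ _ Q, e, out, some (Sum.inr l) => Q.code k (e ∘ some ∘ Sum.inr) out l
  | loop j c P, e, out, none => peek (stackIndex k j) (fun _ o => o) <|
      branch c (load (fun _ => none) (goto fun _ => e (some P.entry)))
        (load (fun _ => none) (goto fun _ => out))
  | loop _ _ P, e, _, some l => P.code k (e ∘ some) (e none) l

section Simulation

variable {k : ℕ} {L : Type}

/-- The machine configuration at label `l` with the stacks of the store `S`. -/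
def cfg (k : ℕ) (l : L) (S : Store) :
    Turing.TM2.Cfg (fun _ : Fin (k + 1) => Option Bool) L (Option (Option Bool)) :=
  ⟨some l, none, fun i => S i⟩

/-- `stackIndex` reduces modulo `k + 1`; the bound on `j` rules out that two stacks of the store are
identified. -/
theorem update_restrict {j : ℕ} (hj : j < k + 1) (S : Store) (x : List (Option Bool)) :
    (fun i : Fin (k + 1) => Function.update S j x i) =
      Function.update (fun i : Fin (k + 1) => S i) (stackIndex k j) x := by
  funext i
  have hv := stackIndex_val hj
  by_cases h : i = stackIndex k j
  · subst h
    rw [Function.update_self]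
    simp only [hv, Function.update_self]
  · rw [Function.update_of_ne h, Function.update_of_ne]
    intro h'
    exact h (Fin.ext (h'.trans hv.symm))

theorem step_cfg (M : L → Turing.TM2.Stmt (fun _ : Fin (k + 1) => Option Bool) L
      (Option (Option Bool))) (l : L) (S : Store) :
    flip Bind.bind (Turing.TM2.step M) (some (cfg k l S)) =
      some (Turing.TM2.stepAux (M l) none fun i => S i) := rfl

/-- Execution of a program is simulated step by step by the machine. -/
theorem Exec.simulate {M : L → Turing.TM2.Stmt (fun _ : Fin (k + 1) => Option Bool) L
      (Option (Option Bool))} {P : Prog} {S S' : Store} {n : ℕ} (h : P.Exec S S' n)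
    (hP : P.UsesBelow (k + 1)) (e : P.Label → L) (out : L)
    (hM : ∀ l, M (e l) = P.code k e out l) :
    (flip Bind.bind (Turing.TM2.step M))^[n] (some (cfg k (e P.entry) S)) = some (cfg k out S') := by
  induction h generalizing out with
  | skip S =>
    rw [Function.iterate_one, step_cfg, hM]
    rfl
  | push S j a =>
    rw [Function.iterate_one, step_cfg, hM]
    simp only [code, Turing.TM2.stepAux, stackIndex_val hP, cfg, update_restrict hP]
  | pop S j =>
    rw [Function.iterate_one, step_cfg, hM]
    simp only [code, Turing.TM2.stepAux, stackIndex_val hP, cfg, update_restrict hP]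
  | @seq P Q S S' S'' m n hP' hQ' ihP ihQ =>
    rw [add_comm m n, Function.iterate_add_apply]
    have h1 := ihP hP.1 (e ∘ Sum.inl) (e (Sum.inr Q.entry)) (fun l => hM (Sum.inl l))
    have h2 := ihQ hP.2 (e ∘ Sum.inr) out (fun l => hM (Sum.inr l))
    exact (congrArg _ h1).trans h2
  | @iteTrue P Q S S' j c m hc hP' ihP =>
    rw [Function.iterate_succ_apply]
    refine (congrArg _ ?_).trans
      (ihP hP.2.1 (e ∘ some ∘ Sum.inl) out (fun l => hM (some (Sum.inl l))))
    rw [step_cfg, hM]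
    simp only [entry, code, Turing.TM2.stepAux, stackIndex_val hP.1, hc]
    rfl
  | @iteFalse P Q S S' j c m hc hP' ihP =>
    rw [Function.iterate_succ_apply]
    refine (congrArg _ ?_).trans
      (ihP hP.2.2 (e ∘ some ∘ Sum.inr) out (fun l => hM (some (Sum.inr l))))
    rw [step_cfg, hM]
    simp only [entry, code, Turing.TM2.stepAux, stackIndex_val hP.1, hc]
    rfl
  | @loopFalse P S j c hc =>
    rw [Function.iterate_one, step_cfg, hM]
    simp only [entry, code, Turing.TM2.stepAux, stackIndex_val hP.1, hc]
    rfl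
  | @loopTrue P S S' S'' j c m n hc hP' hL ihP ihL =>
    rw [Function.iterate_succ_apply, add_comm m n, Function.iterate_add_apply]
    have h1 := ihP hP.2 (e ∘ some) (e none) (fun l => hM (some l))
    refine (congrArg _ ((congrArg _ ?_).trans h1)).trans (ihL hP e out hM)
    rw [step_cfg, hM]
    simp only [entry, code, Turing.TM2.stepAux, stackIndex_val hP.1, hc]
    rfl

end Simulation

/-- The multi-stack machine executing a program: input on stack `0`, output on stack `1`. -/
def toFinTM2 (k : ℕ) (P : Prog) : Turing.FinTM2 :=
  letI := P.labelFintype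
  { K := Fin (k + 2)
    k₀ := 0
    k₁ := 1
    Γ := fun _ => Option Bool
    Λ := Option P.Label
    main := some P.entry
    σ := Option (Option Bool)
    initialState := none
    m := fun l => l.elim .halt (P.code (k + 1) some none) }

/-- Transfer of a program execution to its machine. -/
theorem Exec.outputsInTime {k : ℕ} {P : Prog} (hP : P.UsesBelow (k + 2))
    {w w' : List (Option Bool)} {n T : ℕ}
    (h : P.Exec (Function.update (fun _ => []) 0 w) (Function.update (fun _ => []) 1 w') n)
    (hT : n + 1 ≤ T) :
    Nonempty (Turing.TM2OutputsInTime (P.toFinTM2 k) w (some w') T) := by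
  have hs := h.simulate (k := k + 1) (L := Option P.Label)
    (M := fun l => l.elim .halt (P.code (k + 1) some none)) hP some none (fun l => rfl)
  refine ⟨⟨⟨n + 1, ?_⟩, hT⟩⟩
  -- The one additional step executes `halt` at the exit label `none` of the program.
  rw [add_comm n 1, Function.iterate_add_apply]
  have h0 : Turing.initList (P.toFinTM2 k) w =
      cfg (k + 1) (some P.entry) (Function.update (fun _ => []) 0 w) := by
    unfold Turing.initList cfg
    congr 1
    funext i
    by_cases hi : i = (0 : Fin (k + 2))
    · subst hi; rfl
    · have hi' : Fin.val (n := k + 2) i ≠ 0 := fun h => hi (Fin.ext h)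
      rw [Function.update_of_ne hi']
      exact dif_neg hi
  have h1 : Turing.haltList (P.toFinTM2 k) w' =
      ⟨none, none, fun i : Fin (k + 2) => Function.update (fun _ => []) 1 w' (i : ℕ)⟩ := by
    unfold Turing.haltList
    congr 1
    funext i
    by_cases hi : i = (1 : Fin (k + 2))
    · subst hi; rfl
    · have hi' : Fin.val (n := k + 2) i ≠ 1 := fun h => hi (Fin.ext h)
      rw [Function.update_of_ne hi']
      exact dif_neg hi
  have h2 : (flip Bind.bind (P.toFinTM2 k).step)^[n]
      (some (Turing.initList (P.toFinTM2 k) w)) =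
      some (cfg (k + 1) none (Function.update (fun _ => []) 1 w')) :=
    (congrArg (fun x => (flip Bind.bind (P.toFinTM2 k).step)^[n] (some x)) h0).trans hs
  exact (congrArg _ h2).trans (congrArg some h1).symm

end Prog
end StackProg

/-! ### Counter programs -/

namespace StackProg

open Prog

/-- The store whose stacks are unary counters. -/
def counters (s : ℕ → ℕ) : Store := fun j => List.replicate (s j) none

/-- `Runs P s s' n`: the program takes counters `s` to counters `s'` in at most `n` steps. -/
def Runs (P : Prog) (s s' : ℕ → ℕ) (n : ℕ) : Prop :=
  ∃ m ≤ n, P.Exec (counters s) (counters s') m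

theorem counters_update (s : ℕ → ℕ) (j v : ℕ) :
    counters (Function.update s j v) =
      Function.update (counters s) j (List.replicate v none) := by
  funext i
  by_cases h : i = j
  · subst h; simp [counters]
  · simp [counters, Function.update_of_ne h]

theorem Runs.mono {P : Prog} {s s' : ℕ → ℕ} {m n : ℕ} (h : Runs P s s' m) (hmn : m ≤ n) :
    Runs P s s' n :=
  let ⟨k, hk, e⟩ := h
  ⟨k, hk.trans hmn, e⟩

theorem Runs.congr {P : Prog} {s s' t : ℕ → ℕ} {m n : ℕ} (h : Runs P s s' m) (ht : s' = t)
    (hmn : m ≤ n) : Runs P s t n :=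
  ht ▸ h.mono hmn

theorem Runs.skip (s : ℕ → ℕ) : Runs .skip s s 1 := ⟨1, le_rfl, .skip _⟩

/-- Increment a counter. -/
def inc (j : ℕ) : Prog := .push j none

theorem Runs.inc (s : ℕ → ℕ) (j : ℕ) : Runs (inc j) s (Function.update s j (s j + 1)) 1 := by
  refine ⟨1, le_rfl, ?_⟩
  rw [counters_update, List.replicate_succ]
  exact .push _ _ _

theorem Runs.pop (s : ℕ → ℕ) (j : ℕ) : Runs (.pop j) s (Function.update s j (s j - 1)) 1 := by
  refine ⟨1, le_rfl, ?_⟩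
  rw [counters_update, ← List.tail_replicate]
  exact .pop _ _

theorem Runs.seq {P Q : Prog} {s s' s'' : ℕ → ℕ} {m n : ℕ} (hP : Runs P s s' m)
    (hQ : Runs Q s' s'' n) : Runs (.seq P Q) s s'' (m + n) :=
  let ⟨k, hk, e⟩ := hP
  let ⟨l, hl, e'⟩ := hQ
  ⟨k + l, add_le_add hk hl, .seq e e'⟩

/-- Repeat the body while the counter is positive. -/
def whilePos (j : ℕ) (P : Prog) : Prog := .loop j Option.isSome P

/-- The trajectory `st` is prescribed in advance, so a loop is verified by a closed formula for its
states. Each pass pays one step for its test, and the final failing test pays the leading `1`. -/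
theorem Runs.whilePos {j : ℕ} {P : Prog} (n : ℕ) (st : ℕ → ℕ → ℕ) (T : ℕ → ℕ)
    (hpos : ∀ i < n, st i j ≠ 0) (hzero : st n j = 0)
    (hstep : ∀ i < n, Runs P (st i) (st (i + 1)) (T i)) :
    Runs (whilePos j P) (st 0) (st n) (1 + ∑ i ∈ Finset.range n, (T i + 1)) := by
  induction n generalizing st T with
  | zero =>
    refine ⟨1, by simp, .loopFalse ?_⟩
    simp [counters, hzero]
  | succ n ih =>
    obtain ⟨k, hk, e⟩ := ih (fun i => st (i + 1)) (fun i => T (i + 1))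
      (fun i hi => hpos _ (by omega)) hzero (fun i hi => hstep _ (by omega))
    obtain ⟨l, hl, e'⟩ := hstep 0 (by omega)
    refine ⟨l + k + 1, ?_, .loopTrue ?_ e' e⟩
    · rw [Finset.sum_range_succ']
      omega
    · have := hpos 0 (by omega)
      obtain ⟨v, hv⟩ := Nat.exists_eq_succ_of_ne_zero this
      simp [counters, hv, List.replicate_succ]

/-- Empty a counter. -/
def clear (j : ℕ) : Prog := whilePos j (.pop j)

theorem Runs.clear (s : ℕ → ℕ) (j : ℕ) :
    Runs (clear j) s (Function.update s j 0) (2 * s j + 1) := by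
  have h := Runs.whilePos (j := j) (P := .pop j) (s j) (fun i => Function.update s j (s j - i))
    (fun _ => 1) (fun i hi => by simp; omega) (by simp) (fun i hi => by
      simpa [Nat.sub_sub] using Runs.pop (Function.update s j (s j - i)) j)
  simp only [Nat.sub_zero, Function.update_eq_self, Nat.sub_self] at h
  exact h.mono (by simp; omega)

/-- Move a counter onto another one. -/
def move (j o : ℕ) : Prog := whilePos j (.seq (.pop j) (inc o))

theorem Runs.move (s : ℕ → ℕ) {j o : ℕ} (hjo : j ≠ o) :
    Runs (move j o) s (Function.update (Function.update s j 0) o (s o + s j)) (3 * s j + 1) := by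
  have h := Runs.whilePos (j := j) (P := .seq (.pop j) (StackProg.inc o)) (s j)
    (fun i => Function.update (Function.update s j (s j - i)) o (s o + i))
    (fun _ => 2) (fun i hi => by simp [Function.update_of_ne hjo]; omega)
    (by simp [Function.update_of_ne hjo]) (fun i hi => by
      have h := (Runs.pop (Function.update (Function.update s j (s j - i)) o (s o + i)) j).seq
        (Runs.inc _ o)
      convert h using 1
      funext l
      simp only [Function.update_apply]
      split_ifs <;> omega)
  simp only [Nat.sub_zero, Function.update_eq_self, Nat.sub_self, add_zero] at h
  exact h.mono (by simp; omega)

/-- Add a counter to another one, keeping it, with the help of an empty counter `b`. -/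
def copy (j o b : ℕ) : Prog :=
  .seq (whilePos j (.seq (.pop j) (.seq (inc o) (inc b)))) (move b j)

theorem Runs.copy (s : ℕ → ℕ) {j o b : ℕ} (hjo : j ≠ o) (hjb : j ≠ b) (hob : o ≠ b)
    (hb : s b = 0) :
    Runs (copy j o b) s (Function.update s o (s o + s j)) (7 * s j + 2) := by
  have h := Runs.whilePos (j := j)
    (P := .seq (.pop j) (.seq (StackProg.inc o) (StackProg.inc b))) (s j)
    (fun i l => if l = j then s j - i else if l = o then s o + i else if l = b then i else s l)
    (fun _ => 3) (fun i hi => by simp; omega)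
    (by simp) (fun i hi => by
      have h := (Runs.pop (fun l => if l = j then s j - i else if l = o then s o + i
        else if l = b then i else s l) j).seq ((Runs.inc _ o).seq (Runs.inc _ b))
      convert h using 1
      funext l
      simp only [Function.update_apply]
      split_ifs <;> omega)
  have h2 := h.seq (Runs.move _ hjb.symm)
  have e0 : (fun l => if l = j then s j - 0 else if l = o then s o + 0 else if l = b then 0
      else s l) = s := by
    funext l
    split_ifs <;> simp_all
  rw [e0] at h2
  refine h2.congr ?_ (by simp [hjb.symm, hob.symm]; omega)
  funext l
  simp only [Function.update_apply]
  split_ifs <;> simp_all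

/-- `Comp f T`: in the presence of enough free counters, the value `f x` can be added to an
output counter in at most `T x` steps, where the counters holding `x` are kept. -/
def Comp {k : ℕ} (f T : (Fin k → ℕ) → ℕ) : Prop :=
  ∃ w : ℕ, ∀ (ρ : Fin k → ℕ) (o b : ℕ), (∀ i, ρ i < b) → o < b → (∀ i, ρ i ≠ o) →
    ∃ P : Prog, P.UsesBelow (b + w) ∧ ∀ s : ℕ → ℕ, (∀ j, b ≤ j → s j = 0) →
      Runs P s (Function.update s o (s o + f (s ∘ ρ))) (T (s ∘ ρ))

namespace Comp

variable {k : ℕ}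

theorem mono {f T T' : (Fin k → ℕ) → ℕ} (h : Comp f T) (hT : ∀ x, T x ≤ T' x) : Comp f T' := by
  obtain ⟨w, hw⟩ := h
  refine ⟨w, fun ρ o b h1 h2 h3 => ?_⟩
  obtain ⟨P, hP, hr⟩ := hw ρ o b h1 h2 h3
  exact ⟨P, hP, fun s hs => (hr s hs).mono (hT _)⟩

theorem zero : Comp (fun _ : Fin k → ℕ => 0) (fun _ => 1) :=
  ⟨0, fun _ _ _ _ _ _ => ⟨.skip, trivial, fun s _ => by simpa using Runs.skip s⟩⟩

theorem one : Comp (fun _ : Fin k → ℕ => 1) (fun _ => 1) :=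
  ⟨0, fun _ o _ _ ho _ => ⟨inc o, ho, fun s _ => Runs.inc s o⟩⟩

theorem var (i : Fin k) : Comp (fun x : Fin k → ℕ => x i) (fun x => 7 * x i + 2) := by
  refine ⟨1, fun ρ o b hρ ho hne => ⟨copy (ρ i) o b, ?_, fun s hs => ?_⟩⟩
  · have := hρ i
    simp [copy, whilePos, move, inc, UsesBelow]
    omega
  · exact Runs.copy s (hne i) (hρ i).ne ho.ne (hs b le_rfl)

/-- Results are added to the output counter, so the two programs simply run in succession. They
share their free counters, because each leaves them empty. -/
theorem add {f g T U : (Fin k → ℕ) → ℕ} (hf : Comp f T) (hg : Comp g U) :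
    Comp (fun x => f x + g x) (fun x => T x + U x) := by
  obtain ⟨w, hw⟩ := hf
  obtain ⟨w', hw'⟩ := hg
  refine ⟨max w w', fun ρ o b h1 h2 h3 => ?_⟩
  obtain ⟨P, hP, hr⟩ := hw ρ o b h1 h2 h3
  obtain ⟨Q, hQ, hr'⟩ := hw' ρ o b h1 h2 h3
  refine ⟨.seq P Q, ⟨hP.mono (by omega), hQ.mono (by omega)⟩, fun s hs => ?_⟩
  have e : (Function.update s o (s o + f (s ∘ ρ))) ∘ ρ = s ∘ ρ := by
    funext i
    simp [Function.update_of_ne (h3 i)]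
  have := (hr s hs).seq (hr' _ (fun j hj => by
    rw [Function.update_of_ne (by omega)]
    exact hs j hj))
  rw [e] at this
  simpa [add_assoc] using this

/-- `Comp` quantifies over all placements `ρ` of the arguments, injective or not, so a change of
variables is a change of placement. -/
theorem rename {l : ℕ} {f T : (Fin k → ℕ) → ℕ} (hf : Comp f T) (π : Fin k → Fin l) :
    Comp (fun x : Fin l → ℕ => f (x ∘ π)) (fun x => T (x ∘ π)) := by
  obtain ⟨w, hw⟩ := hf
  exact ⟨w, fun ρ o b h1 h2 h3 => hw (ρ ∘ π) o b (fun i => h1 _) h2 (fun i => h3 _)⟩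

/-- Substitution of a computed value for the first variable. -/
theorem bind {f T : (Fin (k + 1) → ℕ) → ℕ} {g U : (Fin k → ℕ) → ℕ} (hf : Comp f T)
    (hg : Comp g U) : Comp (fun x => f (Fin.cons (g x) x))
      (fun x => U x + T (Fin.cons (g x) x) + (2 * g x + 1)) := by
  obtain ⟨w, hw⟩ := hf
  obtain ⟨w', hw'⟩ := hg
  refine ⟨max w w' + 1, fun ρ o b h1 h2 h3 => ?_⟩
  -- The first free counter `b` holds `g x` as the additional argument and is cleared at the end;
  -- the counters above `b` stay free.
  obtain ⟨P, hP, hr⟩ := hw (Fin.cons b ρ) o (b + 1)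
    (fun i => by refine Fin.cases ?_ (fun i => ?_) i <;> simp; have := h1 i; omega) (by omega)
    (fun i => by refine Fin.cases ?_ (fun i => ?_) i <;> simp; omega; exact h3 i)
  obtain ⟨Q, hQ, hr'⟩ := hw' ρ b (b + 1) (fun i => by have := h1 i; omega) (by omega)
    (fun i => (h1 i).ne)
  refine ⟨.seq (.seq Q P) (clear b), ⟨⟨hQ.mono (by omega), hP.mono (by omega)⟩, ?_⟩,
    fun s hs => ?_⟩
  · simp [clear, whilePos, UsesBelow]
  · have r1 := hr' s (fun j hj => hs j (by omega))
    have r2 := hr (Function.update s b (s b + g (s ∘ ρ))) (fun j hj => by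
      rw [Function.update_of_ne (by omega)]
      exact hs j (by omega))
    have e : (Function.update s b (s b + g (s ∘ ρ))) ∘ (Fin.cons b ρ : Fin (k + 1) → ℕ) =
        Fin.cons (g (s ∘ ρ)) (s ∘ ρ) := by
      funext i
      refine Fin.cases ?_ (fun i => ?_) i
      · simp [hs b le_rfl]
      · simp [Function.update_of_ne (h1 i).ne]
    rw [e] at r2
    have r3 := (r1.seq r2).seq (Runs.clear _ b)
    have hb := hs b le_rfl
    convert r3 using 1
    · funext j
      simp only [Function.update_apply]
      split_ifs <;> first | omega | simp_all
    · simp [Function.update_apply, h2.ne', hb]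

/-- Primitive recursion. -/
theorem recursion {n b T U : (Fin k → ℕ) → ℕ} {h V : (Fin (k + 2) → ℕ) → ℕ}
    (hn : Comp n T) (hb : Comp b U) (hh : Comp h V) (R : (Fin k → ℕ) → ℕ → ℕ)
    (hR0 : ∀ x, R x 0 = b x)
    (hR : ∀ x i, R x (i + 1) = h (Fin.cons i (Fin.cons (R x i) x))) :
    Comp (fun x => R x (n x)) (fun x => T x + U x + (1 + ∑ i ∈ Finset.range (n x),
      (V (Fin.cons i (Fin.cons (R x i) x)) + 2 * R x i + 3 * R x (i + 1) + 5)) +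
      (3 * R x (n x) + 1) + (2 * n x + 1)) := by
  obtain ⟨w, hw⟩ := hn
  obtain ⟨w', hw'⟩ := hb
  obtain ⟨w'', hw''⟩ := hh
  -- Layout: `m` counts the remaining rounds, `m + 1` holds the index `i`, `m + 2` the current value
  -- `R x i`, `m + 3` receives the next value, and the counters from `m + 4` on are free.
  refine ⟨max w (max w' w'') + 4, fun ρ o m h1 h2 h3 => ?_⟩
  have h1' : ∀ i, ρ i ≠ m ∧ ρ i ≠ m + 1 ∧ ρ i ≠ m + 2 ∧ ρ i ≠ m + 3 := fun i => by
    have := h1 i; omega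
  obtain ⟨P, hP, rP⟩ := hw ρ m (m + 4) (fun i => by have := h1 i; omega) (by omega)
    (fun i => (h1' i).1)
  obtain ⟨Q, hQ, rQ⟩ := hw' ρ (m + 2) (m + 4) (fun i => by have := h1 i; omega) (by omega)
    (fun i => (h1' i).2.2.1)
  obtain ⟨H, hH, rH⟩ := hw'' (Fin.cons (m + 1) (Fin.cons (m + 2) ρ)) (m + 3) (m + 4)
    (fun i => by
      refine Fin.cases (by simp) (fun i => Fin.cases (by simp) (fun i => ?_) i) i
      have := h1 i
      simp; omega) (by omega)
    (fun i => by
      refine Fin.cases (by simp) (fun i => Fin.cases (by simp) (fun i => ?_) i) i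
      simpa using (h1' i).2.2.2)
  refine ⟨.seq (.seq (.seq (.seq P Q) (whilePos m (.seq (.pop m) (.seq H (.seq (clear (m + 2))
    (.seq (move (m + 3) (m + 2)) (inc (m + 1)))))))) (move (m + 2) o)) (clear (m + 1)),
    ⟨⟨⟨⟨hP.mono (by omega), hQ.mono (by omega)⟩, ?_⟩, ?_⟩, ?_⟩, fun s hs => ?_⟩
  · have := hH.mono (n := m + (max w (max w' w'') + 4)) (by omega)
    simp [clear, whilePos, move, inc, UsesBelow, this]
  · simp [move, whilePos, inc, UsesBelow]; omega
  · simp [clear, whilePos, UsesBelow]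
  · set x := s ∘ ρ with hx
    have s0 := hs m le_rfl
    have s1 := hs (m + 1) (by omega)
    have s2 := hs (m + 2) (by omega)
    have s3 := hs (m + 3) (by omega)
    let st : ℕ → ℕ → ℕ := fun i j => if j = m then n x - i else if j = m + 1 then i else
      if j = m + 2 then R x i else s j
    have r1 := rP s (fun j hj => hs j (by omega))
    have r2 := rQ (Function.update s m (s m + n x)) (fun j hj => by
      rw [Function.update_of_ne (by omega)]; exact hs j (by omega))
    have e2 : (Function.update s m (s m + n x)) ∘ ρ = x := by
      funext i
      simp [hx, Function.update_of_ne (h1' i).1]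
    rw [e2] at r2
    have est : Function.update (Function.update s m (s m + n x)) (m + 2)
        ((Function.update s m (s m + n x)) (m + 2) + b x) = st 0 := by
      funext j
      have hj : j = m ∨ j = m + 1 ∨ j = m + 2 ∨ (j ≠ m ∧ j ≠ m + 1 ∧ j ≠ m + 2) := by omega
      rcases hj with rfl | rfl | rfl | ⟨n0, n1, n2⟩
      · simp [st, s0]
      · simp [st, s1]
      · simp [st, s2, hR0]
      · simp [st, n0, n1, n2]
    rw [est] at r2
    have r3 := Runs.whilePos (j := m) (P := .seq (.pop m) (.seq H (.seq (StackProg.clear (m + 2))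
        (.seq (StackProg.move (m + 3) (m + 2)) (StackProg.inc (m + 1)))))) (n x) st
      (fun i => V (Fin.cons i (Fin.cons (R x i) x)) + 2 * R x i + 3 * R x (i + 1) + 4)
      (fun i hi => by simp [st]; omega) (by simp [st]) (fun i hi => by
        have q1 := Runs.pop (st i) m
        set u1 := Function.update (st i) m (st i m - 1) with hu1
        have q2 := rH u1 (fun j hj => by
          have hjm : j ≠ m := by omega
          simp only [hu1, st, Function.update_apply]
          rw [if_neg (by omega), if_neg (by omega), if_neg (by omega), if_neg (by omega)]
          exact hs j (by omega))
        have e : u1 ∘ (Fin.cons (m + 1) (Fin.cons (m + 2) ρ) : Fin (k + 2) → ℕ) =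
            Fin.cons i (Fin.cons (R x i) x) := by
          funext l
          refine Fin.cases ?_ (fun l => Fin.cases ?_ (fun l => ?_) l) l
          · simp [hu1, st]
          · simp [hu1, st]
          · have := h1' l
            simp [hu1, st, this, hx]
        rw [e, ← hR] at q2
        have u13 : u1 (m + 3) = 0 := by simp [hu1, st, s3]
        have u12 : u1 (m + 2) = R x i := by simp [hu1, st]
        rw [u13, zero_add] at q2
        set u2 := Function.update u1 (m + 3) (R x (i + 1)) with hu2
        have q3 := Runs.clear u2 (m + 2)
        set u3 := Function.update u2 (m + 2) 0 with hu3
        have q4 := Runs.move u3 (j := m + 3) (o := m + 2) (by omega)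
        have q := q1.seq (q2.seq (q3.seq (q4.seq (Runs.inc _ (m + 1)))))
        have t2 : u2 (m + 2) = R x i := by simp [hu2, u12]
        have t3 : u3 (m + 3) = R x (i + 1) := by simp [hu3, hu2]
        rw [t2, t3] at q
        refine q.congr ?_ ?_
        · funext j
          have hj : j = m ∨ j = m + 1 ∨ j = m + 2 ∨ j = m + 3 ∨
              (j ≠ m ∧ j ≠ m + 1 ∧ j ≠ m + 2 ∧ j ≠ m + 3) := by omega
          rcases hj with rfl | rfl | rfl | rfl | ⟨n0, n1, n2, n3⟩
          · simp [hu3, hu2, hu1, st, Nat.sub_sub]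
          · simp [hu3, hu2, hu1, st]
          · simp [hu3, st]
          · simp [st, s3]
          · simp [hu3, hu2, hu1, st, n0, n1, n2, n3]
        · omega)
    have r4 := ((r1.seq r2).seq r3).seq (Runs.move (st (n x)) (j := m + 2) (o := o) (by omega))
    have r5 := r4.seq (Runs.clear _ (m + 1))
    have t1 : st (n x) (m + 2) = R x (n x) := by simp [st]
    rw [t1] at r5
    refine r5.congr ?_ ?_
    · funext j
      have o1 : o ≠ m + 1 := by omega
      have o2 : o ≠ m + 2 := by omega
      have hj : j = m ∨ j = m + 1 ∨ j = m + 2 ∨ j = o ∨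
          (j ≠ m ∧ j ≠ m + 1 ∧ j ≠ m + 2 ∧ j ≠ o) := by omega
      rcases hj with rfl | rfl | rfl | rfl | ⟨n0, n1, n2, n3⟩
      · simp [st, h2.ne', s0]
      · simp [o1.symm, s1]
      · simp [st, o2.symm, s2]
      · simp [st, h2.ne, o1, o2]
      · simp [st, n0, n1, n2, n3]
    · have t2 : Function.update (Function.update (st (n x)) (m + 2) 0) o
          (st (n x) o + R x (n x)) (m + 1) = n x := by
        have : m + 1 ≠ o := by omega
        simp [this, st]
      rw [t2]

end Comp

end StackProg

/-! ### Functions computable in time polynomial in the values of their arguments -/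

namespace StackProg

/-- Polynomially bounded functions of several natural numbers. -/
def PolyBounded {k : ℕ} (T : (Fin k → ℕ) → ℕ) : Prop := ∃ c : ℕ, ∀ x, T x ≤ (2 + ∑ i, x i) ^ c

namespace PolyBounded

variable {k : ℕ}

theorem mono {T U : (Fin k → ℕ) → ℕ} (hU : PolyBounded U) (h : ∀ x, T x ≤ U x) : PolyBounded T :=
  let ⟨c, hc⟩ := hU
  ⟨c, fun x => (h x).trans (hc x)⟩

/-- The summand `2` in the base makes this possible even where all arguments vanish. -/
theorem const (n : ℕ) : PolyBounded (fun _ : Fin k → ℕ => n) :=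
  ⟨n, fun x => (Nat.lt_two_pow_self (n := n)).le.trans (Nat.pow_le_pow_left (by omega) n)⟩

theorem var (i : Fin k) : PolyBounded (fun x : Fin k → ℕ => x i) :=
  ⟨1, fun x => by
    have := Finset.single_le_sum (f := x) (fun _ _ => Nat.zero_le _) (Finset.mem_univ i)
    simp only [pow_one]
    omega⟩

theorem size : PolyBounded (fun x : Fin k → ℕ => ∑ i, x i) := ⟨1, fun x => by simp only [pow_one]; omega⟩

theorem mul {T U : (Fin k → ℕ) → ℕ} (hT : PolyBounded T) (hU : PolyBounded U) :
    PolyBounded (fun x => T x * U x) :=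
  let ⟨c, hc⟩ := hT
  let ⟨d, hd⟩ := hU
  ⟨c + d, fun x => by rw [pow_add]; exact Nat.mul_le_mul (hc x) (hd x)⟩

theorem add {T U : (Fin k → ℕ) → ℕ} (hT : PolyBounded T) (hU : PolyBounded U) :
    PolyBounded (fun x => T x + U x) := by
  obtain ⟨c, hc⟩ := hT
  obtain ⟨d, hd⟩ := hU
  refine ⟨c + d + 1, fun x => ?_⟩
  have h1 : (2 + ∑ i, x i) ^ c ≤ (2 + ∑ i, x i) ^ (c + d) :=
    Nat.pow_le_pow_right (by omega) (by omega)
  have h2 : (2 + ∑ i, x i) ^ d ≤ (2 + ∑ i, x i) ^ (c + d) :=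
    Nat.pow_le_pow_right (by omega) (by omega)
  have h3 : (2 + ∑ i, x i) ^ (c + d) * 2 ≤ (2 + ∑ i, x i) ^ (c + d + 1) := by
    rw [pow_succ]
    exact Nat.mul_le_mul_left _ (by omega)
  have := hc x
  have := hd x
  dsimp only
  omega

theorem pow {T : (Fin k → ℕ) → ℕ} (hT : PolyBounded T) (n : ℕ) :
    PolyBounded (fun x => T x ^ n) := by
  induction n with
  | zero => simpa using const 1
  | succ n ih => simpa [pow_succ] using ih.mul hT

theorem rename {l : ℕ} {T : (Fin k → ℕ) → ℕ} (hT : PolyBounded T) (π : Fin k → Fin l) :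
    PolyBounded (fun x : Fin l → ℕ => T (x ∘ π)) := by
  obtain ⟨c, hc⟩ := hT
  have : PolyBounded (fun x : Fin l → ℕ => (2 + k * ∑ i, x i) ^ c) :=
    ((const 2).add ((const k).mul size)).pow c
  refine this.mono fun x => (hc _).trans (Nat.pow_le_pow_left ?_ c)
  have : ∑ i, (x ∘ π) i ≤ ∑ _i : Fin k, ∑ j, x j :=
    Finset.sum_le_sum fun i _ =>
      Finset.single_le_sum (f := x) (fun _ _ => Nat.zero_le _) (Finset.mem_univ (π i))
  simp at this ⊢
  omega

theorem bind {T : (Fin (k + 1) → ℕ) → ℕ} {g : (Fin k → ℕ) → ℕ} (hT : PolyBounded T)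
    (hg : PolyBounded g) : PolyBounded (fun x => T (Fin.cons (g x) x)) := by
  obtain ⟨c, hc⟩ := hT
  refine (((const 2).add (hg.add size)).pow c).mono fun x => (hc _).trans ?_
  rw [Fin.sum_cons]

theorem sum {n B : (Fin k → ℕ) → ℕ} {F : (Fin k → ℕ) → ℕ → ℕ} (hn : PolyBounded n)
    (hB : PolyBounded B) (hF : ∀ x, ∀ i < n x, F x i ≤ B x) :
    PolyBounded (fun x => ∑ i ∈ Finset.range (n x), F x i) :=
  (hn.mul hB).mono fun x => by
    refine (Finset.sum_le_sum fun i hi => hF x i (Finset.mem_range.1 hi)).trans ?_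
    simp

end PolyBounded

/-- Functions with polynomially bounded values that can be computed by counter programs in time
polynomial in the values of the arguments. -/
def PolyComp {k : ℕ} (f : (Fin k → ℕ) → ℕ) : Prop :=
  PolyBounded f ∧ ∃ T, PolyBounded T ∧ Comp f T

namespace PolyComp

variable {k : ℕ}

theorem var (i : Fin k) : PolyComp (fun x : Fin k → ℕ => x i) :=
  ⟨.var i, _, ((PolyBounded.const 7).mul (.var i)).add (.const 2), .var i⟩

theorem add {f g : (Fin k → ℕ) → ℕ} (hf : PolyComp f) (hg : PolyComp g) :
    PolyComp (fun x => f x + g x) :=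
  let ⟨bf, _, bT, cf⟩ := hf
  let ⟨bg, _, bU, cg⟩ := hg
  ⟨bf.add bg, _, bT.add bU, cf.add cg⟩

theorem const (n : ℕ) : PolyComp (fun _ : Fin k → ℕ => n) := by
  induction n with
  | zero => exact ⟨.const 0, _, .const 1, .zero⟩
  | succ n ih => exact ih.add ⟨.const 1, _, .const 1, .one⟩

theorem rename {l : ℕ} {f : (Fin k → ℕ) → ℕ} (hf : PolyComp f) (π : Fin k → Fin l) :
    PolyComp (fun x : Fin l → ℕ => f (x ∘ π)) :=
  let ⟨bf, _, bT, cf⟩ := hf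
  ⟨bf.rename π, _, bT.rename π, cf.rename π⟩

theorem bind {f : (Fin (k + 1) → ℕ) → ℕ} {g : (Fin k → ℕ) → ℕ} (hf : PolyComp f)
    (hg : PolyComp g) : PolyComp (fun x => f (Fin.cons (g x) x)) :=
  let ⟨bf, _, bT, cf⟩ := hf
  let ⟨bg, _, bU, cg⟩ := hg
  ⟨bf.bind bg, _, (bU.add (bT.bind bg)).add (((PolyBounded.const 2).mul bg).add (.const 1)),
    cf.bind cg⟩

/-- Primitive recursion with polynomially bounded values. -/
theorem recursion {n b B : (Fin k → ℕ) → ℕ} {h : (Fin (k + 2) → ℕ) → ℕ}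
    (hn : PolyComp n) (hb : PolyComp b) (hh : PolyComp h) (hB : PolyBounded B)
    (R : (Fin k → ℕ) → ℕ → ℕ) (hR0 : ∀ x, R x 0 = b x)
    (hR : ∀ x i, R x (i + 1) = h (Fin.cons i (Fin.cons (R x i) x)))
    (hRB : ∀ x, ∀ i ≤ n x, R x i ≤ B x) : PolyComp (fun x => R x (n x)) := by
  obtain ⟨bn, T, bT, cn⟩ := hn
  obtain ⟨bb, U, bU, cb⟩ := hb
  obtain ⟨bh, V, ⟨c, hc⟩, ch⟩ := hh
  refine ⟨hB.mono fun x => hRB x _ le_rfl, _, ?_, Comp.recursion cn cb ch R hR0 hR⟩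
  -- A round has arguments `i < n x`, `R x i ≤ B x` and `x`, so its cost is polynomial uniformly in
  -- `i`. The a priori bound `B` is essential, since iteration of polynomially bounded steps may
  -- grow exponentially.
  have hS : PolyBounded (fun x : Fin k → ℕ =>
      (2 + (n x + (B x + ∑ i, x i))) ^ c + 2 * B x + 3 * B x + 5) :=
    ((((((PolyBounded.const 2).add (bn.add (hB.add .size))).pow c).add
      ((PolyBounded.const 2).mul hB)).add ((PolyBounded.const 3).mul hB)).add (.const 5))
  have hsum := bn.sum (F := fun x i =>
      V (Fin.cons i (Fin.cons (R x i) x)) + 2 * R x i + 3 * R x (i + 1) + 5) hS (by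
    intro x i hi
    have h1 := hRB x i hi.le
    have h2 := hRB x (i + 1) hi
    have h3 : V (Fin.cons i (Fin.cons (R x i) x)) ≤ (2 + (n x + (B x + ∑ i, x i))) ^ c := by
      refine (hc _).trans (Nat.pow_le_pow_left ?_ c)
      rw [Fin.sum_cons, Fin.sum_cons]
      omega
    omega)
  exact (((bT.add bU).add ((PolyBounded.const 1).add hsum)).add
    (((PolyBounded.const 3).mul (hB.mono fun x => hRB x _ le_rfl)).add (.const 1))).add
    (((PolyBounded.const 2).mul bn).add (.const 1))

theorem comp1 {F : ℕ → ℕ} (hF : PolyComp fun y : Fin 1 → ℕ => F (y 0)) {g : (Fin k → ℕ) → ℕ}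
    (hg : PolyComp g) : PolyComp (fun x => F (g x)) :=
  (hF.rename (l := k + 1) ![0]).bind hg

theorem tail {g : (Fin k → ℕ) → ℕ} (hg : PolyComp g) :
    PolyComp (fun x : Fin (k + 1) → ℕ => g (Fin.tail x)) := hg.rename Fin.succ

/-- `bind` always fills the variable `0`, so the arguments are substituted from the last to the
first and the renaming reverses them. -/
theorem comp3 {F : ℕ → ℕ → ℕ → ℕ} (hF : PolyComp fun y : Fin 3 → ℕ => F (y 0) (y 1) (y 2))
    {g h i : (Fin k → ℕ) → ℕ} (hg : PolyComp g) (hh : PolyComp h) (hi : PolyComp i) :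
    PolyComp (fun x => F (g x) (h x) (i x)) :=
  (((hF.rename (l := k + 3) ![2, 1, 0]).bind hi.tail.tail).bind hh.tail).bind hg

theorem comp4 {F : ℕ → ℕ → ℕ → ℕ → ℕ}
    (hF : PolyComp fun y : Fin 4 → ℕ => F (y 0) (y 1) (y 2) (y 3))
    {g h i j : (Fin k → ℕ) → ℕ} (hg : PolyComp g) (hh : PolyComp h) (hi : PolyComp i)
    (hj : PolyComp j) : PolyComp (fun x => F (g x) (h x) (i x) (j x)) :=
  ((((hF.rename (l := k + 4) ![3, 2, 1, 0]).bind hj.tail.tail.tail).bind hi.tail.tail).bind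
    hh.tail).bind hg

/-- Bounded sums are the main form of loop: products, quotients and logarithms, and later the counts
over cells and digit strings, are all expressed by them. -/
theorem sum {n : (Fin k → ℕ) → ℕ} {F : ℕ → (Fin k → ℕ) → ℕ} (hn : PolyComp n)
    (hF : PolyComp fun z : Fin (k + 1) → ℕ => F (z 0) (Fin.tail z)) :
    PolyComp (fun x => ∑ i ∈ Finset.range (n x), F i x) := by
  have hs : PolyBounded (fun x => ∑ i ∈ Finset.range (n x), F i x) := by
    obtain ⟨⟨c, hc⟩, -⟩ := hF
    refine hn.1.sum (((PolyBounded.const 2).add (hn.1.add .size)).pow c) fun x i hi => ?_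
    have := hc (Fin.cons i x)
    simp only [Fin.cons_zero, Fin.tail_cons, Fin.sum_cons] at this
    exact this.trans (Nat.pow_le_pow_left (by omega) c)
  refine recursion (h := fun z => z 1 + F (z 0) (Fin.tail (Fin.tail z))) hn (const 0)
    ((var 1).add (hF.rename (Fin.cons 0 (fun i : Fin k => i.succ.succ)))) hs
    (fun x m => ∑ i ∈ Finset.range m, F i x) (fun x => rfl) (fun x i => ?_) (fun x i hi => ?_)
  · rw [Finset.sum_range_succ]
    rfl
  · exact Finset.sum_le_sum_of_subset (Finset.range_mono hi)

theorem mul {f g : (Fin k → ℕ) → ℕ} (hf : PolyComp f) (hg : PolyComp g) :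
    PolyComp (fun x => f x * g x) := by
  have := hf.sum (F := fun _ x => g x) hg.tail
  simpa using this

/-- The recursion step discards the previous value and returns the index. -/
theorem pred {f : (Fin k → ℕ) → ℕ} (hf : PolyComp f) : PolyComp (fun x => f x - 1) :=
  recursion (b := fun _ => 0) (h := fun z => z 0) hf (const 0) (var 0) hf.1
    (fun _ i => i - 1) (fun _ => rfl) (fun _ _ => rfl) (fun _ _ _ => by omega)

theorem sub {f g : (Fin k → ℕ) → ℕ} (hf : PolyComp f) (hg : PolyComp g) :
    PolyComp (fun x => f x - g x) :=
  recursion (h := fun z => z 1 - 1) hg hf (var 1).pred hf.1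
    (fun x i => f x - i) (fun _ => rfl) (fun _ _ => rfl) (fun _ _ _ => by omega)

theorem ite_le {f g h i : (Fin k → ℕ) → ℕ} (hf : PolyComp f) (hg : PolyComp g) (hh : PolyComp h)
    (hi : PolyComp i) : PolyComp (fun x => if f x ≤ g x then h x else i x) := by
  -- In truncated subtraction `1 - (f x - g x)` is the truth value of `f x ≤ g x`.
  have h1 : PolyComp (fun x => (1 - (f x - g x)) * h x + (1 - (1 - (f x - g x))) * i x) :=
    (((const 1).sub (hf.sub hg)).mul hh).add (((const 1).sub ((const 1).sub (hf.sub hg))).mul hi)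
  convert h1 using 2 with x
  split_ifs with h
  · simp [Nat.sub_eq_zero_of_le h]
  · have : 1 - (f x - g x) = 0 := by omega
    simp [this]

theorem min {f g : (Fin k → ℕ) → ℕ} (hf : PolyComp f) (hg : PolyComp g) :
    PolyComp (fun x => min (f x) (g x)) := by
  simpa only [min_def] using hf.ite_le hg hf hg

theorem card_filter_le_mul (a b : ℕ) (hb : 0 < b) :
    ∑ q ∈ Finset.range a, (if (q + 1) * b ≤ a then 1 else 0) = a / b := by
  rw [← Finset.card_filter]
  have : Finset.filter (fun q => (q + 1) * b ≤ a) (Finset.range a) = Finset.range (a / b) := by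
    ext q
    simp only [Finset.mem_filter, Finset.mem_range, ← Nat.le_div_iff_mul_le hb]
    have := Nat.div_le_self a b
    omega
  rw [this, Finset.card_range]

/-- The quotient counts the positive multiples of `g x` up to `f x`; the inner test enforces the
value `0` at `g x = 0`. -/
theorem div {f g : (Fin k → ℕ) → ℕ} (hf : PolyComp f) (hg : PolyComp g) :
    PolyComp (fun x => f x / g x) := by
  have h1 : PolyComp (fun x => ∑ q ∈ Finset.range (f x),
      (if (q + 1) * g x ≤ f x then (if 1 ≤ g x then 1 else 0) else 0)) :=
    hf.sum (F := fun q x => if (q + 1) * g x ≤ f x then (if 1 ≤ g x then 1 else 0) else 0)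
      ((((var 0).add (const 1)).mul hg.tail).ite_le hf.tail
        ((const 1).ite_le hg.tail (const 1) (const 0)) (const 0))
  convert h1 using 2 with x
  rcases Nat.eq_zero_or_pos (g x) with h | h
  · simp [h]
  · rw [← card_filter_le_mul _ _ h]
    simp [Nat.succ_le_of_lt h]

theorem mod {f g : (Fin k → ℕ) → ℕ} (hf : PolyComp f) (hg : PolyComp g) :
    PolyComp (fun x => f x % g x) := by
  convert hf.sub (hg.mul (hf.div hg)) using 2 with x
  have := Nat.mod_add_div (f x) (g x)
  omega

/-- Powers of two, cut off at a bound. -/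
theorem min_two_pow {f g : (Fin k → ℕ) → ℕ} (hf : PolyComp f) (hg : PolyComp g) :
    PolyComp (fun x => Min.min (2 ^ g x) (f x)) := by
  -- Cutting off after every doubling gives the same result as cutting off once at the end, and it
  -- keeps all intermediate values below `f x`.
  refine recursion (h := fun z => Min.min (2 * z 1) (f (Fin.tail (Fin.tail z)))) hg
    ((const 1).min hf) (((const 2).mul (var 1)).min hf.tail.tail) hf.1
    (fun x i => Min.min (2 ^ i) (f x)) (fun x => by simp) (fun x i => ?_)
    (fun x i _ => min_le_right _ _)
  change _ = Min.min (2 * Min.min (2 ^ i) (f x)) (f x)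
  rw [pow_succ]
  omega

/-- Logarithms to a base that is a power of two. -/
theorem log_two_pow {f : (Fin k → ℕ) → ℕ} (hf : PolyComp f) (c : ℕ) (hc : 0 < c) :
    PolyComp (fun x => Nat.log (2 ^ c) (f x)) := by
  -- The logarithm counts the exponents `q + 1` whose power is at most `f x`; a cut-off at `f x + 1`
  -- does not affect this comparison.
  have h1 := hf.sum (F := fun q x => if Min.min (2 ^ (c * (q + 1))) (f x + 1) ≤ f x then 1 else 0)
    ((((hf.tail.add (const 1))).min_two_pow ((const c).mul ((var 0).add (const 1)))).ite_le hf.tail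
      (const 1) (const 0))
  convert h1 using 2 with x
  have : ∀ q, (Min.min (2 ^ (c * (q + 1))) (f x + 1) ≤ f x) ↔ q < Nat.log (2 ^ c) (f x) := by
    intro q
    rw [min_le_iff, ← Nat.succ_le_iff, Nat.succ_eq_add_one]
    rcases Nat.eq_zero_or_pos (f x) with h | h
    · simp [h]
    · rw [Nat.le_log_iff_pow_le (Nat.one_lt_two_pow hc.ne') h.ne', ← pow_mul]
      omega
  simp only [this, ← Finset.card_filter]
  have : Finset.filter (fun q => q < Nat.log (2 ^ c) (f x)) (Finset.range (f x)) =
      Finset.range (Nat.log (2 ^ c) (f x)) := by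
    ext q
    have := Nat.log_le_self (2 ^ c) (f x)
    simp only [Finset.mem_filter, Finset.mem_range]
    omega
  rw [this, Finset.card_range]

end PolyComp

end StackProg

/-! ### Input and output -/

namespace StackProg

open Prog Computability

theorem encodeNat_zero : encodeNat 0 = [] := rfl

theorem encodeNat_double {m : ℕ} (hm : m ≠ 0) : encodeNat (2 * m) = false :: encodeNat m := by
  have h : ((2 * m : ℕ) : Num) = Num.bit0 (m : Num) := by
    rw [← Num.bit0_of_bit0, two_mul]; push_cast; rfl
  unfold encodeNat
  rw [h]
  cases hmm : (m : Num) with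
  | zero => exact absurd (Num.of_nat_inj.1 (hmm.trans Num.ofNat'_zero.symm)) hm
  | pos p => rfl

theorem encodeNat_double_add_one (m : ℕ) : encodeNat (2 * m + 1) = true :: encodeNat m := by
  have h : ((2 * m + 1 : ℕ) : Num) = Num.bit1 (m : Num) := by
    rw [← Num.bit1_of_bit1, two_mul]; push_cast; rfl
  unfold encodeNat
  rw [h]
  cases hmm : (m : Num) with
  | zero => rfl
  | pos p => rfl

/-- The value of a list of binary digits, least significant digit first. -/
def bitsValue : List Bool → ℕ
  | [] => 0
  | b :: l => b.toNat + 2 * bitsValue l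

theorem bitsValue_encodeNat (n : ℕ) : bitsValue (encodeNat n) = n := by
  induction n using Nat.strong_induction_on with
  | _ n ih =>
    rcases Nat.even_or_odd' n with ⟨m, rfl | rfl⟩
    · rcases Nat.eq_zero_or_pos m with rfl | hm
      · rfl
      · rw [encodeNat_double hm.ne', bitsValue, ih m (by omega)]
        simp
    · rw [encodeNat_double_add_one, bitsValue, ih m (by omega)]
      simp; omega

theorem two_pow_length_encodeNat_le (n : ℕ) : 2 ^ (encodeNat n).length ≤ 2 * n + 1 := by
  induction n using Nat.strong_induction_on with
  | _ n ih =>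
    rcases Nat.even_or_odd' n with ⟨m, rfl | rfl⟩
    · rcases Nat.eq_zero_or_pos m with rfl | hm
      · simp [encodeNat_zero]
      · have := ih m (by omega)
        have h := Nat.one_le_two_pow (n := (encodeNat m).length)
        rw [encodeNat_double hm.ne', List.length_cons, pow_succ]
        -- The even case needs `2 ^ length ≤ 2 * m`, one better than the induction hypothesis; a
        -- power of two equal to the odd number `2 * m + 1` would force `m = 0`.
        rcases Nat.lt_or_ge (2 ^ (encodeNat m).length) (2 * m + 1) with h' | h'
        · omega
        · exfalso
          have h3 : 2 ^ (encodeNat m).length = 2 * m + 1 := le_antisymm this h'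
          cases hl : (encodeNat m).length with
          | zero => rw [hl] at h3; simp at h3; omega
          | succ k => rw [hl, pow_succ] at h3; omega
    · have := ih m (by omega)
      rw [encodeNat_double_add_one, List.length_cons, pow_succ]
      omega

/-- The program does not mention stack `j`. -/
def Prog.Avoids (j : ℕ) : Prog → Prop
  | skip => True
  | push i _ => i ≠ j
  | pop i => i ≠ j
  | seq P Q => P.Avoids j ∧ Q.Avoids j
  | ite i _ P Q => i ≠ j ∧ P.Avoids j ∧ Q.Avoids j
  | loop i _ P => i ≠ j ∧ P.Avoids j

theorem Prog.Exec.congr {P : Prog} {S S' S'' : Store} {m n : ℕ} (h : P.Exec S S' m)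
    (hS : S' = S'') (hn : m = n) : P.Exec S S'' n := hS ▸ hn ▸ h

/-- Stacks `0` and `1` carry words instead of unary counters; this lets counter programs run beside
them. -/
theorem Prog.Exec.frame {P : Prog} {S S' : Store} {n : ℕ} (h : P.Exec S S' n) {j : ℕ}
    (hj : P.Avoids j) (x : List (Option Bool)) :
    P.Exec (Function.update S j x) (Function.update S' j x) n := by
  induction h with
  | skip S => exact .skip _
  | push S i a =>
    rw [Function.update_comm (show i ≠ j from hj)]
    convert Exec.push (Function.update S j x) i a using 3
    rw [Function.update_of_ne hj]
  | pop S i =>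
    rw [Function.update_comm (show i ≠ j from hj)]
    convert Exec.pop (Function.update S j x) i using 3
    rw [Function.update_of_ne hj]
  | seq _ _ ihP ihQ => exact .seq (ihP hj.1) (ihQ hj.2)
  | iteTrue hc _ ih =>
    exact .iteTrue (by rwa [Function.update_of_ne hj.1]) (ih hj.2.1)
  | iteFalse hc _ ih =>
    exact .iteFalse (by rwa [Function.update_of_ne hj.1]) (ih hj.2.2)
  | loopFalse hc => exact .loopFalse (by rwa [Function.update_of_ne hj.1])
  | loopTrue hc _ _ ihP ihL =>
    exact .loopTrue (by rwa [Function.update_of_ne hj.1]) (ihP hj.2) (ihL hj)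

/-- Double the counter `6` with the help of the empty counters `7` and `8`. -/
def doubleWeight : Prog := .seq (copy 6 8 7) (move 8 6)

theorem runs_doubleWeight (s : ℕ → ℕ) (h7 : s 7 = 0) (h8 : s 8 = 0) :
    Runs doubleWeight s (Function.update s 6 (2 * s 6)) (10 * s 6 + 3) := by
  have h := (Runs.copy s (j := 6) (o := 8) (b := 7) (by decide) (by decide) (by decide) h7).seq
    (Runs.move _ (j := 8) (o := 6) (by decide))
  refine h.congr ?_ ?_
  · funext l
    by_cases h1 : l = 6
    · subst h1; simp [h8]; omega
    · by_cases h2 : l = 8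
      · subst h2; simp [h8]
      · simp [h1, h2]
  · simp [h8]; omega

/-- Whether the top symbol is a binary digit. -/
def isDigit : Option (Option Bool) → Bool
  | some (some _) => true
  | _ => false

/-- Whether the top symbol is the digit `1`. -/
def isOne : Option (Option Bool) → Bool
  | some (some true) => true
  | _ => false

/-- Add the binary number on top of stack `0` to the counter `o`. -/
def readDigits (o : ℕ) : Prog :=
  .loop 0 isDigit (.seq (.ite 0 isOne (copy 6 o 7) .skip) (.seq doubleWeight (.pop 0)))

/-- Counter `6` holds the weight of the next digit, least significant first. A digit costs time
proportional to the weight, which then doubles; the base `3` instead of `2` leaves room in the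
induction for the cost of the present digit. -/
theorem exec_readDigits {o : ℕ} (ho0 : o ≠ 0) (ho6 : o < 6) (l : List Bool)
    (rest : List (Option Bool)) (hrest : isDigit rest.head? = false) (s : ℕ → ℕ)
    (h6 : s 6 ≠ 0) (h7 : s 7 = 0) (h8 : s 8 = 0) :
    ∃ n ≤ 30 * s 6 * 3 ^ l.length + 1,
      (readDigits o).Exec (Function.update (counters s) 0 (l.map some ++ rest))
        (Function.update (counters (Function.update (Function.update s o
          (s o + s 6 * bitsValue l)) 6 (s 6 * 2 ^ l.length))) 0 rest) n := by
  induction l generalizing s with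
  | nil =>
    refine ⟨1, by omega, ?_⟩
    simp only [bitsValue, mul_zero, add_zero, Function.update_eq_self, List.length_nil, pow_zero,
      mul_one, List.map_nil, List.nil_append]
    exact .loopFalse (by simpa using hrest)
  | cons b l ih =>
    set s1 := Function.update s o (s o + s 6 * b.toNat) with hs1
    have o7 : (7 : ℕ) ≠ o := by omega
    have o8 : (8 : ℕ) ≠ o := by omega
    have o6 : (6 : ℕ) ≠ o := by omega
    have s17 : s1 7 = 0 := by simp [hs1, o7, h7]
    have s18 : s1 8 = 0 := by simp [hs1, o8, h8]
    have s16 : s1 6 = s 6 := by simp [hs1, o6]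
    set w := (b :: l).map some ++ rest with hw
    have e1 : ∃ n ≤ 7 * s 6 + 3, (Prog.ite 0 isOne (copy 6 o 7) .skip).Exec
        (Function.update (counters s) 0 w) (Function.update (counters s1) 0 w) n := by
      cases b with
      | false =>
        refine ⟨2, by omega, .iteFalse (by simp [hw, isOne]) ?_⟩
        simp only [hs1, Bool.toNat_false, mul_zero, add_zero, Function.update_eq_self]
        exact .skip _
      | true =>
        obtain ⟨n, hn, e⟩ := Runs.copy s (j := 6) (o := o) (b := 7) (by omega) (by decide)
          (by omega) h7
        refine ⟨n + 1, by omega, .iteTrue (by simp [hw, isOne]) ?_⟩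
        simp only [hs1, Bool.toNat_true, mul_one]
        refine e.frame ?_ w
        simp [copy, whilePos, move, inc, Avoids, ho0]
    obtain ⟨n1, hn1, e1⟩ := e1
    obtain ⟨n2, hn2, e2⟩ := runs_doubleWeight s1 s17 s18
    have e2 := e2.frame (j := 0) (by simp [doubleWeight, copy, whilePos, move, inc, Avoids]) w
    set s2 := Function.update s1 6 (2 * s1 6) with hs2
    have e3 := Exec.pop (Function.update (counters s2) 0 w) 0
    rw [Function.update_self, Function.update_idem] at e3
    have s26 : s2 6 = 2 * s 6 := by simp [hs2, s16]
    obtain ⟨n4, hn4, e4⟩ := ih s2 (by omega) (by simp [hs2, s17]) (by simp [hs2, s18])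
    refine ⟨(n1 + (n2 + 1)) + n4 + 1, ?_, ?_⟩
    · rw [s26] at hn4
      rw [s16] at hn2
      have : 1 ≤ 3 ^ l.length := Nat.one_le_pow _ _ (by norm_num)
      rw [List.length_cons, pow_succ]
      have h5 : 1 ≤ s 6 := Nat.one_le_iff_ne_zero.2 h6
      have h4 : s 6 ≤ s 6 * 3 ^ l.length := Nat.le_mul_of_pos_right _ (by omega)
      have h3 : 30 * (2 * s 6) * 3 ^ l.length = 60 * (s 6 * 3 ^ l.length) := by ring
      have h2 : 30 * s 6 * (3 ^ l.length * 3) = 90 * (s 6 * 3 ^ l.length) := by ring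
      omega
    · refine .loopTrue (by simp [hw, isDigit]) (.seq e1 (.seq e2 e3)) ?_
      have hw' : w.tail = l.map some ++ rest := rfl
      rw [hw']
      suffices hst : Function.update (Function.update s o (s o + s 6 * bitsValue (b :: l))) 6
          (s 6 * 2 ^ (b :: l).length) =
          Function.update (Function.update s2 o (s2 o + s2 6 * bitsValue l)) 6
            (s2 6 * 2 ^ l.length) by
        rw [hst]
        exact e4
      funext i
      by_cases hi : i = 6
      · subst hi
        simp [s26, pow_succ]; ring
      · by_cases hio : i = o
        · subst hio
          simp [hi, hs2, hs1, o6, bitsValue]; ring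
        · simp [hi, hio, hs2, hs1]

/-- Read a binary number from stack `0` into the counter `o`. -/
def readNat (o : ℕ) : Prog := .seq (inc 6) (.seq (readDigits o) (clear 6))

theorem exec_readNat {o : ℕ} (ho0 : o ≠ 0) (ho6 : o < 6) (m : ℕ)
    (rest : List (Option Bool)) (hrest : isDigit rest.head? = false) (s : ℕ → ℕ)
    (hs : ∀ j, 6 ≤ j → s j = 0) (hso : s o = 0) :
    ∃ n ≤ 40 * (2 * m + 1) ^ 2,
      (readNat o).Exec (Function.update (counters s) 0 (binaryWord m ++ rest))
        (Function.update (counters (Function.update s o m)) 0 rest) n := by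
  obtain ⟨n1, hn1, e1⟩ := Runs.inc s 6
  have e1 := e1.frame (j := 0) (by simp [inc, Avoids]) (binaryWord m ++ rest)
  set s1 := Function.update s 6 (s 6 + 1) with hs1
  have s16 : s1 6 = 1 := by simp [hs1, hs]
  obtain ⟨n2, hn2, e2⟩ := exec_readDigits ho0 ho6 (encodeNat m) rest hrest s1 (by omega)
    (by simp [hs1, hs]) (by simp [hs1, hs])
  set s2 := Function.update (Function.update s1 o (s1 o + s1 6 * bitsValue (encodeNat m))) 6
    (s1 6 * 2 ^ (encodeNat m).length) with hs2
  obtain ⟨n3, hn3, e3⟩ := Runs.clear s2 6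
  have e3 := e3.frame (j := 0) (by simp [clear, whilePos, Avoids]) rest
  refine ⟨n1 + (n2 + n3), ?_, ?_⟩
  · have h1 := two_pow_length_encodeNat_le m
    have s26 : s2 6 = 2 ^ (encodeNat m).length := by simp [hs2, s16]
    rw [s26] at hn3
    rw [s16] at hn2
    have h3 : 3 ^ (encodeNat m).length ≤ (2 * m + 1) ^ 2 := by
      calc 3 ^ (encodeNat m).length ≤ 4 ^ (encodeNat m).length :=
            Nat.pow_le_pow_left (by norm_num) _
        _ = (2 ^ (encodeNat m).length) ^ 2 := by rw [← pow_mul, mul_comm, pow_mul]; rfl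
        _ ≤ _ := Nat.pow_le_pow_left h1 2
    have h4 : 2 * m + 1 ≤ (2 * m + 1) ^ 2 := Nat.le_self_pow (by norm_num) _
    omega
  · refine .seq e1 (.seq e2 ?_)
    convert e3 using 2
    congr 1
    funext i
    by_cases hi : i = 6
    · subst hi
      have : (6 : ℕ) ≠ o := by omega
      simp [this, hs]
    · by_cases hio : i = o
      · subst hio
        have : i ≠ 6 := by omega
        simp [this, hs2, hs1, hso, bitsValue_encodeNat, hs]
      · simp [hi, hio, hs2, hs1]

/-- Read the four numbers of a query into the counters `2, 3, 4, 5`. -/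
def readQuery : Prog :=
  .seq (readNat 2) (.seq (.pop 0) (.seq (readNat 3) (.seq (.pop 0) (.seq (readNat 4)
    (.seq (.pop 0) (readNat 5))))))

/-- The counters holding a query. -/
def queryCounters (r u v t : ℕ) (j : ℕ) : ℕ :=
  if j = 2 then r else if j = 3 then u else if j = 4 then v else if j = 5 then t else 0

theorem queryCounters_of_le (r u v t : ℕ) (j : ℕ) (hj : 6 ≤ j) : queryCounters r u v t j = 0 := by
  unfold queryCounters
  split_ifs <;> omega

theorem exec_readQuery (Q : DyadicSquare) (t : ℕ) :
    ∃ n ≤ 40 * ((2 * Q.r + 1) ^ 2 + (2 * Q.u + 1) ^ 2 + (2 * Q.v + 1) ^ 2 + (2 * t + 1) ^ 2) + 3,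
      readQuery.Exec (Function.update (fun _ => []) 0 (queryWord Q t))
        (counters (queryCounters Q.r Q.u Q.v t)) n := by
  obtain ⟨n1, hn1, e1⟩ := exec_readNat (o := 2) (by decide) (by decide) Q.r
    (none :: (binaryWord Q.u ++ none :: (binaryWord Q.v ++ none :: binaryWord t))) rfl
    (fun _ => 0) (fun _ _ => rfl) rfl
  obtain ⟨n2, hn2, e2⟩ := exec_readNat (o := 3) (by decide) (by decide) Q.u
    (none :: (binaryWord Q.v ++ none :: binaryWord t)) rfl
    (queryCounters Q.r 0 0 0) (queryCounters_of_le _ _ _ _) rfl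
  obtain ⟨n3, hn3, e3⟩ := exec_readNat (o := 4) (by decide) (by decide) Q.v
    (none :: binaryWord t) rfl
    (queryCounters Q.r Q.u 0 0) (queryCounters_of_le _ _ _ _) rfl
  obtain ⟨n4, hn4, e4⟩ := exec_readNat (o := 5) (by decide) (by decide) t [] rfl
    (queryCounters Q.r Q.u Q.v 0) (queryCounters_of_le _ _ _ _) rfl
  have c1 : Function.update (fun _ => 0) 2 Q.r = queryCounters Q.r 0 0 0 := by
    funext j; simp [Function.update_apply, queryCounters]
  have c2 : Function.update (queryCounters Q.r 0 0 0) 3 Q.u = queryCounters Q.r Q.u 0 0 := by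
    funext j; simp only [Function.update_apply, queryCounters]; split_ifs <;> omega
  have c3 : Function.update (queryCounters Q.r Q.u 0 0) 4 Q.v = queryCounters Q.r Q.u Q.v 0 := by
    funext j; simp only [Function.update_apply, queryCounters]; split_ifs <;> omega
  have c4 : Function.update (queryCounters Q.r Q.u Q.v 0) 5 t = queryCounters Q.r Q.u Q.v t := by
    funext j; simp only [Function.update_apply, queryCounters]; split_ifs <;> omega
  have p : ∀ (s : ℕ → ℕ) (w : List (Option Bool)), (Prog.pop 0).Exec
      (Function.update (counters s) 0 (none :: w)) (Function.update (counters s) 0 w) 1 := by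
    intro s w
    have := Exec.pop (Function.update (counters s) 0 (none :: w)) 0
    rwa [Function.update_self, Function.update_idem] at this
  rw [c1] at e1
  rw [c2] at e2
  rw [c3] at e3
  rw [c4] at e4
  refine ⟨n1 + (1 + (n2 + (1 + (n3 + (1 + n4))))), by omega, ?_⟩
  have z : (Function.update (counters (queryCounters Q.r Q.u Q.v t)) 0 []) =
      counters (queryCounters Q.r Q.u Q.v t) := by
    funext j
    by_cases hj : j = 0
    · subst hj; simp [counters, queryCounters]
    · simp [hj]
  rw [z, List.append_nil] at e4
  exact .seq e1 (.seq (p _ _) (.seq e2 (.seq (p _ _) (.seq e3 (.seq (p _ _) e4)))))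

theorem Runs.iteTrue {P Q : Prog} {s s' : ℕ → ℕ} {j n : ℕ} (hj : s j ≠ 0) (h : Runs P s s' n) :
    Runs (.ite j Option.isSome P Q) s s' (n + 1) := by
  obtain ⟨m, hm, e⟩ := h
  refine ⟨m + 1, by omega, .iteTrue ?_ e⟩
  obtain ⟨v, hv⟩ := Nat.exists_eq_succ_of_ne_zero hj
  simp [counters, hv, List.replicate_succ]

theorem Runs.iteFalse {P Q : Prog} {s s' : ℕ → ℕ} {j n : ℕ} (hj : s j = 0) (h : Runs Q s s' n) :
    Runs (.ite j Option.isSome P Q) s s' (n + 1) := by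
  obtain ⟨m, hm, e⟩ := h
  exact ⟨m + 1, by omega, .iteFalse (by simp [counters, hj]) e⟩

/-- Divide the counter `x` by two: quotient into `6`, remainder into `7`. -/
def halve (x : ℕ) : Prog :=
  whilePos x (.seq (.pop x) (.ite x Option.isSome (.seq (.pop x) (inc 6)) (inc 7)))

theorem runs_halve {x : ℕ} (hx : 7 < x) (s : ℕ → ℕ) (h6 : s 6 = 0) (h7 : s 7 = 0) :
    Runs (halve x) s (Function.update (Function.update (Function.update s x 0) 6 (s x / 2)) 7
      (s x % 2)) (3 * s x + 4) := by
  have x6 : x ≠ 6 := by omega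
  have x7 : x ≠ 7 := by omega
  have h := Runs.whilePos (j := x)
    (P := .seq (.pop x) (.ite x Option.isSome (.seq (.pop x) (inc 6)) (inc 7))) ((s x + 1) / 2)
    -- After `i` passes `2 * i` units have been requested. By truncation `2 * i - s x` becomes `1`
    -- only in the last pass, when it finds a single unit.
    (fun i j => if j = x then s x - 2 * i else if j = 6 then min i (s x / 2) else
      if j = 7 then 2 * i - s x else s j) (fun _ => 4) (fun i hi => by simp; omega)
    (by simp; omega) (fun i hi => by
      set st := (fun j => if j = x then s x - 2 * i else if j = 6 then min i (s x / 2) else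
        if j = 7 then 2 * i - s x else s j) with hst
      have q1 := Runs.pop st x
      set s1 := Function.update st x (st x - 1) with hs1
      have s1x : s1 x = s x - 2 * i - 1 := by simp [hs1, hst]
      by_cases hz : s1 x = 0
      · refine (q1.seq (Runs.iteFalse hz (Runs.inc s1 7))).congr ?_ (by omega)
        funext j
        by_cases j7 : j = 7
        · subst j7; simp [hs1, hst, x7.symm]; omega
        by_cases jx : j = x
        · subst jx; simp [s1x, j7]; omega
        by_cases j6 : j = 6
        · subst j6; simp [hs1, hst, x6.symm]; omega
        simp [hs1, hst, j7, jx, j6]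
      · refine (q1.seq (Runs.iteTrue hz ((Runs.pop s1 x).seq (Runs.inc _ 6)))).congr ?_ (by omega)
        funext j
        by_cases j7 : j = 7
        · subst j7; simp [hs1, hst, x7.symm]; omega
        by_cases jx : j = x
        · subst jx; simp [s1x, x6]; omega
        by_cases j6 : j = 6
        · subst j6; simp [hs1, hst, x6.symm]; omega
        simp [hs1, hst, j7, jx, j6])
  have e0 : (fun j => if j = x then s x - 2 * 0 else if j = 6 then min 0 (s x / 2) else
      if j = 7 then 2 * 0 - s x else s j) = s := by
    funext j
    split_ifs <;> simp_all
  rw [e0] at h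
  refine h.congr ?_ (by simp; omega)
  funext j
  by_cases j7 : j = 7
  · subst j7; simp [x7.symm]; omega
  by_cases j6 : j = 6
  · subst j6; simp [x6.symm]; omega
  by_cases jx : j = x
  · subst jx; simp [j7, j6]; omega
  simp [j7, jx, j6]

/-- Push the binary digits of the counter `x` onto stack `0`. -/
def pushDigits (x : ℕ) : Prog :=
  .loop x Option.isSome (.seq (halve x) (.seq
    (.ite 7 Option.isSome (.seq (.pop 7) (.push 0 (some true))) (.push 0 (some false)))
    (move 6 x)))

/-- Halving yields the least significant digit first, so the word arises on stack `0` in reversed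
order; `flush` turns it round again. -/
theorem exec_pushDigits {x : ℕ} (hx : 7 < x) (a : ℕ) (s : ℕ → ℕ) (hsx : s x = a)
    (h6 : s 6 = 0) (h7 : s 7 = 0) (z : List (Option Bool)) :
    ∃ n ≤ 30 * a + 1, (pushDigits x).Exec (Function.update (counters s) 0 z)
      (Function.update (counters (Function.update s x 0)) 0
        ((encodeNat a).reverse.map some ++ z)) n := by
  have x0 : x ≠ 0 := by omega
  have x6 : x ≠ 6 := by omega
  have x7 : x ≠ 7 := by omega
  induction a using Nat.strong_induction_on generalizing s z with
  | _ a ih =>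
    rcases Nat.eq_zero_or_pos a with rfl | ha
    · refine ⟨1, by omega, ?_⟩
      rw [← hsx, Function.update_eq_self, hsx]
      simp only [encodeNat_zero, List.reverse_nil, List.map_nil, List.nil_append]
      refine .loopFalse ?_
      simp [Function.update_of_ne x0, counters, hsx]
    · obtain ⟨n1, hn1, e1⟩ := runs_halve hx s h6 h7
      rw [hsx] at e1 hn1
      have e1 := e1.frame (j := 0)
        (by simp [halve, whilePos, inc, Avoids, x0]) z
      set s1 := Function.update (Function.update s x 0) 6 (a / 2) with hs1
      have s17 : s1 7 = 0 := by simp [hs1, x7.symm, h7]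
      have e2 : ∃ n ≤ 3, (Prog.ite 7 Option.isSome (.seq (.pop 7) (.push 0 (some true)))
          (.push 0 (some false))).Exec (Function.update (counters (Function.update s1 7 (a % 2))) 0 z)
          (Function.update (counters s1) 0 (some (decide (a % 2 = 1)) :: z)) n := by
        rcases Nat.mod_two_eq_zero_or_one a with h | h
        · refine ⟨2, by omega, .iteFalse (by simp [counters, h]) ?_⟩
          have : Function.update s1 7 (a % 2) = s1 := by rw [h, ← s17, Function.update_eq_self]
          rw [this, h]
          have := Exec.push (Function.update (counters s1) 0 z) 0 (some false)
          rwa [Function.update_self, Function.update_idem] at this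
        · have q1 := Exec.pop (Function.update (counters (Function.update s1 7 (a % 2))) 0 z) 7
          have q2 := Exec.push (Function.update (counters s1) 0 z) 0 (some true)
          rw [Function.update_self, Function.update_idem] at q2
          refine ⟨1 + 1 + 1, le_rfl, .iteTrue (by simp [counters, h]) (.seq (q1.congr ?_ rfl)
            (q2.congr (by simp [h]) rfl))⟩
          funext j
          by_cases j0 : j = 0
          · subst j0; simp
          by_cases j7 : j = 7
          · subst j7; simp [counters, h, s17]
          simp [j0, j7, counters]
      obtain ⟨n2, hn2, e2⟩ := e2
      obtain ⟨n3, hn3, e3⟩ := Runs.move s1 (j := 6) (o := x) x6.symm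
      have s16 : s1 6 = a / 2 := by simp [hs1]
      rw [s16] at hn3
      have e3 := e3.frame (j := 0) (by simp [move, whilePos, inc, Avoids, x0])
        (some (decide (a % 2 = 1)) :: z)
      have hs2 : Function.update (Function.update s1 6 0) x (s1 x + s1 6) =
          Function.update s x (a / 2) := by
        funext j
        by_cases jx : j = x
        · subst jx; simp [hs1, x6]
        by_cases j6 : j = 6
        · subst j6; simp [jx, h6]
        simp [hs1, jx, j6]
      rw [hs2] at e3
      obtain ⟨n4, hn4, e4⟩ := ih (a / 2) (by omega) (Function.update s x (a / 2)) (by simp)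
        (by simp [x6.symm, h6]) (by simp [x7.symm, h7]) (some (decide (a % 2 = 1)) :: z)
      rw [Function.update_idem] at e4
      refine ⟨n1 + (n2 + n3) + n4 + 1, by omega, .loopTrue ?_ (.seq e1 (.seq e2 e3)) ?_⟩
      · obtain ⟨v, hv⟩ := Nat.exists_eq_succ_of_ne_zero ha.ne'
        simp [Function.update_of_ne x0, counters, hsx, hv, List.replicate_succ]
      · suffices h : encodeNat a = decide (a % 2 = 1) :: encodeNat (a / 2) by
          rw [h]
          simpa [pushDigits] using e4
        rcases Nat.even_or_odd' a with ⟨m, rfl | rfl⟩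
        · rw [encodeNat_double (by omega)]
          simp
        · rw [encodeNat_double_add_one]
          have : (2 * m + 1) / 2 = m := by omega
          simp [this, Nat.add_mod]

/-- Move a word of digits from stack `0` to stack `1`. -/
def flush : Prog :=
  .loop 0 Option.isSome (.seq (.ite 0 isOne (.push 1 (some true)) (.push 1 (some false))) (.pop 0))

theorem exec_flush (l : List Bool) (S : Store) (h0 : S 0 = l.map some) :
    flush.Exec S (Function.update (Function.update S 0 []) 1 (l.reverse.map some ++ S 1))
      (4 * l.length + 1) := by
  induction l generalizing S with
  | nil =>
    have : (Function.update (Function.update S 0 []) 1 (([] : List Bool).reverse.map some ++ S 1))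
        = S := by
      funext j
      by_cases j1 : j = 1
      · subst j1; simp
      by_cases j0 : j = 0
      · subst j0; simp [h0]
      simp [j1, j0]
    rw [this]
    exact .loopFalse (by simp [h0])
  | cons b l ih =>
    have e1 : (Prog.ite 0 isOne (.push 1 (some true)) (.push 1 (some false))).Exec S
        (Function.update S 1 (some b :: S 1)) 2 := by
      cases b with
      | true => exact .iteTrue (by simp [h0, isOne]) (.push _ _ _)
      | false => exact .iteFalse (by simp [h0, isOne]) (.push _ _ _)
    have e2 := Exec.pop (Function.update S 1 (some b :: S 1)) 0
    have e3 := ih _ (show Function.update (Function.update S 1 (some b :: S 1)) 0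
      (Function.update S 1 (some b :: S 1) 0).tail 0 = _ by simp [h0])
    have e := Exec.loopTrue (j := 0) (c := Option.isSome) (by simp [h0]) (.seq e1 e2) e3
    refine e.congr ?_ (by simp; omega)
    · funext j
      by_cases j1 : j = 1
      · subst j1; simp
      by_cases j0 : j = 0
      · subst j0; simp
      simp [j1, j0]

/-- Write the counter `x` in binary onto stack `1`. -/
def writeNat (x : ℕ) : Prog := .seq (pushDigits x) flush

theorem exec_writeNat {x : ℕ} (hx : 7 < x) (s : ℕ → ℕ) (h0 : s 0 = 0)
    (h6 : s 6 = 0) (h7 : s 7 = 0) (w : List (Option Bool)) :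
    ∃ n ≤ 50 * (s x + 1), (writeNat x).Exec (Function.update (counters s) 1 w)
      (Function.update (counters (Function.update s x 0)) 1 (binaryWord (s x) ++ w)) n := by
  obtain ⟨n1, hn1, e1⟩ := exec_pushDigits hx (s x) s rfl h6 h7 []
  have hs : Function.update (counters s) 0 [] = counters s := by
    funext j
    by_cases j0 : j = 0
    · subst j0; simp [counters, h0]
    simp [j0]
  rw [hs, List.append_nil] at e1
  have x1 : x ≠ 1 := by omega
  have x0 : x ≠ 0 := by omega
  have e1 := e1.frame (j := 1) (by simp [pushDigits, halve, move, whilePos, inc, Avoids, x1]) w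
  have e2 := exec_flush (encodeNat (s x)).reverse _
    (show Function.update (Function.update (counters (Function.update s x 0)) 0
      ((encodeNat (s x)).reverse.map some)) 1 w 0 = _ by simp)
  refine ⟨_, ?_, .seq e1 (?_ : flush.Exec _ _ (4 * (encodeNat (s x)).reverse.length + 1))⟩
  · have h1 := two_pow_length_encodeNat_le (s x)
    have h2 := Nat.lt_two_pow_self (n := (encodeNat (s x)).length)
    rw [List.length_reverse]
    omega
  · convert e2 using 1
    funext j
    by_cases j1 : j = 1
    · subst j1; simp [binaryWord]
    by_cases j0 : j = 0
    · subst j0; simp [counters, x0.symm, h0]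
    simp [j1, j0]

/-- Evaluation of a quotient of two computable functions at a query. -/
def quotientProg (P Q : Prog) : Prog :=
  -- The output stack is filled from the end of the word: denominator, separator, numerator, sign.
  -- The query counters are cleared because the halting configuration has all stacks but the output
  -- empty.
  .seq readQuery (.seq P (.seq Q (.seq (writeNat 9) (.seq (.push 1 none) (.seq (writeNat 8)
    (.seq (.push 1 (some false)) (.seq (clear 2) (.seq (clear 3) (.seq (clear 4) (clear 5))))))))))

/-- Every summand is at most a constant times `Y`, thanks to `u, v < 2 ^ r`. One more factor `Y ≥ 2
^ 16` absorbs the constant, and squaring `Y` only adds `1` to the inner exponent. -/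
theorem time_bound {r u v t c T A B : ℕ} (hu : u < 2 ^ r) (hv : v < 2 ^ r)
    (h : T + A + B ≤ 2 ^ 2 ^ (c * (r + t) + c)) :
    40 * ((2 * r + 1) ^ 2 + (2 * u + 1) ^ 2 + (2 * v + 1) ^ 2 + (2 * t + 1) ^ 2) + 3 + T +
      50 * (A + 1) + 50 * (B + 1) + 2 * (r + u + v + t) + 10 ≤
      2 ^ 2 ^ ((c + 5) * (r + t) + (c + 5)) := by
  set Y := 2 ^ 2 ^ ((c + 1) * (r + t) + c + 4) with hY
  have h1 : T + A + B ≤ Y := h.trans (Nat.pow_le_pow_right (by norm_num)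
    (Nat.pow_le_pow_right (by norm_num) (by nlinarith)))
  have h2 : ∀ y, y < 2 ^ (r + t) → (2 * y + 1) ^ 2 ≤ Y := by
    intro y hy
    calc (2 * y + 1) ^ 2 ≤ (2 ^ (r + t + 1)) ^ 2 :=
          Nat.pow_le_pow_left (by rw [pow_succ]; omega) 2
      _ = 2 ^ ((r + t + 1) * 2) := by rw [← pow_mul]
      _ ≤ Y := Nat.pow_le_pow_right (by norm_num) ?_
    calc (r + t + 1) * 2 ≤ 2 ^ (r + t + 1) * 2 :=
          Nat.mul_le_mul_right _ (Nat.lt_two_pow_self).le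
      _ = 2 ^ (r + t + 2) := by rw [← pow_succ]
      _ ≤ _ := Nat.pow_le_pow_right (by norm_num) (by nlinarith)
  have hr : r < 2 ^ (r + t) := (Nat.lt_two_pow_self).trans_le
    (Nat.pow_le_pow_right (by norm_num) (by omega))
  have ht : t < 2 ^ (r + t) := (Nat.lt_two_pow_self).trans_le
    (Nat.pow_le_pow_right (by norm_num) (by omega))
  have hrt : 2 ^ r ≤ 2 ^ (r + t) := Nat.pow_le_pow_right (by norm_num) (by omega)
  have q1 := h2 r hr
  have q2 := h2 u (by omega)
  have q3 := h2 v (by omega)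
  have q4 := h2 t ht
  have k : ∀ y, 2 * y + 1 ≤ (2 * y + 1) ^ 2 := fun y => Nat.le_self_pow (by norm_num) _
  have k1 := k r
  have k2 := k u
  have k3 := k v
  have k4 := k t
  have h16 : 2 ^ 2 ^ 4 ≤ Y := Nat.pow_le_pow_right (by norm_num)
    (Nat.pow_le_pow_right (by norm_num) (by omega))
  have hfin : Y * Y ≤ 2 ^ 2 ^ ((c + 5) * (r + t) + (c + 5)) := by
    rw [hY, ← pow_add, ← two_mul, ← pow_succ']
    exact Nat.pow_le_pow_right (by norm_num) (Nat.pow_le_pow_right (by norm_num) (by nlinarith))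
  have : 2 ^ 2 ^ 4 * Y ≤ Y * Y := Nat.mul_le_mul_right _ h16
  norm_num at this h16
  omega

/-- Quotients of functions computed by counter programs in double exponential time. -/
theorem doubleExpTimeComputable_div {F G T U : (Fin 4 → ℕ) → ℕ} (hF : Comp F T) (hG : Comp G U)
    (c : ℕ) (hb : ∀ r u v t : ℕ, u < 2 ^ r → v < 2 ^ r → T ![r, u, v, t] + U ![r, u, v, t] +
      F ![r, u, v, t] + G ![r, u, v, t] ≤ 2 ^ 2 ^ (c * (r + t) + c))
    (hpos : ∀ x, 0 < G x) :
    DoubleExpTimeComputable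
      (fun Q t => (F ![Q.r, Q.u, Q.v, t] : ℚ) / (G ![Q.r, Q.u, Q.v, t] : ℚ)) := by
  obtain ⟨w, hw⟩ := hF
  obtain ⟨w', hw'⟩ := hG
  obtain ⟨P, hP, rP⟩ := hw ![2, 3, 4, 5] 8 10 (by decide) (by decide) (by decide)
  obtain ⟨Q', hQ', rQ⟩ := hw' ![2, 3, 4, 5] 9 10 (by decide) (by decide) (by decide)
  have hU : (quotientProg P Q').UsesBelow (8 + w + w' + 2) := by
    have h1 := hP.mono (n := 8 + w + w' + 2) (by omega)
    have h2 := hQ'.mono (n := 8 + w + w' + 2) (by omega)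
    simp only [quotientProg, readQuery, readNat, readDigits, doubleWeight, copy, writeNat,
      pushDigits, halve, flush, clear, move, whilePos, inc, UsesBelow, h1, h2, true_and, and_true]
    omega
  refine ⟨⟨(quotientProg P Q').toFinTM2 (8 + w + w'), Equiv.refl _, Equiv.refl _⟩, c + 5,
    fun k => inferInstanceAs (Finite (Option Bool)), fun Q t => ?_⟩
  set x : Fin 4 → ℕ := ![Q.r, Q.u, Q.v, t] with hx
  refine ⟨some false :: (binaryWord (F x) ++ none :: binaryWord (G x)),
    ⟨false, F x, G x, hpos x, rfl, by simp [hx]⟩, ?_⟩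
  have hid : ∀ l : List (Option Bool), l.map (Equiv.refl (Option Bool)).symm = l := by
    intro l; simp
  obtain ⟨n1, hn1, e1⟩ := exec_readQuery Q t
  set s0 := queryCounters Q.r Q.u Q.v t with hs0
  have hz : ∀ j, 6 ≤ j → s0 j = 0 := queryCounters_of_le _ _ _ _
  have hx0 : s0 ∘ ![2, 3, 4, 5] = x := by
    funext i
    fin_cases i <;> rfl
  obtain ⟨n2, hn2, e2⟩ := rP s0 (fun j hj => hz j (by omega))
  rw [hx0, hz 8 (by omega), zero_add] at e2
  rw [hx0] at hn2
  set s1 := Function.update s0 8 (F x) with hs1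
  have hx1 : s1 ∘ ![2, 3, 4, 5] = x := by
    funext i
    fin_cases i <;> rfl
  obtain ⟨n3, hn3, e3⟩ := rQ s1 (fun j hj => by
    rw [hs1, Function.update_of_ne (by omega)]
    exact hz j (by omega))
  have s19 : s1 9 = 0 := by simp [hs1, hz]
  rw [hx1, s19, zero_add] at e3
  rw [hx1] at hn3
  set s2 := Function.update s1 9 (G x) with hs2
  have s20 : s2 0 = 0 := rfl
  have s26 : s2 6 = 0 := rfl
  have s27 : s2 7 = 0 := rfl
  obtain ⟨n4, hn4, e4⟩ := exec_writeNat (x := 9) (by decide) s2 s20 s26 s27 []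
  have hc1 : Function.update (counters s2) 1 [] = counters s2 := by
    have : counters s2 1 = [] := rfl
    rw [← this, Function.update_eq_self]
  have s29 : s2 9 = G x := by simp [hs2]
  rw [hc1, s29, List.append_nil] at e4
  rw [s29] at hn4
  have hs3 : Function.update s2 9 0 = s1 := by
    rw [hs2, Function.update_idem, ← s19, Function.update_eq_self]
  rw [hs3] at e4
  have e5 := Exec.push (Function.update (counters s1) 1 (binaryWord (G x))) 1 none
  rw [Function.update_self, Function.update_idem] at e5
  obtain ⟨n6, hn6, e6⟩ := exec_writeNat (x := 8) (by decide) s1 rfl rfl rfl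
    (none :: binaryWord (G x))
  have s18 : s1 8 = F x := by simp [hs1]
  have hs4 : Function.update s1 8 0 = s0 := by
    rw [hs1, Function.update_idem, ← hz 8 (by omega), Function.update_eq_self]
  rw [s18, hs4] at e6
  rw [s18] at hn6
  have e7 := Exec.push (Function.update (counters s0) 1
    (binaryWord (F x) ++ none :: binaryWord (G x))) 1 (some false)
  rw [Function.update_self, Function.update_idem] at e7
  set out := some false :: (binaryWord (F x) ++ none :: binaryWord (G x)) with hout
  obtain ⟨n8, hn8, e8⟩ := (Runs.clear s0 2).seq ((Runs.clear _ 3).seq ((Runs.clear _ 4).seq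
    (Runs.clear _ 5)))
  have e8 := e8.frame (j := 1) (by simp [clear, whilePos, Avoids]) out
  have hs5 : Function.update (Function.update (Function.update (Function.update s0 2 0) 3 0) 4 0)
      5 0 = fun _ => 0 := by
    funext j
    simp only [Function.update_apply, hs0, queryCounters]
    split_ifs <;> rfl
  rw [hs5] at e8
  have e := Exec.seq e1 (.seq e2 (.seq e3 (.seq e4 (.seq e5 (.seq e6 (.seq e7 e8))))))
  have hzero : counters (fun _ => 0) = fun _ => [] := rfl
  rw [hzero] at e
  have htime := time_bound (t := t) (T := T x + U x) (A := F x) (B := G x) Q.hu Q.hv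
    (hb Q.r Q.u Q.v t Q.hu Q.hv)
  have hn8' : n8 ≤ 2 * (Q.r + Q.u + Q.v + t) + 4 := by
    simp [hs0, queryCounters] at hn8
    omega
  have hfin := Exec.outputsInTime hU (w := queryWord Q t) (w' := out)
    (T := 2 ^ 2 ^ ((c + 5) * (Q.r + t) + (c + 5))) e (by omega)
  dsimp only
  exact (hid (queryWord Q t)).symm ▸ (hid out).symm ▸ hfin

end StackProg

/-! ### An effective Borel-Cantelli lemma -/

namespace StackProg

/-- The double exponential bound available to computations at a query. -/
def bigBound (a : ℕ) (x : Fin 4 → ℕ) : ℕ := 2 ^ 2 ^ (4 * (x 3 + 2 * x 0 + a))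

/-- Exponentials are not polynomially bounded, hence not `PolyComp`; applied twice, this produces
`bigBound`. Doubling is linear in the current value, so the costs form a geometric sum. -/
theorem Comp.two_pow {k : ℕ} {g U : (Fin k → ℕ) → ℕ} (hg : Comp g U) :
    Comp (fun x => 2 ^ g x) (fun x => U x + 40 * 2 ^ g x) := by
  have h : Comp (fun z : Fin (k + 2) → ℕ => z 1 + z 1) _ := (Comp.var 1).add (Comp.var 1)
  refine (Comp.recursion hg .one h (fun _ i => 2 ^ i) (fun _ => rfl)
    (fun x i => ?_)).mono (fun x => ?_)
  · change 2 ^ (i + 1) = 2 ^ i + 2 ^ i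
    rw [pow_succ]; omega
  · have h1 : ∑ i ∈ Finset.range (g x), ((7 * (Fin.cons i (Fin.cons (2 ^ i) x) : Fin (k + 2) → ℕ) 1
        + 2 + (7 * (Fin.cons i (Fin.cons (2 ^ i) x) : Fin (k + 2) → ℕ) 1 + 2)) + 2 * 2 ^ i +
        3 * 2 ^ (i + 1) + 5) = ∑ i ∈ Finset.range (g x), (22 * 2 ^ i + 9) := by
      refine Finset.sum_congr rfl fun i _ => ?_
      change 7 * 2 ^ i + 2 + (7 * 2 ^ i + 2) + 2 * 2 ^ i + 3 * 2 ^ (i + 1) + 5 = _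
      rw [pow_succ]; ring
    have h2 : ∑ i ∈ Finset.range (g x), (22 * 2 ^ i + 9) ≤ 22 * 2 ^ g x + 9 * g x := by
      rw [Finset.sum_add_distrib, ← Finset.mul_sum, Finset.sum_const, Finset.card_range, smul_eq_mul,
        Nat.geomSum_eq (le_refl 2)]
      have := Nat.div_le_self (2 ^ g x - 1) (2 - 1)
      omega
    have h3 := Nat.lt_two_pow_self (n := g x)
    rw [h1]
    omega

/-- Quotients of functions that are polynomial time computable relative to the bound. -/
theorem doubleExpTimeComputable_of_polyComp {F G : (Fin 5 → ℕ) → ℕ} (hF : PolyComp F)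
    (hG : PolyComp G) (a : ℕ) (hpos : ∀ x, 0 < G (Fin.cons (bigBound a x) x)) :
    DoubleExpTimeComputable (fun Q t =>
      (F (Fin.cons (bigBound a ![Q.r, Q.u, Q.v, t]) ![Q.r, Q.u, Q.v, t]) : ℚ) /
      (G (Fin.cons (bigBound a ![Q.r, Q.u, Q.v, t]) ![Q.r, Q.u, Q.v, t]) : ℚ)) := by
  have hlin : PolyComp (fun x : Fin 4 → ℕ => 4 * (x 3 + 2 * x 0 + a)) :=
    (PolyComp.const 4).mul (((PolyComp.var 3).add ((PolyComp.const 2).mul (.var 0))).add (.const a))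
  obtain ⟨-, L, ⟨cL, hL⟩, hL'⟩ := hlin
  have hN : Comp (bigBound a) (fun x => L x + 40 * 2 ^ (4 * (x 3 + 2 * x 0 + a)) +
      40 * bigBound a x) := hL'.two_pow.two_pow
  obtain ⟨⟨cF, bF⟩, T, ⟨cT, bT⟩, hT⟩ := hF
  obtain ⟨⟨cG, bG⟩, U, ⟨cU, bU⟩, hU⟩ := hG
  refine doubleExpTimeComputable_div (hT.bind hN) (hU.bind hN)
    (16 + 4 * a + (3 * (cL + cF + cT + cG + cU) + 1)) (fun r u v t hu hv => ?_) hpos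
  set x : Fin 4 → ℕ := ![r, u, v, t] with hx
  set N := bigBound a x with hNdef
  set e := 4 * (t + 2 * r + a) with he
  have hNe : N = 2 ^ 2 ^ e := rfl
  have hMN : 2 ^ e ≤ N := (Nat.lt_two_pow_self).le
  have hN2 : 2 ≤ N := by
    calc 2 = 2 ^ 1 := rfl
      _ ≤ N := Nat.pow_le_pow_right (by norm_num) Nat.one_le_two_pow
  have hsum : ∑ i, x i = r + u + v + t := by
    simp [hx, Fin.sum_univ_four]
  have hS : r + u + v + t + 2 ≤ 2 * N := by
    have h1 : r < 2 ^ r := Nat.lt_two_pow_self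
    have h2 : t < 2 ^ t := Nat.lt_two_pow_self
    by_cases hzero : r + t = 0
    · have hr0 : r = 0 := by omega
      subst hr0
      simp at hu hv
      omega
    · have h3 : 2 ^ (r + 2) ≤ 2 ^ (2 ^ e) := by
        refine Nat.pow_le_pow_right (by norm_num) ?_
        have : e < 2 ^ e := Nat.lt_two_pow_self
        omega
      have h4 : 2 ^ t ≤ 2 ^ (2 ^ e) := by
        refine Nat.pow_le_pow_right (by norm_num) ?_
        have : e < 2 ^ e := Nat.lt_two_pow_self
        omega
      rw [pow_add] at h3
      rw [hNe]
      omega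
  have hcube : 3 * N ≤ N ^ 3 := by nlinarith [Nat.mul_le_mul hN2 hN2]
  -- The arguments, `N` included, sum to at most `N ^ 3`, so all values and running times that are
  -- polynomial in them are at most `N ^ K`, which is again double exponential.
  set K := 3 * (cL + cF + cT + cG + cU) + 1 with hK
  have hpow : ∀ c, c ≤ cL + cF + cT + cG + cU → ∀ S, S ≤ N ^ 3 → S ^ c ≤ N ^ K := by
    intro c hc S hS
    refine (Nat.pow_le_pow_left hS c).trans ?_
    rw [← pow_mul]
    exact Nat.pow_le_pow_right (by omega) (by omega)
  have hcons : 2 + ∑ i, (Fin.cons N x : Fin 5 → ℕ) i ≤ N ^ 3 := by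
    rw [Fin.sum_cons, hsum]; omega
  have q1 := (hL x).trans (hpow cL (by omega) _ (by rw [hsum]; omega))
  have q2 := (bF (Fin.cons N x)).trans (hpow cF (by omega) _ hcons)
  have q3 := (bT (Fin.cons N x)).trans (hpow cT (by omega) _ hcons)
  have q4 := (bG (Fin.cons N x)).trans (hpow cG (by omega) _ hcons)
  have q5 := (bU (Fin.cons N x)).trans (hpow cU (by omega) _ hcons)
  have q6 : N ≤ N ^ K := Nat.le_self_pow (by omega) _
  have q7 : 4 * (x 3 + 2 * x 0 + a) = e := rfl
  have q8 : 2 ^ 8 * N ^ K ≤ N ^ (K + 8) := by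
    rw [pow_add N K 8, mul_comm]
    exact Nat.mul_le_mul_left _ (Nat.pow_le_pow_left hN2 8)
  have q9 : N ^ (K + 8) ≤ 2 ^ 2 ^ ((16 + 4 * a + K) * (r + t) + (16 + 4 * a + K)) := by
    rw [hNe, ← pow_mul]
    refine Nat.pow_le_pow_right (by norm_num) ?_
    calc 2 ^ e * (K + 8) ≤ 2 ^ e * 2 ^ (K + 8) :=
          Nat.mul_le_mul_left _ (Nat.lt_two_pow_self).le
      _ = 2 ^ (e + (K + 8)) := by rw [← pow_add]
      _ ≤ _ := Nat.pow_le_pow_right (by norm_num) ?_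
    have h1 := Nat.zero_le (a * (r + t))
    have h2 := Nat.zero_le (K * (r + t))
    nlinarith
  rw [q7]
  norm_num at q8
  omega

end StackProg

/-! ### Martingales averaging weights on a dyadic grid -/

namespace DyadicSquare

/-- The total weight of the cells at level `m` inside `Q`; below level `m`, the weight of the
cell containing `Q`. -/
def gridSum (g : ℕ → ℕ → ℕ) (m : ℕ) (Q : DyadicSquare) : ℕ :=
  ∑ i ∈ Finset.range (2 ^ (m - Q.r)), ∑ j ∈ Finset.range (2 ^ (m - Q.r)),
    g ((Q.u * 2 ^ (m - Q.r) + i) / 2 ^ (Q.r - m)) ((Q.v * 2 ^ (m - Q.r) + j) / 2 ^ (Q.r - m))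

/-- The average weight of the cells at level `m` inside `Q`. -/
noncomputable def gridAverage (g : ℕ → ℕ → ℕ) (m : ℕ) (Q : DyadicSquare) : ℝ≥0 :=
  (gridSum g m Q : ℝ≥0) / 4 ^ (m - Q.r)

theorem gridSum_of_le {g : ℕ → ℕ → ℕ} {m : ℕ} {Q : DyadicSquare} (h : m ≤ Q.r) :
    gridSum g m Q = g (Q.u / 2 ^ (Q.r - m)) (Q.v / 2 ^ (Q.r - m)) := by
  simp [gridSum, Nat.sub_eq_zero_of_le h]

theorem gridAverage_of_le {g : ℕ → ℕ → ℕ} {m : ℕ} {Q : DyadicSquare} (h : m ≤ Q.r) :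
    gridAverage g m Q = g (Q.u / 2 ^ (Q.r - m)) (Q.v / 2 ^ (Q.r - m)) := by
  simp [gridAverage, gridSum_of_le h, Nat.sub_eq_zero_of_le h]

theorem gridSum_of_ge {g : ℕ → ℕ → ℕ} {m k : ℕ} {Q : DyadicSquare} (h : m = Q.r + k) :
    gridSum g m Q = ∑ i ∈ Finset.range (2 ^ k), ∑ j ∈ Finset.range (2 ^ k),
      g (Q.u * 2 ^ k + i) (Q.v * 2 ^ k + j) := by
  simp [gridSum, h]

theorem sum_range_two_pow_succ (f : ℕ → ℕ) (u k : ℕ) :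
    ∑ i ∈ Finset.range (2 ^ (k + 1)), f (u * 2 ^ (k + 1) + i) =
      ∑ α : Fin 2, ∑ i ∈ Finset.range (2 ^ k), f ((2 * u + α) * 2 ^ k + i) := by
  rw [pow_succ, mul_two, Finset.sum_range_add, Fin.sum_univ_two]
  congr 1
  · refine Finset.sum_congr rfl fun i _ => ?_
    congr 1
    simp; ring
  · refine Finset.sum_congr rfl fun i _ => ?_
    congr 1
    simp; ring

/-- For `Q.r < m` the cells inside `Q` are distributed among its four children; from level `m` on
the children inherit the value of `Q`. -/
theorem gridAverage_eq_average (g : ℕ → ℕ → ℕ) (m : ℕ) (Q : DyadicSquare) :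
    gridAverage g m Q = 1 / 4 * ∑ α : Fin 2, ∑ β : Fin 2, gridAverage g m (Q.child α β) := by
  rcases Nat.lt_or_ge Q.r m with h | h
  · obtain ⟨k, rfl⟩ : ∃ k, m = Q.r + (k + 1) := ⟨m - Q.r - 1, by omega⟩
    have hc : ∀ α β, gridSum g (Q.r + (k + 1)) (Q.child α β) =
        ∑ i ∈ Finset.range (2 ^ k), ∑ j ∈ Finset.range (2 ^ k),
          g ((2 * Q.u + α) * 2 ^ k + i) ((2 * Q.v + β) * 2 ^ k + j) := fun α β =>
      gridSum_of_ge (by simp [child]; ring)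
    have hs : gridSum g (Q.r + (k + 1)) Q =
        ∑ α : Fin 2, ∑ β : Fin 2, gridSum g (Q.r + (k + 1)) (Q.child α β) := by
      rw [gridSum_of_ge rfl]
      simp only [hc]
      rw [sum_range_two_pow_succ (fun a => ∑ j ∈ Finset.range (2 ^ (k + 1)),
        g a (Q.v * 2 ^ (k + 1) + j)) Q.u k]
      refine Finset.sum_congr rfl fun α _ => ?_
      rw [Finset.sum_comm (s := (Finset.univ : Finset (Fin 2)))]
      refine Finset.sum_congr rfl fun i _ => ?_
      exact sum_range_two_pow_succ (g _) Q.v k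
    have e1 : Q.r + (k + 1) - Q.r = k + 1 := by omega
    have e2 : Q.r + (k + 1) - (Q.r + 1) = k := by omega
    have hr : ∀ α β, (Q.child α β).r = Q.r + 1 := fun _ _ => rfl
    simp only [gridAverage, hs, hr, e1, e2]
    push_cast
    simp only [← Finset.sum_div]
    rw [pow_succ]
    field_simp
  · have h' : m ≤ Q.r + 1 := by omega
    have hc : ∀ α β, gridAverage g m (Q.child α β) = gridAverage g m Q := by
      intro α β
      rw [gridAverage_of_le h, gridAverage_of_le (Q := Q.child α β) h']
      have e : Q.r + 1 - m = (Q.r - m) + 1 := by omega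
      have h1 : ∀ w : ℕ, ∀ γ : Fin 2, (2 * w + γ) / 2 ^ (Q.r + 1 - m) = w / 2 ^ (Q.r - m) := by
        intro w γ
        rw [e, pow_succ', ← Nat.div_div_eq_div_mul]
        congr 1
        have := γ.isLt
        omega
      simp only [child, h1]
    simp only [hc, Fin.sum_univ_two]
    field_simp
    norm_num

theorem sum_shift_le {M : Type*} [AddCommMonoid M] [PartialOrder M] [CanonicallyOrderedAdd M]
    [IsOrderedAddMonoid M] (f : ℕ → M) {r u k : ℕ} (hu : u < 2 ^ r) :
    ∑ i ∈ Finset.range (2 ^ k), f (u * 2 ^ k + i) ≤ ∑ i ∈ Finset.range (2 ^ (r + k)), f i := by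
  have h : (u + 1) * 2 ^ k ≤ 2 ^ (r + k) := by
    rw [pow_add]
    exact Nat.mul_le_mul_right _ hu
  have h2 := Finset.sum_Ico_eq_sum_range f (u * 2 ^ k) ((u + 1) * 2 ^ k)
  have h3 : (u + 1) * 2 ^ k - u * 2 ^ k = 2 ^ k := by rw [add_mul]; omega
  rw [h3] at h2
  rw [← h2]
  refine Finset.sum_le_sum_of_subset fun i hi => ?_
  rw [Finset.mem_Ico] at hi
  rw [Finset.mem_range]
  omega

theorem gridSum_le (g : ℕ → ℕ → ℕ) (m : ℕ) (Q : DyadicSquare) :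
    gridSum g m Q ≤ ∑ i ∈ Finset.range (2 ^ m), ∑ j ∈ Finset.range (2 ^ m), g i j := by
  rcases Nat.le_total Q.r m with h | h
  · obtain ⟨k, rfl⟩ : ∃ k, m = Q.r + k := ⟨m - Q.r, by omega⟩
    rw [gridSum_of_ge rfl]
    refine le_trans ?_ (sum_shift_le (fun i => ∑ j ∈ Finset.range (2 ^ (Q.r + k)), g i j) Q.hu)
    exact Finset.sum_le_sum fun i _ => sum_shift_le (g _) Q.hv
  · rw [gridSum_of_le h]
    have hlt : ∀ w, w < 2 ^ Q.r → w / 2 ^ (Q.r - m) < 2 ^ m := by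
      intro w hw
      rw [Nat.div_lt_iff_lt_mul (by positivity), ← pow_add]
      convert hw using 2
      omega
    refine le_trans ?_ (Finset.single_le_sum (f := fun i => ∑ j ∈ Finset.range (2 ^ m), g i j)
      (fun _ _ => Nat.zero_le _) (Finset.mem_range.2 (hlt _ Q.hu)))
    exact Finset.single_le_sum (f := g _) (fun _ _ => Nat.zero_le _)
      (Finset.mem_range.2 (hlt _ Q.hv))

/-- All the weight could sit inside `Q`, at the price of a factor `4 ^ Q.r`. The term `2 * r` in the
number of summands of `partialNumerator` compensates for it. -/
theorem gridAverage_le {g : ℕ → ℕ → ℕ} {m s C : ℕ} (hC : 2 ^ s * ∑ i ∈ Finset.range (2 ^ m),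
    ∑ j ∈ Finset.range (2 ^ m), g i j ≤ C * 4 ^ m) (Q : DyadicSquare) :
    gridAverage g m Q ≤ 4 ^ Q.r * C * (1 / 2) ^ s := by
  have h1 : 2 ^ s * gridSum g m Q ≤ C * 4 ^ m := (Nat.mul_le_mul_left _ (gridSum_le g m Q)).trans hC
  have h2 : 2 ^ s * gridSum g m Q ≤ 4 ^ Q.r * C * 4 ^ (m - Q.r) := by
    refine h1.trans ?_
    calc C * 4 ^ m ≤ C * 4 ^ (Q.r + (m - Q.r)) :=
          Nat.mul_le_mul_left _ (Nat.pow_le_pow_right (by norm_num) (by omega))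
      _ = _ := by rw [pow_add]; ring
  rw [gridAverage, one_div, inv_pow, ← div_eq_mul_inv, div_le_div_iff₀ (by positivity)
    (by positivity), mul_comm]
  exact_mod_cast h2

/-- From level `m` on, the average at the square containing `p` is the weight of the cell of `p`. -/
theorem gridAverage_containing {g : ℕ → ℕ → ℕ} {m r : ℕ} (h : m ≤ r) {p : Plane}
    (hp : p ∈ unitSquare) :
    gridAverage g m (containing r p hp) = g ⌊(2 : ℝ) ^ m * p 0⌋₊ ⌊(2 : ℝ) ^ m * p 1⌋₊ := by
  have hf : ∀ x : ℝ, ⌊(2 : ℝ) ^ r * x⌋₊ / 2 ^ (r - m) = ⌊(2 : ℝ) ^ m * x⌋₊ := by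
    intro x
    have := Nat.floor_div_natCast ((2 : ℝ) ^ r * x) (2 ^ (r - m))
    rw [← this]
    congr 1
    have h2 : (2 : ℝ) ^ r = 2 ^ m * 2 ^ (r - m) := by rw [← pow_add]; congr 1; omega
    rw [h2]
    push_cast
    field_simp
  rw [gridAverage_of_le (Q := containing r p hp) h]
  simp only [containing, hf]

end DyadicSquare

/-! ### Superposition of the averages and its computability -/

open DyadicSquare StackProg

/-- Weights at the levels `16 ^ s` give a numerator for the partial sums of the averages. -/
def partialNumerator (g : ℕ → ℕ → ℕ → ℕ → ℕ) (a N r u v t : ℕ) : ℕ :=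
  ∑ s ∈ Finset.range (t + 2 * r + a),
    -- The common denominator is `N * N`. For the intended `N` this quotient is exact, since the
    -- number of cells along a side of `Q` is a power of two dividing `N`.
    N * N / (min (2 ^ (min (2 ^ (4 * s)) N - r)) N * min (2 ^ (min (2 ^ (4 * s)) N - r)) N) *
      ∑ i ∈ Finset.range (min (2 ^ (min (2 ^ (4 * s)) N - r)) N),
        ∑ j ∈ Finset.range (min (2 ^ (min (2 ^ (4 * s)) N - r)) N),
          g N s ((u * min (2 ^ (min (2 ^ (4 * s)) N - r)) N + i) /
              min (2 ^ (r - min (2 ^ (4 * s)) N)) N)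
            ((v * min (2 ^ (min (2 ^ (4 * s)) N - r)) N + j) /
              min (2 ^ (r - min (2 ^ (4 * s)) N)) N)

theorem polyComp_partialNumerator {g : ℕ → ℕ → ℕ → ℕ → ℕ}
    (hg : PolyComp fun x : Fin 4 → ℕ => g (x 0) (x 1) (x 2) (x 3)) (a : ℕ) :
    PolyComp fun x : Fin 5 → ℕ => partialNumerator g a (x 0) (x 1) (x 2) (x 3) (x 4) := by
  have hP : ∀ {k : ℕ} {s N r : (Fin k → ℕ) → ℕ}, PolyComp s → PolyComp N → PolyComp r →
      PolyComp fun x => min (2 ^ (min (2 ^ (4 * s x)) (N x) - r x)) (N x) := fun hs hN hr =>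
    hN.min_two_pow ((hN.min_two_pow ((PolyComp.const 4).mul hs)).sub hr)
  have hR : ∀ {k : ℕ} {s N r : (Fin k → ℕ) → ℕ}, PolyComp s → PolyComp N → PolyComp r →
      PolyComp fun x => min (2 ^ (r x - min (2 ^ (4 * s x)) (N x))) (N x) := fun hs hN hr =>
    hN.min_two_pow (hr.sub (hN.min_two_pow ((PolyComp.const 4).mul hs)))
  refine PolyComp.sum (F := fun s x => _) (((PolyComp.var 4).add ((PolyComp.const 2).mul
    (.var 1))).add (.const a)) ?_
  refine PolyComp.mul (((PolyComp.var 1).mul (.var 1)).div ((hP (.var 0) (.var 1) (.var 2)).mul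
    (hP (.var 0) (.var 1) (.var 2)))) ?_
  refine PolyComp.sum (F := fun i x => _) (hP (.var 0) (.var 1) (.var 2)) ?_
  refine PolyComp.sum (F := fun j x => _) (hP (.var 1) (.var 2) (.var 3)) ?_
  exact hg.comp4 (.var 3) (.var 2)
    ((((PolyComp.var 5).mul (hP (.var 2) (.var 3) (.var 4))).add (.var 1)).div
      (hR (.var 2) (.var 3) (.var 4)))
    ((((PolyComp.var 6).mul (hP (.var 2) (.var 3) (.var 4))).add (.var 0)).div
      (hR (.var 2) (.var 3) (.var 4)))

/-- For `s < t + 2 * Q.r + a` no power of two that occurs exceeds `N`, so all cut-offs are inactive.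
-/
theorem partialNumerator_eq {g : ℕ → ℕ → ℕ → ℕ} {g' : ℕ → ℕ → ℕ → ℕ → ℕ}
    (hg : ∀ N s i j, 2 ^ 16 ^ s ≤ N → g' N s i j = g s i j) (a : ℕ) (Q : DyadicSquare) (t N : ℕ)
    (hN : N = 2 ^ 16 ^ (t + 2 * Q.r + a)) :
    (partialNumerator g' a N Q.r Q.u Q.v t : ℝ) / (N * N : ℕ) =
      ∑ s ∈ Finset.range (t + 2 * Q.r + a), (gridAverage (g s) (16 ^ s) Q : ℝ) := by
  unfold partialNumerator
  rw [Nat.cast_sum, Finset.sum_div]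
  refine Finset.sum_congr rfl fun s hs => ?_
  rw [Finset.mem_range] at hs
  set S := t + 2 * Q.r + a with hS
  have h16 : (2 : ℕ) ^ (4 * s) = 16 ^ s := by rw [pow_mul]; norm_num
  have hlt : 16 ^ s ≤ 16 ^ S := Nat.pow_le_pow_right (by norm_num) hs.le
  have hle : ∀ e, e ≤ 16 ^ S → min (2 ^ e) N = 2 ^ e := fun e he => by
    rw [hN]
    exact min_eq_left (Nat.pow_le_pow_right (by norm_num) he)
  have hm : min (2 ^ (4 * s)) N = 16 ^ s := by
    rw [h16, hN]
    exact min_eq_left (hlt.trans (Nat.lt_two_pow_self).le)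
  have hr : Q.r ≤ 16 ^ S := by
    have : S < 16 ^ S := Nat.lt_pow_self (by norm_num)
    omega
  have hgs : ∀ i j, g' N s i j = g s i j := fun i j =>
    hg N s i j (by rw [hN]; exact Nat.pow_le_pow_right (by norm_num) hlt)
  have e1 := hle (16 ^ s - Q.r) (by omega)
  have e2 := hle (Q.r - 16 ^ s) ((Nat.sub_le _ _).trans hr)
  simp only [hm, e1, e2, hgs]
  obtain ⟨D, hD⟩ : ∃ D, N = 2 ^ (16 ^ s - Q.r) * D := by
    rw [hN]
    exact pow_dvd_pow 2 ((Nat.sub_le _ _).trans hlt)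
  have hN0 : 0 < N := by rw [hN]; positivity
  have hD0 : D ≠ 0 := by rintro rfl; omega
  have hdiv : N * N / (2 ^ (16 ^ s - Q.r) * 2 ^ (16 ^ s - Q.r)) = D * D := by
    rw [hD]
    refine Nat.div_eq_of_eq_mul_right (by positivity) (by ring)
  rw [hdiv, gridAverage, NNReal.coe_div, NNReal.coe_natCast]
  have h4 : (4 : ℝ) ^ (16 ^ s - Q.r) = 2 ^ (16 ^ s - Q.r) * 2 ^ (16 ^ s - Q.r) := by
    rw [← mul_pow]; norm_num
  change ((D * D * gridSum (g s) (16 ^ s) Q : ℕ) : ℝ) / _ = _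
  have hDR : (D : ℝ) ≠ 0 := by exact_mod_cast hD0
  push_cast
  rw [h4, hD]
  push_cast
  field_simp

/-- The stage averages decay like `2^-s` at each square, so their sum is a martingale approximated
by partial sums. A stage that charges the cell of `p` contributes at least `1` at all deeper squares
around `p`. The companion `g'` has the extra argument `N` because `g` itself need not be
polynomially bounded. -/
theorem hasEEMeasureZero_of_weights (g : ℕ → ℕ → ℕ → ℕ) (g' : ℕ → ℕ → ℕ → ℕ → ℕ)
    (hg' : PolyComp fun x : Fin 4 → ℕ => g' (x 0) (x 1) (x 2) (x 3))
    (hg : ∀ N s i j, 2 ^ 16 ^ s ≤ N → g' N s i j = g s i j) (C : ℕ)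
    (hC : ∀ s, 2 ^ s * ∑ i ∈ Finset.range (2 ^ 16 ^ s), ∑ j ∈ Finset.range (2 ^ 16 ^ s), g s i j ≤
      C * 4 ^ 16 ^ s) (E : Set Plane)
    (hE : ∀ p ∈ hashSet E, ∃ᶠ s in atTop,
      1 ≤ g s ⌊(2 : ℝ) ^ 16 ^ s * p 0⌋₊ ⌊(2 : ℝ) ^ 16 ^ s * p 1⌋₊) : HasEEMeasureZero E := by
  have hle : ∀ Q s, gridAverage (g s) (16 ^ s) Q ≤ 4 ^ Q.r * C * (1 / 2) ^ s :=
    fun Q s => gridAverage_le (hC s) Q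
  have hgeo : Summable fun s : ℕ => ((1 / 2 : ℝ≥0)) ^ s :=
    NNReal.summable_geometric (by rw [div_lt_one] <;> norm_num)
  have hsum : ∀ Q, Summable fun s => gridAverage (g s) (16 ^ s) Q := fun Q =>
    NNReal.summable_of_le (hle Q) (hgeo.mul_left _)
  refine ⟨fun Q => ∑' s, gridAverage (g s) (16 ^ s) Q, fun Q => ?_, ?_, fun p hp => ?_⟩
  · simp only [Fin.sum_univ_two]
    rw [← (hsum _).tsum_add (hsum _), ← (hsum _).tsum_add (hsum _),
      ← ((hsum _).add (hsum _)).tsum_add ((hsum _).add (hsum _)), ← NNReal.tsum_mul_left]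
    refine tsum_congr fun s => ?_
    rw [gridAverage_eq_average]
    simp only [Fin.sum_univ_two]
  -- The offset `C + 2` is chosen such that the tail, at most `2 * C * 4^r * 2^-(t + 2r + C + 2)`,
  -- is below `2^-t`; this uses `2 * C < 2^(C + 2)`.
  · refine ⟨fun Q t => (partialNumerator g' (C + 2) (bigBound (C + 2) ![Q.r, Q.u, Q.v, t])
        Q.r Q.u Q.v t : ℚ) / ((bigBound (C + 2) ![Q.r, Q.u, Q.v, t] *
          bigBound (C + 2) ![Q.r, Q.u, Q.v, t] : ℕ) : ℚ), fun Q t => ?_,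
      doubleExpTimeComputable_of_polyComp (polyComp_partialNumerator hg' (C + 2))
        ((PolyComp.var 0).mul (PolyComp.var 0)) (C + 2) (fun x => ?_)⟩
    · have hN : bigBound (C + 2) ![Q.r, Q.u, Q.v, t] = 2 ^ 16 ^ (t + 2 * Q.r + (C + 2)) := by
        change 2 ^ 2 ^ (4 * (t + 2 * Q.r + (C + 2))) = _
        rw [pow_mul 2 4]
        norm_num
      have h1 := partialNumerator_eq hg (C + 2) Q t _ hN
      set S := t + 2 * Q.r + (C + 2) with hS
      rw [Rat.cast_div, Rat.cast_natCast, Rat.cast_natCast, h1]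
      have h2 := (NNReal.summable_coe.2 (hsum Q)).sum_add_tsum_nat_add S
      rw [NNReal.coe_tsum, ← h2, add_sub_cancel_left]
      have h3 : Summable fun i => ((gridAverage (g (i + S)) (16 ^ (i + S)) Q : ℝ≥0) : ℝ) :=
        (summable_nat_add_iff S).2 (NNReal.summable_coe.2 (hsum Q))
      rw [abs_of_nonneg (tsum_nonneg fun i => NNReal.coe_nonneg _)]
      have hgeo' : HasSum (fun i : ℕ => (4 : ℝ) ^ Q.r * C * (1 / 2) ^ S * (1 / 2) ^ i)
          ((4 : ℝ) ^ Q.r * C * (1 / 2) ^ S * 2) := hasSum_geometric_two.mul_left _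
      have h4 := h3.tsum_le_tsum (fun i => (?_ : _ ≤ (4 : ℝ) ^ Q.r * C * (1 / 2) ^ S * (1 / 2) ^ i))
        hgeo'.summable
      · rw [hgeo'.tsum_eq] at h4
        refine h4.trans_lt ?_
        have h5 : (C : ℝ) * 2 < 2 ^ (C + 2) := by
          have : C < 2 ^ C := Nat.lt_two_pow_self
          have : (C : ℝ) < 2 ^ C := by exact_mod_cast this
          rw [pow_add]; linarith [pow_pos (two_pos : (0 : ℝ) < 2) C]
        have h6 : ((1 : ℝ) / 2) ^ S = (2 ^ t)⁻¹ * (4 ^ Q.r)⁻¹ * (2 ^ (C + 2))⁻¹ := by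
          rw [hS, one_div, inv_pow, pow_add, pow_add, pow_mul, mul_inv, mul_inv]; norm_num
        rw [h6]
        have h7 : (4 : ℝ) ^ Q.r * C * ((2 ^ t)⁻¹ * (4 ^ Q.r)⁻¹ * (2 ^ (C + 2))⁻¹) * 2 =
            (2 ^ t)⁻¹ * ((C * 2) / 2 ^ (C + 2)) := by
          field_simp
        rw [h7]
        have h8 : (C : ℝ) * 2 / 2 ^ (C + 2) < 1 := by rwa [div_lt_one (by positivity)]
        exact mul_lt_of_lt_one_right (by positivity) h8
      · have := hle Q (i + S)
        have h9 : ((gridAverage (g (i + S)) (16 ^ (i + S)) Q : ℝ≥0) : ℝ) ≤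
            4 ^ Q.r * C * (1 / 2) ^ (i + S) := by exact_mod_cast this
        rw [pow_add (1 / 2 : ℝ)] at h9
        linarith
    · change 0 < bigBound _ _ * bigBound _ _
      unfold bigBound
      positivity
  · refine ⟨hp.1, ?_⟩
    have hinf := Nat.frequently_atTop_iff_infinite.1 (hE p hp)
    refine Tendsto.limsup_eq (ENNReal.tendsto_nhds_top fun K => ?_)
    -- Beyond the levels of `K + 1` charging stages the martingale is at least `K + 1`, so its
    -- values tend to infinity.
    obtain ⟨A, hA, hcard⟩ := hinf.exists_subset_card_eq (K + 1)
    filter_upwards [eventually_ge_atTop (∑ s ∈ A, 16 ^ s)] with r hr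
    have h1 : ((K + 1 : ℕ) : ℝ≥0) ≤ ∑' s, gridAverage (g s) (16 ^ s) (containing r p hp.1) := by
      refine le_trans ?_ ((hsum _).sum_le_tsum A fun _ _ => zero_le)
      rw [← hcard, Finset.card_eq_sum_ones, Nat.cast_sum]
      refine Finset.sum_le_sum fun s hs => ?_
      have hsr : 16 ^ s ≤ r := le_trans
        (Finset.single_le_sum (f := fun s => 16 ^ s) (fun _ _ => Nat.zero_le _) hs) hr
      rw [gridAverage_containing hsr]
      exact_mod_cast hA hs
    refine lt_of_lt_of_le (?_ : (K : ℝ≥0∞) < ((K + 1 : ℕ) : ℝ≥0∞)) (by exact_mod_cast h1)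
    exact_mod_cast Nat.lt_succ_self K

/-! ### Polynomial time calculus for integers -/

namespace StackProg

/-- Integer-valued functions that are differences of two polynomial time computable ones. -/
def PolyCompInt {k : ℕ} (f : (Fin k → ℕ) → ℤ) : Prop :=
  ∃ a b : (Fin k → ℕ) → ℕ, PolyComp a ∧ PolyComp b ∧ ∀ x, f x = a x - b x

namespace PolyCompInt

variable {k : ℕ}

theorem natCast {f : (Fin k → ℕ) → ℕ} (hf : PolyComp f) : PolyCompInt fun x => (f x : ℤ) :=
  ⟨f, fun _ => 0, hf, .const 0, fun x => by simp⟩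

theorem const (n : ℤ) : PolyCompInt fun _ : Fin k → ℕ => n :=
  ⟨fun _ => n.toNat, fun _ => (-n).toNat, .const _, .const _, fun x => by dsimp only; omega⟩

theorem add {f g : (Fin k → ℕ) → ℤ} (hf : PolyCompInt f) (hg : PolyCompInt g) :
    PolyCompInt fun x => f x + g x := by
  obtain ⟨a, b, ha, hb, h⟩ := hf
  obtain ⟨c, d, hc, hd, h'⟩ := hg
  exact ⟨_, _, ha.add hc, hb.add hd, fun x => by simp only [h, h']; push_cast; ring⟩

theorem sub {f g : (Fin k → ℕ) → ℤ} (hf : PolyCompInt f) (hg : PolyCompInt g) :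
    PolyCompInt fun x => f x - g x := by
  obtain ⟨a, b, ha, hb, h⟩ := hf
  obtain ⟨c, d, hc, hd, h'⟩ := hg
  exact ⟨_, _, ha.add hd, hb.add hc, fun x => by simp only [h, h']; push_cast; ring⟩

theorem mul {f g : (Fin k → ℕ) → ℤ} (hf : PolyCompInt f) (hg : PolyCompInt g) :
    PolyCompInt fun x => f x * g x := by
  obtain ⟨a, b, ha, hb, h⟩ := hf
  obtain ⟨c, d, hc, hd, h'⟩ := hg
  exact ⟨_, _, (ha.mul hc).add (hb.mul hd), (ha.mul hd).add (hb.mul hc),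
    fun x => by simp only [h, h']; push_cast; ring⟩

theorem sum {n : (Fin k → ℕ) → ℕ} {F : ℕ → (Fin k → ℕ) → ℤ} (hn : PolyComp n)
    (hF : PolyCompInt fun z : Fin (k + 1) → ℕ => F (z 0) (Fin.tail z)) :
    PolyCompInt fun x => ∑ i ∈ Finset.range (n x), F i x := by
  obtain ⟨a, b, ha, hb, h⟩ := hF
  refine ⟨_, _, hn.sum (F := fun i x => a (Fin.cons i x)) (by simpa using ha),
    hn.sum (F := fun i x => b (Fin.cons i x)) (by simpa using hb), fun x => ?_⟩
  push_cast
  rw [← Finset.sum_sub_distrib]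
  refine Finset.sum_congr rfl fun i _ => ?_
  rw [← h]
  simp

theorem toNat {f : (Fin k → ℕ) → ℤ} (hf : PolyCompInt f) : PolyComp fun x => (f x).toNat := by
  obtain ⟨a, b, ha, hb, h⟩ := hf
  convert ha.sub hb using 2 with x
  rw [h]
  omega

theorem comp1 {F : ℕ → ℤ} (hF : PolyCompInt fun y : Fin 1 → ℕ => F (y 0))
    {g : (Fin k → ℕ) → ℕ} (hg : PolyComp g) : PolyCompInt fun x => F (g x) := by
  obtain ⟨a, b, ha, hb, h⟩ := hF
  refine ⟨fun x => a (fun _ => g x), fun x => b (fun _ => g x),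
    PolyComp.comp1 (F := fun y => a fun _ => y) ?_ hg,
    PolyComp.comp1 (F := fun y => b fun _ => y) ?_ hg, fun x => h (fun _ => g x)⟩
  · convert ha using 2 with y
    congr 1
    funext i
    rw [Subsingleton.elim i 0]
  · convert hb using 2 with y
    congr 1
    funext i
    rw [Subsingleton.elim i 0]

theorem ite_abs_le {f : (Fin k → ℕ) → ℤ} {g : (Fin k → ℕ) → ℕ} (hf : PolyCompInt f)
    (hg : PolyComp g) : PolyComp fun x => if |f x| ≤ g x then 1 else 0 := by
  obtain ⟨a, b, ha, hb, h⟩ := hf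
  have h1 := ha.ite_le (hb.add hg) (hb.ite_le (ha.add hg) (.const 1) (.const 0)) (.const 0)
  convert h1 using 2 with x
  have h2 : |f x| ≤ g x ↔ a x ≤ b x + g x ∧ b x ≤ a x + g x := by
    rw [h, abs_le]
    omega
  simp only [h2, ite_and]

end PolyCompInt

end StackProg

open StackProg

/-! ### Counting narrow strips -/

/-- Numerator of the abscissa around which the family of lines is contracted by the `l`-th
digit of the slope. The denominator is `2 ^ Nat.log 8 l`. -/
def focusNum (l : ℕ) : ℤ :=
  -- In the block `8^p ≤ l < 8^(p+1)` the foci start at `-2^p` and advance by `2^-p` after every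
  -- `2^p` digits, up to almost `6 * 2^p`; hence they cross `[-2^p, 2^p]`.
  ((l - 8 ^ Nat.log 8 l) / 2 ^ Nat.log 8 l : ℕ) - (4 ^ Nat.log 8 l : ℕ)

/-- The number of digits of the slope that matter in the column `i` at stage `s`. -/
def digitCount (I : ℤ) (s i : ℕ) : ℕ :=
  -- This is `8^s + k * 2^s` with `k = ⌊2^s x⌋ + 4^s` for `x` in the column: the index in block `s`
  -- where the focus reaches `k / 2^s - 2^s`, within `2^-s` of `x`. The minimum with `16^s` is
  -- inactive at late stages.
  min (2 ^ (3 * s) + (((i / 2 ^ (2 ^ (4 * s) - s) : ℕ) : ℤ) + (2 ^ s : ℕ) * I +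
    (2 ^ s : ℕ) * (2 ^ s : ℕ)).toNat * 2 ^ s) (2 ^ (4 * s))

/-- Scaled sum of the focus abscissae over the binary digits of `A`. -/
def focusSum (s n A : ℕ) : ℤ :=
  ∑ l ∈ Finset.range n,
    ((A / 2 ^ (n - 1 - l) % 2 * 2 ^ (n - 1 - l) * 2 ^ (s - Nat.log 8 l) : ℕ) : ℤ) * focusNum l

/-- Scaled vertical distance of the corner of the cell `(i, j)` from the line with digits `A`. -/
def defect (z I J : ℤ) (s n A i j : ℕ) : ℤ :=
  J * ((2 ^ n * 2 ^ 2 ^ (4 * s) * 2 ^ s : ℕ) : ℤ) + ((j * (2 ^ n * 2 ^ s) : ℕ) : ℤ) -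
    (z * ((2 ^ n : ℕ) : ℤ) + (A : ℤ)) * (I * ((2 ^ 2 ^ (4 * s) : ℕ) : ℤ) + (i : ℤ)) *
      ((2 ^ s : ℕ) : ℤ) + ((2 ^ 2 ^ (4 * s) : ℕ) : ℤ) * focusSum s n A

/-- The number of strips that the cell `(i, j)` of level `16 ^ s` meets. -/
def stripCount (z I J : ℤ) (C s i j : ℕ) : ℕ :=
  -- The defect is scaled by `2^(n + 16^s + s)` with `n` the digit count, so the test allows a
  -- vertical distance of `C * 2^-(n+s)`.
  ∑ A ∈ Finset.range (2 ^ digitCount I s i),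
    if |defect z I J s (digitCount I s i) A i j| ≤ ((C * 2 ^ 2 ^ (4 * s) : ℕ) : ℤ) then 1 else 0

/-- A power of two, cut off at `N`. -/
def cap (N e : ℕ) : ℕ := min (2 ^ e) N

/-- `digitCount` with cut off powers. -/
def digitCountCap (I : ℤ) (N s i : ℕ) : ℕ :=
  min (cap N (3 * s) + (((i / cap N (cap N (4 * s) - s) : ℕ) : ℤ) + (cap N s : ℕ) * I +
    (cap N s : ℕ) * (cap N s : ℕ)).toNat * cap N s) (cap N (4 * s))

/-- `focusSum` with cut off powers. -/
def focusSumCap (N s n A : ℕ) : ℤ :=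
  ∑ l ∈ Finset.range n,
    ((A / cap N (n - 1 - l) % 2 * cap N (n - 1 - l) * cap N (s - Nat.log 8 l) : ℕ) : ℤ) *
      focusNum l

/-- `defect` with cut off powers. -/
def defectCap (z I J : ℤ) (N s n A i j : ℕ) : ℤ :=
  J * ((cap N n * cap N (cap N (4 * s)) * cap N s : ℕ) : ℤ) +
    ((j * (cap N n * cap N s) : ℕ) : ℤ) -
    (z * ((cap N n : ℕ) : ℤ) + (A : ℤ)) * (I * ((cap N (cap N (4 * s)) : ℕ) : ℤ) + (i : ℤ)) *
      ((cap N s : ℕ) : ℤ) + ((cap N (cap N (4 * s)) : ℕ) : ℤ) * focusSumCap N s n A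

/-- `stripCount` with cut off powers. -/
def stripCountCap (z I J : ℤ) (C N s i j : ℕ) : ℕ :=
  ∑ A ∈ Finset.range (cap N (digitCountCap I N s i)),
    if |defectCap z I J N s (digitCountCap I N s i) A i j| ≤
      ((C * cap N (cap N (4 * s)) : ℕ) : ℤ) then 1 else 0

theorem two_pow_four_mul (s : ℕ) : 2 ^ (4 * s) = 16 ^ s := by
  rw [pow_mul]; norm_num

/-- No exponent exceeds `2 ^ (4 * s) = 16 ^ s`, so the cut-offs are inactive. They serve only to
make the count polynomial in its arguments. -/
theorem stripCountCap_eq (z I J : ℤ) (C N s i j : ℕ) (hN : 2 ^ 16 ^ s ≤ N) :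
    stripCountCap z I J C N s i j = stripCount z I J C s i j := by
  have h16 := two_pow_four_mul s
  have hcap : ∀ e, e ≤ 2 ^ (4 * s) → cap N e = 2 ^ e := fun e he =>
    min_eq_left ((Nat.pow_le_pow_right (by norm_num) (h16 ▸ he)).trans hN)
  have h4 : 4 * s ≤ 2 ^ (4 * s) := (Nat.lt_two_pow_self).le
  have c4 := hcap (4 * s) h4
  have c3 := hcap (3 * s) (by omega)
  have c1 := hcap s (by omega)
  have cm := hcap (2 ^ (4 * s)) le_rfl
  have cms := hcap (2 ^ (4 * s) - s) (Nat.sub_le _ _)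
  have hd : digitCountCap I N s i = digitCount I s i := by
    simp only [digitCountCap, digitCount, c4, c3, c1, cms]
  have hn : digitCount I s i ≤ 2 ^ (4 * s) := min_le_right _ _
  have hf : ∀ A, focusSumCap N s (digitCount I s i) A = focusSum s (digitCount I s i) A := by
    intro A
    refine Finset.sum_congr rfl fun l hl => ?_
    rw [Finset.mem_range] at hl
    rw [hcap _ (by omega), hcap _ (by omega)]
  have hdef : ∀ A, defectCap z I J N s (digitCount I s i) A i j =
      defect z I J s (digitCount I s i) A i j := by
    intro A
    simp only [defectCap, defect, hf, c4, cm, c1, hcap _ hn]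
  simp only [stripCountCap, stripCount, hd, hdef, hcap _ hn, c4, cm]

/-- The powers that occur are at most `8 ^ Nat.log 8 l ≤ l + 1`, so the argument provides its own
cut-off. -/
theorem polyCompInt_focusNum : PolyCompInt fun x : Fin 1 → ℕ => focusNum (x 0) := by
  have hlog : PolyComp fun x : Fin 1 → ℕ => Nat.log 8 (x 0) :=
    (PolyComp.var 0).log_two_pow 3 (by norm_num)
  have hle : ∀ l, 8 ^ Nat.log 8 l ≤ l + 1 := fun l => by
    rcases Nat.eq_zero_or_pos l with rfl | h
    · simp
    · exact (Nat.pow_log_le_self 8 h.ne').trans (by omega)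
  have hpow : ∀ c ≤ 3, PolyComp fun x : Fin 1 → ℕ => (2 ^ c) ^ Nat.log 8 (x 0) := by
    intro c hc
    convert ((PolyComp.var (k := 1) 0).add (.const 1)).min_two_pow ((PolyComp.const c).mul hlog)
      using 2 with x
    rw [min_eq_left, pow_mul]
    refine le_trans ?_ (hle _)
    rw [pow_mul]
    exact Nat.pow_le_pow_left (Nat.pow_le_pow_right (n := 2) (by norm_num) hc) _
  exact (PolyCompInt.natCast (((PolyComp.var 0).sub (hpow 3 le_rfl)).div
    (hpow 1 (by norm_num)))).sub (.natCast (hpow 2 (by norm_num)))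

theorem polyComp_stripCountCap (z I J : ℤ) (C : ℕ) :
    PolyComp fun x : Fin 4 → ℕ => stripCountCap z I J C (x 0) (x 1) (x 2) (x 3) := by
  have hcap : ∀ {k : ℕ} {N e : (Fin k → ℕ) → ℕ}, PolyComp N → PolyComp e →
      PolyComp fun x => cap (N x) (e x) := fun hN he => hN.min_two_pow he
  have hcap4 : ∀ {k : ℕ} {N s : (Fin k → ℕ) → ℕ}, PolyComp N → PolyComp s →
      PolyComp fun x => cap (N x) (4 * s x) := fun hN hs => hcap hN ((PolyComp.const 4).mul hs)
  have hdig : PolyComp fun x : Fin 3 → ℕ => digitCountCap I (x 0) (x 1) (x 2) := by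
    have hs : PolyComp fun x : Fin 3 → ℕ => cap (x 0) (x 1) := hcap (.var 0) (.var 1)
    refine PolyComp.min ((hcap (.var 0) ((PolyComp.const 3).mul (.var 1))).add
      (PolyComp.mul (PolyCompInt.toNat ?_) hs)) (hcap4 (.var 0) (.var 1))
    exact ((PolyCompInt.natCast ((PolyComp.var 2).div
      (hcap (.var 0) ((hcap4 (.var 0) (.var 1)).sub (.var 1))))).add
      ((PolyCompInt.natCast hs).mul (.const I))).add
      ((PolyCompInt.natCast hs).mul (PolyCompInt.natCast hs))
  have hlog : ∀ {k : ℕ} {l : (Fin k → ℕ) → ℕ}, PolyComp l →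
      PolyComp fun x => Nat.log 8 (l x) := fun hl => hl.log_two_pow 3 (by norm_num)
  have hfoc : ∀ {k : ℕ} {N s n A : (Fin k → ℕ) → ℕ}, PolyComp N → PolyComp s → PolyComp n →
      PolyComp A → PolyCompInt fun x => focusSumCap (N x) (s x) (n x) (A x) := by
    intro k N s n A hN hs hn hA
    refine PolyCompInt.sum (F := fun l x => _) hn ?_
    have he : PolyComp fun x : Fin (k + 1) → ℕ => cap (N (Fin.tail x)) (n (Fin.tail x) - 1 - x 0) :=
      hcap hN.tail ((hn.tail.sub (.const 1)).sub (.var 0))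
    exact (PolyCompInt.natCast ((((hA.tail.div he).mod (.const 2)).mul he).mul
      (hcap hN.tail (hs.tail.sub (hlog (.var 0)))))).mul
      (polyCompInt_focusNum.comp1 (.var 0))
  have hdig4 : PolyComp fun x : Fin 4 → ℕ => digitCountCap I (x 0) (x 1) (x 2) :=
    hdig.comp3 (.var 0) (.var 1) (.var 2)
  have hdig5 : PolyComp fun x : Fin 5 → ℕ => digitCountCap I (x 1) (x 2) (x 3) :=
    hdig.comp3 (.var 1) (.var 2) (.var 3)
  refine PolyComp.sum (F := fun A x => _) (hcap (.var 0) hdig4) ?_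
  have hm : PolyComp fun x : Fin 5 → ℕ => cap (x 1) (cap (x 1) (4 * x 2)) :=
    hcap (.var 1) (hcap4 (.var 1) (.var 2))
  have hn : PolyComp fun x : Fin 5 → ℕ => cap (x 1) (digitCountCap I (x 1) (x 2) (x 3)) :=
    hcap (.var 1) hdig5
  have hs : PolyComp fun x : Fin 5 → ℕ => cap (x 1) (x 2) := hcap (.var 1) (.var 2)
  refine PolyCompInt.ite_abs_le ?_ ((PolyComp.const C).mul hm)
  exact ((((PolyCompInt.const J).mul (.natCast ((hn.mul hm).mul hs))).add
    (.natCast ((PolyComp.var 4).mul (hn.mul hs)))).sub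
    (((((PolyCompInt.const z).mul (.natCast hn)).add (.natCast (.var 0))).mul
      (((PolyCompInt.const I).mul (.natCast hm)).add (.natCast (.var 3)))).mul (.natCast hs))).add
    ((PolyCompInt.natCast hm).mul (hfoc (.var 1) (.var 2) hdig5 (.var 0)))

/-- An interval of length `2 * K * D` is met by a progression of step `D`; applied to the cells of
one column near a strip. -/
theorem card_filter_abs_le (X D : ℤ) (K n : ℕ) (hD : 0 < D) :
    ((Finset.range n).filter fun j : ℕ => |X + j * D| ≤ K * D).card ≤ 2 * K + 1 := by
  set S := (Finset.range n).filter fun j : ℕ => |X + j * D| ≤ K * D with hS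
  rcases S.eq_empty_or_nonempty with h | h
  · simp [h]
  · have hsub : S ⊆ Finset.Icc (S.min' h) (S.min' h + 2 * K) := by
      intro j hj
      have h0 := (Finset.mem_filter.1 (S.min'_mem h)).2
      have h1 := (Finset.mem_filter.1 hj).2
      have h2 := S.min'_le j hj
      rw [abs_le] at h0 h1
      rw [Finset.mem_Icc]
      refine ⟨h2, ?_⟩
      have h3 : ((j : ℤ) - (S.min' h : ℕ)) * D ≤ (2 * K) * D := by linarith [h0.1, h1.2]
      have h4 := le_of_mul_le_mul_right h3 hD
      omega
    refine (Finset.card_le_card hsub).trans ?_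
    simp
    omega

/-- At late stages, few digits matter compared with the level of the grid. -/
theorem digitCount_bound {I : ℤ} {s i : ℕ} (hs : 2 ≤ s) (hI : |I| + 1 ≤ 2 ^ s)
    (hi : i < 2 ^ 16 ^ s) :
    2 ^ (3 * s) + (((i / 2 ^ (2 ^ (4 * s) - s) : ℕ) : ℤ) + (2 ^ s : ℕ) * I +
      (2 ^ s : ℕ) * (2 ^ s : ℕ)).toNat * 2 ^ s ≤ 3 * 8 ^ s ∧ 3 * 8 ^ s + s ≤ 16 ^ s := by
  have h16 := two_pow_four_mul s
  constructor
  · have hq : i / 2 ^ (2 ^ (4 * s) - s) < 2 ^ s := by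
      rw [Nat.div_lt_iff_lt_mul (by positivity), ← pow_add]
      refine hi.trans_le (Nat.pow_le_pow_right (by norm_num) ?_)
      omega
    have hk : (((i / 2 ^ (2 ^ (4 * s) - s) : ℕ) : ℤ) + (2 ^ s : ℕ) * I +
      (2 ^ s : ℕ) * (2 ^ s : ℕ)).toNat ≤ 2 * (2 ^ s * 2 ^ s) := by
      rw [Int.toNat_le]
      push_cast
      have h1 : ((i / 2 ^ (2 ^ (4 * s) - s) : ℕ) : ℤ) < 2 ^ s := by exact_mod_cast hq
      push_cast at h1
      have h2 := le_abs_self I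
      have h3 : (0 : ℤ) < 2 ^ s := by positivity
      nlinarith
    calc _ ≤ 2 ^ (3 * s) + 2 * (2 ^ s * 2 ^ s) * 2 ^ s :=
          Nat.add_le_add_left (Nat.mul_le_mul_right _ hk) _
      _ = 3 * 8 ^ s := by
        have : (8 : ℕ) ^ s = 2 ^ s * 2 ^ s * 2 ^ s := by rw [← mul_pow, ← mul_pow]; norm_num
        rw [pow_mul, this]
        norm_num
        rw [this]; ring
  · have h1 : s < 8 ^ s := Nat.lt_pow_self (by norm_num)
    have h2 : (16 : ℕ) ^ s = 8 ^ s * 2 ^ s := by rw [← mul_pow]; norm_num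
    have h3 : 2 ^ 2 ≤ 2 ^ s := Nat.pow_le_pow_right (by norm_num) hs
    rw [h2]
    nlinarith

/-- A column meets `2^n` strips of height about `2^-(n+s)`. With `e = 16^s - n - s ≥ 0`, each strip
charges at most `2 * C * 2^e + 1 ≤ (2 * C + 1) * 2^e` cells of the column, which leaves a share of
`(2 * C + 1) * 2^-s`. -/
theorem sum_stripCount_le (z I J : ℤ) (C s : ℕ) (hs : 2 ≤ s) (hI : |I| + 1 ≤ 2 ^ s) :
    2 ^ s * ∑ i ∈ Finset.range (2 ^ 16 ^ s), ∑ j ∈ Finset.range (2 ^ 16 ^ s),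
      stripCount z I J C s i j ≤ (2 * C + 1) * 4 ^ 16 ^ s := by
  have h16 := two_pow_four_mul s
  have key : ∀ i ∈ Finset.range (2 ^ 16 ^ s), 2 ^ s * ∑ j ∈ Finset.range (2 ^ 16 ^ s),
      stripCount z I J C s i j ≤ (2 * C + 1) * 2 ^ 16 ^ s := by
    intro i hi
    rw [Finset.mem_range] at hi
    obtain ⟨b1, b2⟩ := digitCount_bound hs hI hi
    set n := digitCount I s i with hn
    have hns : n + s ≤ 16 ^ s := by
      have : n ≤ 3 * 8 ^ s := (min_le_left _ _).trans b1
      omega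
    obtain ⟨e, he⟩ : ∃ e, 16 ^ s = n + s + e := ⟨16 ^ s - (n + s), by omega⟩
    have hA : ∀ A, ∑ j ∈ Finset.range (2 ^ 16 ^ s), (if |defect z I J s n A i j| ≤
        ((C * 2 ^ 2 ^ (4 * s) : ℕ) : ℤ) then 1 else 0) ≤ 2 * (C * 2 ^ e) + 1 := by
      intro A
      rw [← Finset.card_filter]
      have := card_filter_abs_le (defect z I J s n A i 0) (2 ^ n * 2 ^ s) (C * 2 ^ e)
        (2 ^ 16 ^ s) (by positivity)
      convert this using 3
      rename_i j hj
      have e1 : defect z I J s n A i j = defect z I J s n A i 0 + (j : ℤ) * (2 ^ n * 2 ^ s) := by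
        simp only [defect]; push_cast; ring
      rw [e1, h16, he, pow_add, pow_add]
      push_cast
      rw [show ((C : ℤ) * (2 ^ n * 2 ^ s * 2 ^ e)) = C * 2 ^ e * (2 ^ n * 2 ^ s) by ring]
    have hsum : ∑ j ∈ Finset.range (2 ^ 16 ^ s), stripCount z I J C s i j ≤
        2 ^ n * (2 * (C * 2 ^ e) + 1) := by
      simp only [stripCount]
      rw [Finset.sum_comm]
      refine (Finset.sum_le_sum fun A _ => hA A).trans ?_
      simp [hn]
    refine (Nat.mul_le_mul_left _ hsum).trans ?_
    rw [he, pow_add, pow_add]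
    have := Nat.one_le_two_pow (n := e)
    have h3 : 2 ^ s * 2 ^ n ≤ 2 ^ s * 2 ^ n * 2 ^ e := Nat.le_mul_of_pos_right _ (by omega)
    calc 2 ^ s * (2 ^ n * (2 * (C * 2 ^ e) + 1)) =
          2 * C * (2 ^ s * 2 ^ n * 2 ^ e) + 2 ^ s * 2 ^ n := by ring
      _ ≤ 2 * C * (2 ^ s * 2 ^ n * 2 ^ e) + 2 ^ s * 2 ^ n * 2 ^ e := by omega
      _ = _ := by ring
  rw [Finset.mul_sum]
  refine (Finset.sum_le_sum key).trans ?_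
  rw [Finset.sum_const, Finset.card_range, smul_eq_mul]
  have : (4 : ℕ) ^ 16 ^ s = 2 ^ 16 ^ s * 2 ^ 16 ^ s := by rw [← mul_pow]; norm_num
  rw [this]
  apply le_of_eq
  ring

/-! ### A family of lines with small vertical sections -/

/-- The `l`-th binary digit of `a`, counted from `0` after the binary point. -/
noncomputable def binDigit (a : ℝ) (l : ℕ) : ℕ := ⌊(2 : ℝ) ^ (l + 1) * a⌋₊ % 2

/-- The abscissa around which the family of lines is contracted by the `l`-th digit. -/
noncomputable def focus (l : ℕ) : ℝ := focusNum l / 2 ^ Nat.log 8 l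

/-- The intercept of the line of the family with slope `a`, up to sign. -/
noncomputable def interceptTerm (a : ℝ) (l : ℕ) : ℝ := binDigit a l * (1 / 2) ^ (l + 1) * focus l

theorem binDigit_le_one (a : ℝ) (l : ℕ) : (binDigit a l : ℝ) ≤ 1 := by
  have : binDigit a l ≤ 1 := by unfold binDigit; omega
  exact_mod_cast this

theorem two_pow_log_le (l : ℕ) : 2 ^ Nat.log 8 l ≤ l + 1 := by
  rcases Nat.eq_zero_or_pos l with rfl | h
  · simp
  · exact (Nat.pow_le_pow_left (by norm_num) _).trans
      ((Nat.pow_log_le_self 8 h.ne').trans (by omega))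

theorem abs_focus_le (l : ℕ) : |focus l| ≤ 7 * (l + 1) := by
  set p := Nat.log 8 l with hp
  have h1 : l < 8 ^ (p + 1) := Nat.lt_pow_succ_log_self (by norm_num) l
  have h8 : (8 : ℕ) ^ p = 4 ^ p * 2 ^ p := by rw [← mul_pow]; norm_num
  have h2 : (l - 8 ^ p) / 2 ^ p ≤ 7 * 4 ^ p := by
    apply Nat.div_le_of_le_mul
    rw [pow_succ] at h1
    have : 2 ^ p * (7 * 4 ^ p) = 7 * 8 ^ p := by rw [h8]; ring
    omega
  have h3 : |focusNum l| ≤ 7 * 4 ^ p := by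
    have h4 : (((l - 8 ^ p) / 2 ^ p : ℕ) : ℤ) ≤ ((7 * 4 ^ p : ℕ) : ℤ) := by exact_mod_cast h2
    have h5 : (0 : ℤ) ≤ (((l - 8 ^ p) / 2 ^ p : ℕ) : ℤ) := by positivity
    have h6 : (0 : ℤ) < 4 ^ p := by positivity
    unfold focusNum
    rw [← hp, abs_le]
    push_cast at *
    constructor <;> linarith
  have h3' : |(focusNum l : ℝ)| ≤ 7 * 4 ^ p := by exact_mod_cast h3
  have h7 : ((2 : ℝ) ^ p) ≤ l + 1 := by exact_mod_cast two_pow_log_le l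
  have h9 : (4 : ℝ) ^ p = 2 ^ p * 2 ^ p := by rw [← mul_pow]; norm_num
  unfold focus
  rw [← hp, abs_div, abs_of_pos (show (0 : ℝ) < 2 ^ p by positivity), div_le_iff₀ (by positivity)]
  rw [h9] at h3'
  have : (0 : ℝ) < 2 ^ p := by positivity
  nlinarith

theorem summable_interceptTerm (a : ℝ) : Summable (interceptTerm a) := by
  have h1 : Summable fun l : ℕ => ((l : ℝ) ^ 1 * (1 / 2 : ℝ) ^ l) :=
    summable_pow_mul_geometric_of_norm_lt_one 1 (by norm_num)
  have h2 := ((h1.comp_injective (add_left_injective 1)).mul_left 7)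
  refine Summable.of_norm_bounded h2 fun l => ?_
  simp only [interceptTerm, Function.comp, Real.norm_eq_abs, abs_mul, pow_one, Nat.abs_cast]
  rw [abs_of_pos (show (0 : ℝ) < (1 / 2) ^ (l + 1) by positivity)]
  have h3 := binDigit_le_one a l
  have h4 := abs_focus_le l
  have h5 : (0 : ℝ) < (1 / 2) ^ (l + 1) := by positivity
  push_cast
  calc (binDigit a l : ℝ) * (1 / 2) ^ (l + 1) * |focus l|
      ≤ 1 * (1 / 2) ^ (l + 1) * (7 * (l + 1)) := by gcongr
    _ = _ := by ring

theorem floor_two_pow_succ (a : ℝ) (n : ℕ) :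
    ⌊(2 : ℝ) ^ (n + 1) * a⌋₊ = 2 * ⌊(2 : ℝ) ^ n * a⌋₊ + binDigit a n := by
  have := Nat.floor_div_natCast ((2 : ℝ) ^ (n + 1) * a) 2
  have h2 : (2 : ℝ) ^ (n + 1) * a / (2 : ℕ) = 2 ^ n * a := by
    rw [pow_succ]; push_cast; field_simp
  rw [h2] at this
  unfold binDigit
  omega

theorem floor_two_pow_div (a : ℝ) {n l : ℕ} (h : l < n) :
    ⌊(2 : ℝ) ^ n * a⌋₊ / 2 ^ (n - 1 - l) % 2 = binDigit a l := by
  have := Nat.floor_div_natCast ((2 : ℝ) ^ n * a) (2 ^ (n - 1 - l))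
  rw [← this, binDigit]
  congr 2
  have h2 : (2 : ℝ) ^ n = 2 ^ (l + 1) * 2 ^ (n - 1 - l) := by rw [← pow_add]; congr 1; omega
  rw [h2]
  push_cast
  field_simp

theorem sum_binDigit {a : ℝ} (ha : a ∈ Ico (0 : ℝ) 1) (n : ℕ) :
    ∑ l ∈ Finset.range n, (binDigit a l : ℝ) * (1 / 2) ^ (l + 1) = ⌊(2 : ℝ) ^ n * a⌋₊ / 2 ^ n := by
  induction n with
  | zero => simp [Nat.floor_eq_zero.2 ha.2]
  | succ n ih =>
    rw [Finset.sum_range_succ, ih, floor_two_pow_succ, pow_succ, one_div, inv_pow]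
    push_cast
    field_simp
    ring

theorem hasSum_binDigit {a : ℝ} (ha : a ∈ Ico (0 : ℝ) 1) :
    HasSum (fun l => (binDigit a l : ℝ) * (1 / 2) ^ (l + 1)) a := by
  rw [hasSum_iff_tendsto_nat_of_nonneg (fun l => by positivity)]
  simp only [sum_binDigit ha]
  have h1 : Tendsto (fun n : ℕ => a - (1 / 2 : ℝ) ^ n) atTop (nhds (a - 0)) :=
    tendsto_const_nhds.sub (tendsto_pow_atTop_nhds_zero_of_lt_one (by norm_num) (by norm_num))
  rw [sub_zero] at h1
  refine tendsto_of_tendsto_of_tendsto_of_le_of_le h1 tendsto_const_nhds (fun n => ?_) (fun n => ?_)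
  · have := Nat.lt_floor_add_one ((2 : ℝ) ^ n * a)
    have h2 : (0 : ℝ) < 2 ^ n := by positivity
    rw [one_div, inv_pow, le_div_iff₀ h2, sub_mul, inv_mul_cancel₀ h2.ne']
    linarith
  · have := Nat.floor_le (mul_nonneg (pow_nonneg two_pos.le n) ha.1)
    rw [div_le_iff₀ (by positivity)]
    linarith

/-- The line of the family is close to the line given by finitely many digits of its slope. -/
theorem abs_line_sub_le {a : ℝ} (ha : a ∈ Ico (0 : ℝ) 1) (x : ℝ) (n : ℕ) {B : ℝ}
    (hB : ∀ i : ℕ, (1 / 2 : ℝ) ^ (n + i + 1) * |x - focus (n + i)| ≤ B * (3 / 4) ^ i) :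
    |(a * x - ∑' l, interceptTerm a l) - (⌊(2 : ℝ) ^ n * a⌋₊ / 2 ^ n * x -
      ∑ l ∈ Finset.range n, interceptTerm a l)| ≤ B * 4 := by
  -- Digit `l` turns the line about its point over `focus l`, so its effect at `x` is proportional
  -- to `x - focus l`.
  have hs : HasSum (fun l => (binDigit a l : ℝ) * (1 / 2) ^ (l + 1) * (x - focus l))
      (a * x - ∑' l, interceptTerm a l) := by
    have := ((hasSum_binDigit ha).mul_right x).sub (summable_interceptTerm a).hasSum
    have hfun : (fun l => (binDigit a l : ℝ) * (1 / 2) ^ (l + 1) * (x - focus l)) =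
        fun l => (binDigit a l : ℝ) * (1 / 2) ^ (l + 1) * x - interceptTerm a l := by
      funext l
      unfold interceptTerm
      ring
    rw [hfun]
    exact this
  have h1 := hs.summable.sum_add_tsum_nat_add n
  rw [hs.tsum_eq] at h1
  have h2 : ∑ l ∈ Finset.range n, (binDigit a l : ℝ) * (1 / 2) ^ (l + 1) * (x - focus l) =
      ⌊(2 : ℝ) ^ n * a⌋₊ / 2 ^ n * x - ∑ l ∈ Finset.range n, interceptTerm a l := by
    rw [← sum_binDigit ha, Finset.sum_mul, ← Finset.sum_sub_distrib]
    refine Finset.sum_congr rfl fun l _ => ?_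
    unfold interceptTerm
    ring
  rw [← h1, h2, add_sub_cancel_left]
  have hgeo : HasSum (fun i : ℕ => B * (3 / 4 : ℝ) ^ i) (B * 4) := by
    have := (hasSum_geometric_of_lt_one (r := (3 / 4 : ℝ)) (by norm_num) (by norm_num)).mul_left B
    norm_num at this
    exact this
  rw [← Real.norm_eq_abs]
  refine tsum_of_norm_bounded hgeo fun i => ?_
  rw [Real.norm_eq_abs, abs_mul, abs_mul, Nat.abs_cast, abs_of_pos (by positivity)]
  refine le_trans ?_ (hB i)
  have h3 := binDigit_le_one a (i + n)
  rw [add_comm i n] at h3 ⊢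
  have h4 : (0 : ℝ) ≤ (1 / 2) ^ (n + i + 1) * |x - focus (n + i)| := by positivity
  nlinarith

/-- Used in `focus_bound` for the digits far behind position `n`: there `|x - focus (n + i)| ≤ 36 *
i^3` and `2^s ≤ i`, which leads to `18 * i^4`. -/
theorem exists_geometric_bound :
    ∃ i₀ : ℕ, ∀ i ≥ i₀, 18 * (i : ℝ) ^ 4 ≤ (3 / 2 : ℝ) ^ i := by
  have h := tendsto_pow_const_div_const_pow_of_one_lt 4 (show (1 : ℝ) < 3 / 2 by norm_num)
  have h2 := h.eventually (gt_mem_nhds (show (0 : ℝ) < 1 / 18 by norm_num))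
  obtain ⟨i₀, hi⟩ := eventually_atTop.1 h2
  refine ⟨i₀, fun i hii => ?_⟩
  have := hi i hii
  rw [div_lt_iff₀ (by positivity)] at this
  linarith

/-- The remaining digits have a small effect near their common focus. -/
theorem focus_bound {i₀ : ℕ} (hi₀ : ∀ i ≥ i₀, 18 * (i : ℝ) ^ 4 ≤ (3 / 2 : ℝ) ^ i) {s k : ℕ}
    (hs : i₀ ≤ 2 ^ s) {x : ℝ} (hx : |x| ≤ 2 ^ s) (hk : k + 1 ≤ 3 * 4 ^ s)
    (hn : 8 ^ s + k * 2 ^ s ≤ 3 * 8 ^ s)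
    (hxk : |x - ((k : ℝ) / 2 ^ s - 2 ^ s)| ≤ (1 / 2) ^ s) (i : ℕ) :
    (1 / 2 : ℝ) ^ (8 ^ s + k * 2 ^ s + i + 1) * |x - focus (8 ^ s + k * 2 ^ s + i)| ≤
      (1 / 2) ^ (8 ^ s + k * 2 ^ s + s) * (3 / 4) ^ i := by
  set n := 8 ^ s + k * 2 ^ s with hndef
  have hpos : (0 : ℝ) < (1 / 2) ^ n := by positivity
  have h34 : (3 / 4 : ℝ) ^ i = (1 / 2) ^ i * (3 / 2) ^ i := by rw [← mul_pow]; norm_num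
  -- The ratio `3 / 4` in place of `1 / 2` leaves the factor `(3 / 2)^i` to absorb the growth of the
  -- foci.
  suffices h : 1 / 2 * |x - focus (n + i)| ≤ (1 / 2) ^ s * (3 / 2) ^ i by
    have hp2 : (0 : ℝ) < (1 / 2) ^ n * (1 / 2) ^ i := by positivity
    calc (1 / 2 : ℝ) ^ (n + i + 1) * |x - focus (n + i)|
        = (1 / 2) ^ n * (1 / 2) ^ i * (1 / 2 * |x - focus (n + i)|) := by
          rw [pow_add, pow_add]; ring
      _ ≤ (1 / 2) ^ n * (1 / 2) ^ i * ((1 / 2) ^ s * (3 / 2) ^ i) := by gcongr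
      _ = _ := by rw [h34, pow_add]; ring
  have h32 : (1 : ℝ) ≤ (3 / 2) ^ i := one_le_pow₀ (by norm_num)
  -- The digits `n, …, n + 2^s - 1` share the focus `k / 2^s - 2^s`, which is close to `x`. All
  -- later ones have `i ≥ 2^s`, so `(3 / 2)^i` beats both the foci and the demanded gain `2^s`.
  rcases Nat.lt_or_ge i (2 ^ s) with hi | hi
  · have h8 : (8 : ℕ) ^ s = 4 ^ s * 2 ^ s := by rw [← mul_pow]; norm_num
    have hlog : Nat.log 8 (n + i) = s := by
      refine Nat.log_eq_of_pow_le_of_lt_pow (by omega) ?_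
      have h1 : (k + 1) * 2 ^ s ≤ 3 * 8 ^ s := by
        rw [h8, ← mul_assoc]
        exact Nat.mul_le_mul_right _ hk
      rw [pow_succ]
      rw [add_mul] at h1
      have : 0 < 8 ^ s := by positivity
      omega
    have hf : focus (n + i) = (k : ℝ) / 2 ^ s - 2 ^ s := by
      have h1 : (n + i - 8 ^ s) / 2 ^ s = k := by
        have : n + i - 8 ^ s = i + k * 2 ^ s := by omega
        rw [this, Nat.add_mul_div_right _ _ (by positivity), Nat.div_eq_of_lt hi, zero_add]
      have h4 : (4 : ℝ) ^ s = 2 ^ s * 2 ^ s := by rw [← mul_pow]; norm_num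
      unfold focus focusNum
      rw [hlog, h1]
      push_cast
      rw [h4]
      field_simp
    rw [hf]
    have h2 : (0 : ℝ) < (1 / 2) ^ s := by positivity
    nlinarith [abs_nonneg (x - ((k : ℝ) / 2 ^ s - 2 ^ s))]
  · have hi1 : (1 : ℝ) ≤ i := by
      have : 1 ≤ i := le_trans Nat.one_le_two_pow hi
      exact_mod_cast this
    have h2i : (2 : ℝ) ^ s ≤ i := by exact_mod_cast hi
    have h1 := hi₀ i (hs.trans hi)
    have h2 := abs_focus_le (n + i)
    have h8 : (8 : ℝ) ^ s = 2 ^ s * 2 ^ s * 2 ^ s := by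
      rw [← mul_pow, ← mul_pow]; norm_num
    have hn' : (n : ℝ) ≤ 3 * (i : ℝ) ^ 3 := by
      have h3 : (n : ℝ) ≤ 3 * 8 ^ s := by exact_mod_cast hn
      have h4 : (2 : ℝ) ^ s * 2 ^ s * 2 ^ s ≤ i * i * i := by gcongr
      rw [h8] at h3
      nlinarith
    have h3 : |x - focus (n + i)| ≤ 36 * (i : ℝ) ^ 3 := by
      have h5 := abs_sub x (focus (n + i))
      push_cast at h2
      have h6 : (i : ℝ) ≤ i ^ 3 := le_self_pow₀ hi1 (by norm_num)
      have h7 : (1 : ℝ) ≤ i ^ 3 := one_le_pow₀ hi1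
      linarith
    have h9 : (1 / 2 : ℝ) ^ s * 2 ^ s = 1 := by rw [← mul_pow]; norm_num
    have hps : (0 : ℝ) < (1 / 2) ^ s := by positivity
    calc 1 / 2 * |x - focus (n + i)| ≤ 1 / 2 * (36 * (i : ℝ) ^ 3) := by gcongr
      _ = (1 / 2 : ℝ) ^ s * (18 * (i : ℝ) ^ 3 * 2 ^ s) := by
        linear_combination (-18 * (i : ℝ) ^ 3) * h9
      _ ≤ (1 / 2 : ℝ) ^ s * (18 * (i : ℝ) ^ 3 * i) := by gcongr
      _ = (1 / 2 : ℝ) ^ s * (18 * (i : ℝ) ^ 4) := by ring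
      _ ≤ _ := by gcongr

/-! ### Points of the lines lie in charged cells -/

theorem sub_floor_div_bounds {ξ : ℝ} (hξ : 0 ≤ ξ) (m : ℕ) :
    0 ≤ ξ - ⌊(2 : ℝ) ^ m * ξ⌋₊ / 2 ^ m ∧ ξ - ⌊(2 : ℝ) ^ m * ξ⌋₊ / 2 ^ m ≤ (1 / 2) ^ m := by
  have h2 : (0 : ℝ) < 2 ^ m := by positivity
  constructor
  · rw [sub_nonneg, div_le_iff₀ h2, mul_comm ξ]
    exact Nat.floor_le (by positivity)
  · have := Nat.lt_floor_add_one ((2 : ℝ) ^ m * ξ)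
    rw [one_div, inv_pow, sub_le_iff_le_add, inv_eq_one_div, ← add_div, le_div_iff₀ h2]
    linarith

/-- The factor `2^n * 2^s` clears the denominators `2^(l+1)` of the digits and `2^(log_8 l)` of the
foci; the latter needs `l` in a block up to `s`. -/
theorem focusSum_cast (a : ℝ) {s n : ℕ} (hn : ∀ l < n, Nat.log 8 l ≤ s) :
    (focusSum s n ⌊(2 : ℝ) ^ n * a⌋₊ : ℝ) =
      2 ^ n * 2 ^ s * ∑ l ∈ Finset.range n, interceptTerm a l := by
  unfold focusSum
  push_cast
  rw [Finset.mul_sum]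
  refine Finset.sum_congr rfl fun l hl => ?_
  rw [Finset.mem_range] at hl
  have h1 := floor_two_pow_div a hl
  have h2 : (2 : ℝ) ^ n = 2 ^ (n - 1 - l) * 2 ^ (l + 1) := by rw [← pow_add]; congr 1; omega
  have h3 : (2 : ℝ) ^ s = 2 ^ (s - Nat.log 8 l) * 2 ^ Nat.log 8 l := by
    rw [← pow_add]; congr 1; have := hn l hl; omega
  have h4 : ((⌊(2 : ℝ) ^ n * a⌋₊ / 2 ^ (n - 1 - l) % 2 : ℕ) : ℝ) = binDigit a l := by rw [h1]
  have h5 : (((⌊(2 : ℝ) ^ n * a⌋₊ / 2 ^ (n - 1 - l) % 2 : ℕ) : ℤ) : ℝ) = binDigit a l := by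
    rw [Int.cast_natCast, h4]
  push_cast at h5
  rw [h5, interceptTerm, focus, h2, h3, one_div, inv_pow]
  field_simp

/-- Points of the lines of the family lie in charged cells at all late stages. -/
theorem one_le_stripCount {i₀ : ℕ} (hi₀ : ∀ i ≥ i₀, 18 * (i : ℝ) ^ 4 ≤ (3 / 2 : ℝ) ^ i)
    {z I J : ℤ} {s : ℕ} (hs : 2 ≤ s) (hI : |I| + 1 ≤ 2 ^ s) (hs₀ : i₀ ≤ 2 ^ s) {a ξ η : ℝ}
    (ha : a ∈ Ico (0 : ℝ) 1) (hξ : ξ ∈ Ico (0 : ℝ) 1) (hη : η ∈ Ico (0 : ℝ) 1)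
    (hy : J + η = (z + a) * (I + ξ) - ∑' l, interceptTerm a l) :
    1 ≤ stripCount z I J (z.natAbs + 6) s ⌊(2 : ℝ) ^ 16 ^ s * ξ⌋₊ ⌊(2 : ℝ) ^ 16 ^ s * η⌋₊ := by
  set m := 16 ^ s with hm
  set i := ⌊(2 : ℝ) ^ m * ξ⌋₊ with hi
  set j := ⌊(2 : ℝ) ^ m * η⌋₊ with hj
  have h16 := two_pow_four_mul s
  have hilt : i < 2 ^ m := DyadicSquare.floor_lt_two_pow m hξ
  obtain ⟨b1, b2⟩ := digitCount_bound hs hI hilt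
  have hq : i / 2 ^ (2 ^ (4 * s) - s) = ⌊(2 : ℝ) ^ s * ξ⌋₊ := by
    rw [h16, ← hm, hi, ← Nat.floor_div_natCast]
    congr 1
    have : (2 : ℝ) ^ m = 2 ^ s * 2 ^ (m - s) := by rw [← pow_add]; congr 1; omega
    rw [this]
    push_cast
    field_simp
  rw [hq] at b1
  set q := ⌊(2 : ℝ) ^ s * ξ⌋₊ with hqdef
  set k := ((q : ℤ) + (2 ^ s : ℕ) * I + (2 ^ s : ℕ) * (2 ^ s : ℕ)).toNat with hk
  have h28 : 2 ^ (3 * s) = 8 ^ s := by rw [pow_mul]; norm_num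
  rw [h28] at b1
  have hnk : digitCount I s i = 8 ^ s + k * 2 ^ s := by
    unfold digitCount
    rw [hq, ← hk, h28, h16]
    exact min_eq_left (by omega)
  have hkz : (k : ℤ) = q + 2 ^ s * I + 2 ^ s * 2 ^ s := by
    rw [hk, Int.toNat_of_nonneg]
    · push_cast; ring
    · push_cast
      have h1 := neg_abs_le I
      have h3 : (0 : ℤ) < 2 ^ s := by positivity
      have h4 : (0 : ℤ) ≤ q := by positivity
      nlinarith
  have hkr : (k : ℝ) = q + 2 ^ s * I + 2 ^ s * 2 ^ s := by exact_mod_cast hkz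
  have hqlt : q < 2 ^ s := DyadicSquare.floor_lt_two_pow s hξ
  have hIr : |(I : ℝ)| + 1 ≤ 2 ^ s := by exact_mod_cast hI
  have hkle : k + 1 ≤ 3 * 4 ^ s := by
    have h1 := le_abs_self I
    have h3 : (0 : ℤ) < 2 ^ s := by positivity
    have h4 : (q : ℤ) < 2 ^ s := by exact_mod_cast hqlt
    have h5 : (4 : ℤ) ^ s = 2 ^ s * 2 ^ s := by rw [← mul_pow]; norm_num
    have : (k : ℤ) + 1 ≤ 3 * 4 ^ s := by
      rw [hkz, h5]
      nlinarith
    exact_mod_cast this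
  set X : ℝ := I + ξ with hX
  have hXle : |X| ≤ 2 ^ s := by
    have := abs_add_le (I : ℝ) ξ
    rw [abs_of_nonneg hξ.1] at this
    linarith [hξ.2]
  obtain ⟨f1, f2⟩ := sub_floor_div_bounds hξ.1 s
  have hXk : |X - ((k : ℝ) / 2 ^ s - 2 ^ s)| ≤ (1 / 2) ^ s := by
    have : X - ((k : ℝ) / 2 ^ s - 2 ^ s) = ξ - q / 2 ^ s := by
      rw [hkr, hX]; field_simp; ring
    rw [this, abs_of_nonneg f1]
    exact f2
  set n := 8 ^ s + k * 2 ^ s with hn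
  have hB := abs_line_sub_le ha X n (fun i => focus_bound hi₀ hs₀ hXle hkle b1 hXk i)
  set A := ⌊(2 : ℝ) ^ n * a⌋₊ with hA
  have hAlt : A < 2 ^ n := DyadicSquare.floor_lt_two_pow n ha
  set τ := ∑ l ∈ Finset.range n, interceptTerm a l with hτ
  have hfoc : (focusSum s n A : ℝ) = 2 ^ n * 2 ^ s * τ := by
    refine focusSum_cast a fun l hl => ?_
    refine Nat.lt_succ_iff.1 (Nat.log_lt_of_lt_pow' (by omega) ?_)
    rw [pow_succ]
    have : 0 < 8 ^ s := by positivity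
    omega
  obtain ⟨g1, g2⟩ := sub_floor_div_bounds hξ.1 m
  obtain ⟨g3, g4⟩ := sub_floor_div_bounds hη.1 m
  rw [← hi] at g1 g2
  rw [← hj] at g3 g4
  have hA1 : (0 : ℝ) ≤ (A : ℝ) / 2 ^ n ∧ (A : ℝ) / 2 ^ n ≤ 1 := by
    refine ⟨by positivity, ?_⟩
    rw [div_le_one (by positivity)]
    exact_mod_cast hAlt.le
  have hzA : |(z : ℝ) + A / 2 ^ n| ≤ |(z : ℝ)| + 1 := by
    have := abs_add_le (z : ℝ) (A / 2 ^ n)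
    rw [abs_of_nonneg hA1.1] at this
    linarith
  have hpm : (1 / 2 : ℝ) ^ m ≤ (1 / 2) ^ (n + s) :=
    pow_le_pow_of_le_one (by norm_num) (by norm_num) (by omega)
  set e := (J : ℝ) + j / 2 ^ m - (z + A / 2 ^ n) * (I + i / 2 ^ m) + τ with he
  -- Three errors: the neglected digits give at most `4 * 2^-(n+s)`, the rounding of the abscissa
  -- `(|z| + 1) * 2^-m`, the rounding of the ordinate `2^-m`. As `n + s ≤ m`, they add up to the
  -- tolerance `|z| + 6`.
  have hedec : e = ((a * X - ∑' l, interceptTerm a l) - (A / 2 ^ n * X - τ)) +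
      (z + A / 2 ^ n) * (ξ - i / 2 ^ m) - (η - j / 2 ^ m) := by
    have : (J : ℝ) = (z + a) * X - (∑' l, interceptTerm a l) - η := by rw [← hy]; ring
    rw [he, this, hX]; ring
  have hele : |e| ≤ (|(z : ℝ)| + 6) * (1 / 2) ^ (n + s) := by
    have h1 : |(z + A / 2 ^ n) * (ξ - i / 2 ^ m)| ≤ (|(z : ℝ)| + 1) * (1 / 2) ^ m := by
      rw [abs_mul, abs_of_nonneg g1]
      gcongr
    have h2 : |η - j / 2 ^ m| ≤ (1 / 2) ^ m := by rwa [abs_of_nonneg g3]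
    have h3 := abs_sub (((a * X - ∑' l, interceptTerm a l) - (A / 2 ^ n * X - τ)) +
      (z + A / 2 ^ n) * (ξ - i / 2 ^ m)) (η - j / 2 ^ m)
    have h4 := abs_add_le ((a * X - ∑' l, interceptTerm a l) - (A / 2 ^ n * X - τ))
      ((z + A / 2 ^ n) * (ξ - i / 2 ^ m))
    rw [← hedec] at h3
    have h5 : (|(z : ℝ)| + 1) * (1 / 2 : ℝ) ^ m ≤ (|(z : ℝ)| + 1) * (1 / 2) ^ (n + s) := by gcongr
    linarith
  have hdef : (defect z I J s n A i j : ℝ) = 2 ^ n * 2 ^ m * 2 ^ s * e := by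
    unfold defect
    rw [h16, ← hm]
    push_cast
    rw [hfoc, he]
    field_simp
  have hfin : |defect z I J s n A i j| ≤ (((z.natAbs + 6) * 2 ^ 2 ^ (4 * s) : ℕ) : ℤ) := by
    have : |(defect z I J s n A i j : ℝ)| ≤ (|(z : ℝ)| + 6) * 2 ^ m := by
      rw [hdef, abs_mul, abs_of_pos (show (0 : ℝ) < 2 ^ n * 2 ^ m * 2 ^ s by positivity)]
      calc 2 ^ n * 2 ^ m * 2 ^ s * |e| ≤
            2 ^ n * 2 ^ m * 2 ^ s * ((|(z : ℝ)| + 6) * (1 / 2) ^ (n + s)) := by gcongr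
        _ = (|(z : ℝ)| + 6) * 2 ^ m := by
          rw [pow_add (1 / 2 : ℝ) n s, one_div, inv_pow, inv_pow]; field_simp
    rw [h16, ← hm]
    have hz : ((z.natAbs : ℤ) : ℤ) = |z| := Int.natCast_natAbs z
    push_cast
    exact_mod_cast this
  unfold stripCount
  rw [hnk]
  refine le_trans ?_ (Finset.single_le_sum (fun _ _ => Nat.zero_le _) (Finset.mem_range.2 hAlt))
  rw [if_pos hfin]

/-- The part in `[I, I + 1) × [J, J + 1)` of the lines of the family with slopes in `[z, z + 1)`. -/
def lineFamily (z I J : ℤ) : Set Plane :=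
  {q | (∃ a ∈ Ico (0 : ℝ) 1, q 1 = (z + a) * q 0 - ∑' l, interceptTerm a l) ∧
    ⌊q 0⌋ = I ∧ ⌊q 1⌋ = J}

/-! ### Null sets that cover the lines -/

theorem mem_hashSet {E : Set Plane} {p : Plane} (hp : p ∈ hashSet E) :
    p ∈ unitSquare ∧ ∃ q ∈ E, p 0 = Int.fract (q 0) ∧ p 1 = Int.fract (q 1) := by
  refine ⟨hp.1, ?_⟩
  obtain ⟨i, hi⟩ := mem_iUnion.1 hp.2
  obtain ⟨j, q, hq, rfl⟩ := mem_iUnion.1 hi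
  refine ⟨q, hq, ?_, ?_⟩
  · symm
    exact Int.fract_eq_iff.2 ⟨(hp.1 0).1, (hp.1 0).2, i, by simp⟩
  · symm
    exact Int.fract_eq_iff.2 ⟨(hp.1 1).1, (hp.1 1).2, j, by simp⟩

theorem abs_add_one_le_two_pow {I : ℤ} {s : ℕ} (hs : I.natAbs ≤ s) : |I| + 1 ≤ 2 ^ s := by
  have h1 : I.natAbs + 1 ≤ 2 ^ s := (Nat.succ_le_succ hs).trans Nat.lt_two_pow_self
  rw [← Int.natCast_natAbs]
  exact_mod_cast h1

/-- A point fails to be random as soon as it lies in one null set, so each integer unit square and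
each integer part of the slope can be handled separately, without a countable union. -/
theorem hasEEMeasureZero_lineFamily (z I J : ℤ) : HasEEMeasureZero (lineFamily z I J) := by
  set C := z.natAbs + 6 with hC
  set W : ℕ → ℕ := fun s => 2 ^ s * ∑ i ∈ Finset.range (2 ^ 16 ^ s),
    ∑ j ∈ Finset.range (2 ^ 16 ^ s), stripCount z I J C s i j with hW
  refine hasEEMeasureZero_of_weights (stripCount z I J C) (stripCountCap z I J C)
    (polyComp_stripCountCap z I J C) (fun N s i j hN => stripCountCap_eq z I J C N s i j hN)
    -- The finitely many early stages, where the strip count is not controlled, are put into the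
    -- constant.
    ((2 * C + 1) + ∑ s ∈ Finset.range (I.natAbs + 2), W s) (fun s => ?_) _ (fun p hp => ?_)
  · by_cases hs : s < I.natAbs + 2
    · have h1 : W s ≤ ∑ s ∈ Finset.range (I.natAbs + 2), W s :=
        Finset.single_le_sum (fun _ _ => Nat.zero_le _) (Finset.mem_range.2 hs)
      have h2 : 1 ≤ 4 ^ 16 ^ s := Nat.one_le_two_pow.trans (Nat.pow_le_pow_left (by norm_num) _)
      exact (h1.trans (Nat.le_add_left _ _)).trans (Nat.le_mul_of_pos_right _ h2)
    · refine (sum_stripCount_le z I J C s (by omega) (abs_add_one_le_two_pow (by omega))).trans ?_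
      exact Nat.mul_le_mul_right _ (Nat.le_add_right _ _)
  · obtain ⟨hu, q, ⟨⟨a, ha, hq⟩, hI, hJ⟩, h0, h1⟩ := mem_hashSet hp
    obtain ⟨i₀, hi₀⟩ := exists_geometric_bound
    refine Eventually.frequently ?_
    filter_upwards [eventually_ge_atTop (I.natAbs + 2), eventually_ge_atTop i₀] with s hs hs₀
    refine one_le_stripCount hi₀ (by omega) (abs_add_one_le_two_pow (by omega))
      (hs₀.trans Nat.lt_two_pow_self.le) ha (hu 0) (hu 1) ?_
    rw [h0, h1, ← hI, ← hJ, Int.floor_add_fract, Int.floor_add_fract, hq]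

theorem not_isEERandom_of_line {q : Plane} (z : ℤ) {a : ℝ} (ha : a ∈ Ico (0 : ℝ) 1)
    (hq : q 1 = (z + a) * q 0 - ∑' l, interceptTerm a l) : ¬ IsEERandom q := fun h =>
  h _ (hasEEMeasureZero_lineFamily z ⌊q 0⌋ ⌊q 1⌋) ⟨⟨a, ha, hq⟩, rfl, rfl⟩

/-- The first column of cells at level `16 ^ s` is a share `2^-16^s ≤ 2^-s` of the unit square. -/
theorem hasEEMeasureZero_vertical : HasEEMeasureZero {q : Plane | q 0 = 0} := by
  refine hasEEMeasureZero_of_weights (fun _ i _ => if i ≤ 0 then 1 else 0)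
    (fun _ _ i _ => if i ≤ 0 then 1 else 0)
    (PolyComp.ite_le (.var 2) (.const 0) (.const 1) (.const 0)) (fun _ _ _ _ _ => rfl) 1
    (fun s => ?_) _ (fun p hp => ?_)
  · have h1 : s ≤ 16 ^ s := (Nat.lt_pow_self (by norm_num)).le
    have h2 : ∑ i ∈ Finset.range (2 ^ 16 ^ s), ∑ _j ∈ Finset.range (2 ^ 16 ^ s),
        (if i ≤ 0 then 1 else 0) = 2 ^ 16 ^ s := by
      rw [Finset.sum_eq_single_of_mem 0 (Finset.mem_range.2 (by positivity))]
      · simp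
      · intro i _ hi
        simp [hi]
    rw [h2, one_mul, show (4 : ℕ) = 2 * 2 from rfl, mul_pow]
    exact Nat.mul_le_mul_right _ (Nat.pow_le_pow_right (by norm_num) h1)
  · obtain ⟨-, q, hq, h0, -⟩ := mem_hashSet hp
    have : p 0 = 0 := by rw [h0, show q 0 = 0 from hq, Int.fract_zero]
    exact (Eventually.of_forall fun s => by simp [this]).frequently

/-- When `cos θ ≠ 0`, the slope `tan θ` has an integer part `z` and a fractional part `a`; the line
of the family with these parameters is taken. -/
theorem exists_line_not_isEERandom (θ : ℝ) :
    ∃ p : Plane, ∀ q ∈ lineThrough p θ, ¬ IsEERandom q := by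
  by_cases hc : Real.cos θ = 0
  · refine ⟨0, ?_⟩
    rintro _ ⟨s, rfl⟩ h
    exact h _ hasEEMeasureZero_vertical (by simp [dirVec, hc])
  · refine ⟨!₂[0, -∑' l, interceptTerm (Int.fract (Real.tan θ)) l], ?_⟩
    rintro _ ⟨s, rfl⟩
    refine not_isEERandom_of_line ⌊Real.tan θ⌋ (a := Int.fract (Real.tan θ))
      ⟨Int.fract_nonneg _, Int.fract_lt_one _⟩ ?_
    rw [Int.floor_add_fract, Real.tan_eq_sin_div_cos]
    simp [dirVec]
    field_simp
    ring

theorem dirVec_ne_zero (θ : ℝ) : dirVec θ ≠ 0 := fun h => by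
  have h0 : Real.cos θ = 0 := by simpa [dirVec] using congrArg (fun p : Plane => p 0) h
  have h1 : Real.sin θ = 0 := by simpa [dirVec] using congrArg (fun p : Plane => p 1) h
  simpa [h0, h1] using Real.sin_sq_add_cos_sq θ

/-- A line that contains a unit segment is the line spanned by the segment. -/
theorem lineThrough_subset_of_unitSegment_subset {p p' : Plane} {θ θ' : ℝ}
    (h : unitSegment p θ ⊆ lineThrough p' θ') : lineThrough p' θ' ⊆ lineThrough p θ := by
  obtain ⟨s, hs⟩ := h (left_mem_segment ℝ _ _)
  obtain ⟨t, ht⟩ := h (right_mem_segment ℝ _ _)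
  simp only at hs ht
  have hd : dirVec θ = (t - s) • dirVec θ' := by
    rw [sub_smul, eq_sub_iff_add_eq, ← add_right_inj p', ht, ← hs]
    abel
  have hne : t - s ≠ 0 := fun h0 => dirVec_ne_zero θ (by rw [hd, h0, zero_smul])
  rintro _ ⟨c, rfl⟩
  refine ⟨(c - s) / (t - s), ?_⟩
  simp only
  rw [hd, smul_smul, div_mul_cancel₀ _ hne, ← hs, sub_smul]
  abel

theorem corollary1 :
    (∀ θ ∈ Set.Ico (0 : ℝ) (2 * Real.pi), ∃ p : Plane, ∀ q ∈ lineThrough p θ, ¬ IsEERandom q) ∧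
    (∃ S : Set (Set Plane),
      (∀ I ∈ S, ∃ p θ, I = unitSegment p θ) ∧
      (∀ θ ∈ Set.Ico (0 : ℝ) (2 * Real.pi), ∃ p : Plane, unitSegment p θ ∈ S) ∧
      IsKakeya (⋃₀ S) ∧
      ∀ q ∈ linealExtension S, ¬ IsEERandom q) := by
  refine ⟨fun θ _ => exists_line_not_isEERandom θ, ?_⟩
  choose p hp using exists_line_not_isEERandom
  refine ⟨range fun θ => unitSegment (p θ) θ, ?_, fun θ _ => ⟨p θ, θ, rfl⟩,
    fun θ _ => ⟨p θ, subset_sUnion_of_mem ⟨θ, rfl⟩⟩, ?_⟩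
  · rintro _ ⟨θ, rfl⟩
    exact ⟨_, _, rfl⟩
  -- A line containing the segment chosen for `θ` lies in the chosen line, so the lineal extension
  -- adds no further lines.
  · rintro q ⟨_, ⟨⟨p', θ', rfl⟩, _, ⟨θ, rfl⟩, hsub⟩, hq⟩
    exact hp θ q (lineThrough_subset_of_unitSegment_subset hsub hq)
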